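/- Let $p,q:\mathbb R\to\mathbb C$ be $\pi$-periodic functions of bounded variation on $[0,\pi]$, put $J=\begin{pmatrix}0&1\\-1&0\end{pmatrix}$, $Q=\begin{pmatrix}p&q\\q&-p\end{pmatrix}$ and $l(\mathbf y)=J\mathbf y'+Q\mathbf y$. Let $L(Q)$ be the operator generated by $l$ in $L^2(\mathbb R;\mathbb C^2)$ and, for $t\in\mathbb C$, let $L_t(Q)$ be the operator generated by $l$ in $L^2([0,\pi];\mathbb C^2)$ with the boundary condition $\mathbf y(\pi)=e^{i\pi t}\mathbf y(0)$ (both on their maximal domains). A point $\lambda_0\in\sigma(L(Q))$ is called a *spectral singularity* of $L(Q)$ if for every $\varepsilon>0$ there is a sequence of simple closed piecewise $C^1$ contours $\gamma_n\subset\{|z-\lambda_0|<\varepsilon\}$ such that, for each $n$ and each $t\in(-1,1]$, $\gamma_n$ encloses at most one eigenvalue of $L_t(Q)$ counted with algebraic multiplicity, and $$\lim_{n\to\infty}\ \sup_t\ \Big\|\int_{\gamma_n}(L_t(Q)-zI)^{-1}\,dz\Big\|=\infty ,$$ the supremum being over all $t\in(-1,1]$ for which $\gamma_n$ lies in the resolvent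 set of $L_t(Q)$. A point $\lambda_0$ is called an *essential spectral singularity* of $L(Q)$ if there are $t_1\in(-1,1]$ and a continuous branch $\lambda(t)$ of eigenvalues of $L_t(Q)$, defined for real $t$ near $t_1$, with $\lambda(t_1)=\lambda_0$, such that for every $\varepsilon>0$ the function $1/|\alpha(t)|$ is not integrable on $(t_1-\varepsilon,t_1+\varepsilon)$; here $\alpha(t)=(\Psi_t,\Psi_t^*)$, where $\Psi_t$ is a normalized eigenfunction of $L_t(Q)$ for $\lambda(t)$ and $\Psi_t^*$ is a normalized eigenfunction of $(L_t(Q))^*$ for $\overline{\lambda(t)}$. **Theorem.** Let $t_0\in(-1,1]$, $t_0\neq 0,1$, and let $\lambda_0$ be a multiple eigenvalue of $L_{t_0}(Q)$, that is, an eigenvalue of algebraic multiplicity at least $2$. Then $\lambda_0$ is a spectral singularity of $L(Q)$ and is not an essential spectral singularity of $L(Q)$. -/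

import Mathlib

open MeasureTheory Set Filter Topology

noncomputable section

namespace Dirac

/-! ### Unbounded operators: resolvent, spectrum, eigenvectors, multiplicity -/

section Operators

variable {E : Type*} [NormedAddCommGroup E] [NormedSpace ℂ E]

/-- The bounded operator `R` is the two-sided inverse of `T - z`. -/
def IsResolventAt (T : E →ₗ.[ℂ] E) (z : ℂ) (R : E →L[ℂ] E) : Prop :=
  (∀ f : E, ∃ h : R f ∈ T.domain, T ⟨R f, h⟩ - z • R f = f) ∧
    ∀ y : T.domain, R (T y - z • (y : E)) = y

/-- The resolvent set of `T`. -/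
def resolventSet (T : E →ₗ.[ℂ] E) : Set ℂ := {z | ∃ R : E →L[ℂ] E, IsResolventAt T z R}

/-- The spectrum of `T`. -/
def spectrum (T : E →ₗ.[ℂ] E) : Set ℂ := (resolventSet T)ᶜ

open Classical in
/-- The resolvent `(T - z)⁻¹` (zero outside the resolvent set). -/
def resolvent (T : E →ₗ.[ℂ] E) (z : ℂ) : E →L[ℂ] E :=
  if h : ∃ R : E →L[ℂ] E, IsResolventAt T z R then h.choose else 0

/-- `y` is an eigenvector of `T` with eigenvalue `z`. -/
def IsEigenvector (T : E →ₗ.[ℂ] E) (z : ℂ) (y : E) : Prop :=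
  y ≠ 0 ∧ ∃ h : y ∈ T.domain, T ⟨y, h⟩ = z • y

/-- `z` is an eigenvalue of `T`. -/
def IsEigenvalue (T : E →ₗ.[ℂ] E) (z : ℂ) : Prop := ∃ y : E, IsEigenvector T z y

/-- The kernel of `(T - z) ^ k`: a vector lies in the kernel of `(T - z) ^ (k + 1)` iff it lies in
the domain of `T` and `T - z` sends it into the kernel of `(T - z) ^ k`. -/
def kerPow (T : E →ₗ.[ℂ] E) (z : ℂ) : ℕ → Submodule ℂ E
  | 0 => ⊥
  | k + 1 =>
    (T.graph ⊓ (kerPow T z k).comap (LinearMap.snd ℂ E E - z • LinearMap.fst ℂ E E)).map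
      (LinearMap.fst ℂ E E)

/-- The algebraic multiplicity of `z` as an eigenvalue of `T`: the dimension of the space of all
root vectors (eigenvectors and associated vectors) of `T` at `z`; it is `0` if `z` is not an
eigenvalue. -/
def algMultiplicity (T : E →ₗ.[ℂ] E) (z : ℂ) : ℕ∞ :=
  Cardinal.toENat (Module.rank ℂ (⨆ k : ℕ, kerPow T z k : Submodule ℂ E))

end Operators

/-! ### The Dirac operators -/

/-- `ℂ²` with its Euclidean norm. -/
abbrev C2 : Type := EuclideanSpace ℂ (Fin 2)

/-- The space `L²(s; ℂ²)`. -/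
abbrev L2 (s : Set ℝ) : Type := Lp C2 2 (volume.restrict s)

/-- `u` is absolutely continuous on the compact subintervals of the interval `s`, with
derivative `g` almost everywhere: `u` is an indefinite integral of `g`. -/
def IsPrimitive (s : Set ℝ) (u g : ℝ → C2) : Prop :=
  ∀ a ∈ s, ∀ b ∈ s, IntervalIntegrable g volume a b ∧ u b - u a = ∫ x in a..b, g x

/-- The differential expression `J u' + Q u`, where `J = (0 1; -1 0)`, `Q = (p q; q -p)`
and `g` stands for `u'`. -/
def diracExpr (p q : ℝ → ℂ) (u g : ℝ → C2) (x : ℝ) : C2 :=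
  WithLp.toLp 2 (Matrix.mulVec !![0, 1; -1, 0] (g x).ofLp +
    Matrix.mulVec !![p x, q x; q x, -p x] (u x).ofLp)

lemma diracExpr_add (p q : ℝ → ℂ) (u g u' g' : ℝ → C2) (x : ℝ) :
    diracExpr p q (u + u') (g + g') x = diracExpr p q u g x + diracExpr p q u' g' x := by
  simp only [diracExpr, Pi.add_apply, WithLp.ofLp_add, Matrix.mulVec_add, ← WithLp.toLp_add]
  congr 1
  abel

lemma diracExpr_smul (p q : ℝ → ℂ) (c : ℂ) (u g : ℝ → C2) (x : ℝ) :
    diracExpr p q (c • u) (c • g) x = c • diracExpr p q u g x := by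
  simp only [diracExpr, Pi.smul_apply, WithLp.ofLp_smul, Matrix.mulVec_smul, ← WithLp.toLp_smul,
    smul_add]

lemma IsPrimitive.add {s : Set ℝ} {u g u' g' : ℝ → C2} (h : IsPrimitive s u g)
    (h' : IsPrimitive s u' g') : IsPrimitive s (u + u') (g + g') := by
  intro a ha b hb
  refine ⟨(h a ha b hb).1.add (h' a ha b hb).1, ?_⟩
  simp only [Pi.add_apply]
  rw [intervalIntegral.integral_add (h a ha b hb).1 (h' a ha b hb).1, ← (h a ha b hb).2,
    ← (h' a ha b hb).2]
  abel

lemma IsPrimitive.smul {s : Set ℝ} {u g : ℝ → C2} (c : ℂ) (h : IsPrimitive s u g) :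
    IsPrimitive s (c • u) (c • g) := by
  intro a ha b hb
  refine ⟨(h a ha b hb).1.smul c, ?_⟩
  simp only [Pi.smul_apply]
  rw [intervalIntegral.integral_smul, ← (h a ha b hb).2, smul_sub]

lemma isPrimitive_zero (s : Set ℝ) : IsPrimitive s 0 0 := by
  intro a _ b _
  exact ⟨intervalIntegrable_const (c := (0 : C2)), by simp⟩

/-- The graph of the operator generated in `L²(s; ℂ²)` by the differential expression on the
maximal domain, subject to the boundary conditions `bc`: the pairs `(y, f)` for which `y` is
(represented by) a locally absolutely continuous function `u` satisfying `bc`, and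
`J u' + Q u = f` almost everywhere on `s`. -/
def diracGraph (p q : ℝ → ℂ) (s : Set ℝ) (bc : Submodule ℂ (ℝ → C2)) :
    Submodule ℂ (L2 s × L2 s) where
  carrier := {yf | ∃ u g : ℝ → C2, IsPrimitive s u g ∧ u ∈ bc ∧
    yf.1 =ᵐ[volume.restrict s] u ∧ yf.2 =ᵐ[volume.restrict s] diracExpr p q u g}
  zero_mem' := by
    refine ⟨0, 0, isPrimitive_zero s, bc.zero_mem, Lp.coeFn_zero _ _ _, ?_⟩
    refine (Lp.coeFn_zero _ _ _).trans (Eventually.of_forall fun x => ?_)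
    simp [diracExpr]
  add_mem' := by
    rintro ⟨y, f⟩ ⟨y', f'⟩ ⟨u, g, h, hb, hy, hf⟩ ⟨u', g', h', hb', hy', hf'⟩
    refine ⟨u + u', g + g', h.add h', bc.add_mem hb hb', ?_, ?_⟩
    · exact (Lp.coeFn_add _ _).trans (hy.add hy')
    · refine (Lp.coeFn_add _ _).trans ?_
      filter_upwards [hf, hf'] with x hx hx'
      simp only [Pi.add_apply, diracExpr_add]
      rw [hx, hx']
  smul_mem' := by
    rintro c ⟨y, f⟩ ⟨u, g, h, hb, hy, hf⟩
    refine ⟨c • u, c • g, h.smul c, bc.smul_mem c hb, ?_, ?_⟩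
    · exact (Lp.coeFn_smul _ _).trans (hy.const_smul c)
    · refine (Lp.coeFn_smul _ _).trans ?_
      filter_upwards [hf] with x hx
      simp only [Pi.smul_apply, diracExpr_smul]
      rw [hx]

/-- The quasi-periodic boundary condition `u(π) = e^{iπt} u(0)`. -/
def quasiPeriodic (t : ℂ) : Submodule ℂ (ℝ → C2) where
  carrier := {u | u Real.pi = Complex.exp (Complex.I * Real.pi * t) • u 0}
  zero_mem' := by simp
  add_mem' := by
    intro u v hu hv
    simp only [mem_ofPred_eq, Pi.add_apply, smul_add] at *
    rw [hu, hv]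
  smul_mem' := by
    intro c u hu
    simp only [mem_ofPred_eq, Pi.smul_apply] at *
    rw [hu, smul_comm]

/-- The operator `L(Q)` in `L²(ℝ; ℂ²)`. -/
def opLine (p q : ℝ → ℂ) : L2 univ →ₗ.[ℂ] L2 univ :=
  (diracGraph p q univ ⊤).toLinearPMap

/-- The operator `L_t(Q)` in `L²([0, π]; ℂ²)`. -/
def op (p q : ℝ → ℂ) (t : ℂ) : L2 (Icc 0 Real.pi) →ₗ.[ℂ] L2 (Icc 0 Real.pi) :=
  (diracGraph p q (Icc 0 Real.pi) (quasiPeriodic t)).toLinearPMap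

/-! The two graphs are single-valued, so that they are the graphs of the two operators. -/

lemma IsPrimitive.ae_eq_zero_Icc {a b : ℝ} (hab : a < b) {u g : ℝ → C2}
    (h : IsPrimitive (Icc a b) u g) (hu : u =ᵐ[volume.restrict (Icc a b)] 0) :
    g =ᵐ[volume.restrict (Icc a b)] 0 := by
  have ha : a ∈ Icc a b := left_mem_Icc.2 hab.le
  have hb : b ∈ Icc a b := right_mem_Icc.2 hab.le
  have hI := (h a ha b hb).1
  have hcont : ContinuousOn u (Icc a b) := by
    have h1 : ContinuousOn (fun x => u a + ∫ y in a..x, g y) (Icc a b) := by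
      refine continuousOn_const.add ?_
      have := intervalIntegral.continuousOn_primitive_interval' hI left_mem_uIcc
      rwa [uIcc_of_le hab.le] at this
    refine h1.congr fun x hx => ?_
    simp [← (h a ha x hx).2]
  have h0 : EqOn u 0 (Icc a b) :=
    Measure.eqOn_Icc_of_ae_eq volume hab.ne hu hcont continuousOn_const
  have hd := hI.ae_hasDerivAt_integral
  have hne : ∀ᵐ x : ℝ, x ∉ ({a, b} : Set ℝ) :=
    (measure_eq_zero_iff_ae_notMem (μ := volume)).1 ((Set.toFinite {a, b}).measure_zero volume)
  rw [EventuallyEq, ae_restrict_iff' measurableSet_Icc]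
  filter_upwards [hd, hne] with x hx hxn hxI
  simp only [mem_insert_iff, mem_singleton_iff, not_or] at hxn
  have hxo : x ∈ Ioo a b :=
    ⟨lt_of_le_of_ne hxI.1 (Ne.symm hxn.1), lt_of_le_of_ne hxI.2 hxn.2⟩
  have hx' := hx (by rwa [uIcc_of_le hab.le]) a (by simp)
  have h2 : (fun z => ∫ y in a..z, g y) =ᶠ[𝓝 x] fun _ => (0 : C2) := by
    filter_upwards [Ioo_mem_nhds hxo.1 hxo.2] with z hz
    rw [← (h a ha z ⟨hz.1.le, hz.2.le⟩).2, h0 ⟨hz.1.le, hz.2.le⟩, h0 ha]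
    simp
  exact hx'.unique ((hasDerivAt_const x (0 : C2)).congr_of_eventuallyEq h2)

lemma IsPrimitive.ae_eq_zero_univ {u g : ℝ → C2}
    (h : IsPrimitive univ u g) (hu : u =ᵐ[volume] 0) : g =ᵐ[volume] 0 := by
  have key : ∀ n : ℕ, ∀ᵐ x : ℝ, x ∈ Icc (-(n + 1 : ℝ)) (n + 1) → g x = 0 := by
    intro n
    have hn : (-(n + 1 : ℝ)) < n + 1 := by
      have : (0 : ℝ) ≤ n := n.cast_nonneg
      linarith
    have := IsPrimitive.ae_eq_zero_Icc hn (u := u) (g := g)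
      (fun a _ b _ => h a (mem_univ _) b (mem_univ _)) (ae_restrict_of_ae hu)
    rwa [EventuallyEq, ae_restrict_iff' measurableSet_Icc] at this
  filter_upwards [ae_all_iff.2 key] with x hx
  obtain ⟨n, hn⟩ := exists_nat_ge |x|
  refine hx n ⟨?_, ?_⟩
  · have := neg_abs_le x
    linarith
  · have := le_abs_self x
    linarith

lemma diracGraph_single_valued {p q : ℝ → ℂ} {s : Set ℝ} {bc : Submodule ℂ (ℝ → C2)}
    (hs : ∀ u g : ℝ → C2, IsPrimitive s u g → u =ᵐ[volume.restrict s] 0 →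
      g =ᵐ[volume.restrict s] 0) :
    ∀ yf ∈ diracGraph p q s bc, yf.1 = 0 → yf.2 = 0 := by
  rintro ⟨y, f⟩ ⟨u, g, h, -, hy, hf⟩ h0
  have hy0 : y =ᵐ[volume.restrict s] 0 := by
    have h0' : y = 0 := h0
    rw [h0']
    exact Lp.coeFn_zero _ _ _
  have hu : u =ᵐ[volume.restrict s] 0 := hy.symm.trans hy0
  have hg := hs u g h hu
  refine Lp.ext (hf.trans ((?_ : _ =ᵐ[_] _).trans (Lp.coeFn_zero _ _ _).symm))
  filter_upwards [hu, hg] with x hx hx'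
  simp [diracExpr, hx, hx']

lemma op_graph (p q : ℝ → ℂ) (t : ℂ) :
    (op p q t).graph = diracGraph p q (Icc 0 Real.pi) (quasiPeriodic t) :=
  Submodule.toLinearPMap_graph_eq _ (diracGraph_single_valued fun _ _ h hu =>
    h.ae_eq_zero_Icc Real.pi_pos hu)

lemma opLine_graph (p q : ℝ → ℂ) : (opLine p q).graph = diracGraph p q univ ⊤ :=
  Submodule.toLinearPMap_graph_eq _ (diracGraph_single_valued fun _ _ h hu => by
    rw [Measure.restrict_univ] at hu ⊢
    exact h.ae_eq_zero_univ hu)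

/-! ### Spectral singularities -/

/-- `γ`, parametrized by `[0, 1]`, is a simple closed piecewise continuously differentiable
contour. -/
structure IsContour (γ : ℝ → ℂ) : Prop where
  continuousOn : ContinuousOn γ (Icc 0 1)
  closed : γ 0 = γ 1
  simple : InjOn γ (Ico 0 1)
  piecewise : ∃ P : Finset ℝ, ∀ a b : ℝ, 0 ≤ a → a < b → b ≤ 1 →
    Disjoint (Ioo a b) (P : Set ℝ) → ContDiffOn ℝ 1 γ (Icc a b)

/-- The contour `γ` encloses the point `z`: `z` is off `γ` and `γ` winds around it. -/
def Encloses (γ : ℝ → ℂ) (z : ℂ) : Prop :=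
  z ∉ γ '' Icc 0 1 ∧ ∫ s in (0 : ℝ)..1, deriv γ s / (γ s - z) ≠ 0

/-- The integral `e(t, γ) = ∫_γ (L_t(Q) - z)⁻¹ dz`. -/
def contourProj (p q : ℝ → ℂ) (t : ℝ) (γ : ℝ → ℂ) :
    L2 (Icc 0 Real.pi) →L[ℂ] L2 (Icc 0 Real.pi) :=
  ∫ s in (0 : ℝ)..1, deriv γ s • resolvent (op p q t) (γ s)

/-- The contour `γ` encloses at most one eigenvalue of `L_t(Q)`, counting multiplicity. -/
def EnclosesAtMostOne (p q : ℝ → ℂ) (t : ℝ) (γ : ℝ → ℂ) : Prop :=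
  {z : ℂ | IsEigenvalue (op p q t) z ∧ Encloses γ z}.Subsingleton ∧
    ∀ z : ℂ, Encloses γ z → algMultiplicity (op p q t) z ≤ 1

/-- `z₀` is a spectral singularity of `L(Q)`. -/
def IsSpectralSingularity (p q : ℝ → ℂ) (z₀ : ℂ) : Prop :=
  z₀ ∈ spectrum (opLine p q) ∧ ∀ ε : ℝ, 0 < ε → ∃ γ : ℕ → ℝ → ℂ,
    (∀ n, IsContour (γ n) ∧ γ n '' Icc 0 1 ⊆ Metric.ball z₀ ε ∧
      ∀ t ∈ Ioc (-1 : ℝ) 1, EnclosesAtMostOne p q t (γ n)) ∧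
    Tendsto (fun n => ⨆ t ∈ {t : ℝ | t ∈ Ioc (-1 : ℝ) 1 ∧
        γ n '' Icc 0 1 ⊆ resolventSet (op p q t)}, ‖contourProj p q t (γ n)‖ₑ)
      atTop (𝓝 ⊤)

/-! ### Essential spectral singularities -/

/-- On the interval `I` of real quasimomenta, `lam` is a continuous branch of eigenvalues of
`L_t(Q)`, `Ψ t` is a normalized eigenfunction of `L_t(Q)` for `lam t`, and `Ψs t` is a normalized
eigenfunction of the adjoint operator for the conjugate of `lam t`. -/
structure IsBlochBranch (p q : ℝ → ℂ) (I : Set ℝ) (lam : ℝ → ℂ)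
    (Ψ Ψs : ℝ → L2 (Icc 0 Real.pi)) : Prop where
  continuousOn : ContinuousOn lam I
  eigen : ∀ t ∈ I, IsEigenvector (op p q t) (lam t) (Ψ t)
  norm_eigen : ∀ t ∈ I, ‖Ψ t‖ = 1
  eigen_adjoint : ∀ t ∈ I, IsEigenvector (op p q t).adjoint (star (lam t)) (Ψs t)
  norm_eigen_adjoint : ∀ t ∈ I, ‖Ψs t‖ = 1

/-- `z₀` is an essential spectral singularity of `L(Q)`: it is the value at some `t₀ ∈ (-1, 1]` of
a branch of eigenvalues, defined near `t₀`, for which `1 / α`, where `α t` is the inner product of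
the normalized eigenfunctions, is not integrable on any interval `(t₀ - ε, t₀ + ε)`.
(The modulus of `α t` does not depend on the phases of the eigenfunctions.) -/
def IsESS (p q : ℝ → ℂ) (z₀ : ℂ) : Prop :=
  ∃ t₀ ∈ Ioc (-1 : ℝ) 1, ∃ δ : ℝ, 0 < δ ∧ ∃ (lam : ℝ → ℂ) (Ψ Ψs : ℝ → L2 (Icc 0 Real.pi)),
    IsBlochBranch p q (Ioo (t₀ - δ) (t₀ + δ)) lam Ψ Ψs ∧ lam t₀ = z₀ ∧
    ∀ ε : ℝ, 0 < ε →
      ∫⁻ t in Ioo (t₀ - ε) (t₀ + ε), ‖(inner ℂ (Ψs t) (Ψ t) : ℂ)‖ₑ⁻¹ = ⊤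

end Dirac

end

namespace Dirac

/-! ### Primitives of integrable functions -/

/-! Write `Δ` for the trace `discr` of the monodromy matrix `M(z)` of `J u' + Q u = z u` over one
period, and `ω = e^{iπt}`. Since `det M = 1`, the matrix `M - ω` is singular exactly when `Δ(z) = ω
+ ω⁻¹ = 2 cos πt`, and every eigenvalue of `L_t` is a root of this equation. Bounded variation
enters only through boundedness and measurability of the coefficients, so the fundamental system is
built by Volterra iteration, and `Δ` is entire with the explicit derivative `discrDeriv`.

Variation of constants and Cramer's rule give `(Δ(z) - 2 cos πt) (L_t - z)⁻¹ f = -resFun f + O(Δ(z)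
- 2 cos πt)` (`norm_discr_smul_add_resFun_le`). If `ω² ≠ 1`, then `M - ω ≠ 0`, so at an eigenvalue
the map `f ↦ resFun f` has rank one. It maps into the Bloch line, acts there as multiplication by
`Δ'(z)`, and its kernel is the range of `L_t - z`. Therefore `Δ'(z) ≠ 0` forces multiplicity at most
one (`algMultiplicity_le_one`), and the multiple eigenvalue `λ₀` satisfies `Δ'(λ₀) = 0`.

Spectral singularity. For `s` near `t₀`, `s ≠ t₀`, the open mapping theorem yields a root `w ≠ λ₀`
of `Δ(w) = 2 cos πs` close to `λ₀`, with `Δ'(w) ≠ 0`. The residue of the resolvent at `w` is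
`-resFun / Δ'(w)`. Its numerator stays away from zero by continuity while `Δ'(w)` tends to `Δ'(λ₀) =
0`, so the projections over small circles about `w` are unbounded (`norm_contourProj_ge`,
`exists_contour`). On such a circle `Δ` is injective inside, so at most one eigenvalue is enclosed
for any `t`. That `λ₀` lies in the spectrum on the line follows by cutting off a Bloch solution at
larger and larger scales (`mem_spectrum_opLine`).

No essential singularity. The element `Δ' Ψ* - resFun Ψ*` lies in the range of `L_t - λ(t)` and is
orthogonal to `Ψ*`; this gives `|Δ'(λ(t))| ≤ C |α(t)|` (`norm_discrDeriv_le`). A non-constant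
analytic function satisfies `|Δ'| ≥ c |Δ - Δ(λ₀)|^σ` near `λ₀` with some `σ < 1`, and `|Δ(λ(t)) -
Δ(λ₀)| = 2 |cos πt - cos πt₁| ≥ c |t - t₁|` because `sin πt₁ ≠ 0`. Thus `1/|α(t)| ≤ K |t -
t₁|^{-σ}`, which is integrable (`not_isESS`). -/

lemma absolutelyContinuous_ofReal {r : ℝ → ℝ} {a b : ℝ} (h : AbsolutelyContinuousOnInterval r a b) :
    AbsolutelyContinuousOnInterval (fun x => (r x : ℂ)) a b := by
  simpa [AbsolutelyContinuousOnInterval, Complex.dist_eq, ← Complex.ofReal_sub, Real.dist_eq,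
    Complex.norm_real] using h

lemma absolutelyContinuous_primitive {g : ℝ → ℂ} {a b : ℝ} (hg : IntervalIntegrable g volume a b) :
    AbsolutelyContinuousOnInterval (fun x => ∫ y in a..x, g y) a b := by
  have hre : IntervalIntegrable (fun x => (g x).re) volume a b := ⟨hg.1.re, hg.2.re⟩
  have him : IntervalIntegrable (fun x => (g x).im) volume a b := ⟨hg.1.im, hg.2.im⟩
  have h1 := absolutelyContinuous_ofReal
    (hre.absolutelyContinuousOnInterval_intervalIntegral (c := a) left_mem_uIcc)
  have h2 := absolutelyContinuous_ofReal
    (him.absolutelyContinuousOnInterval_intervalIntegral (c := a) left_mem_uIcc)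
  have h3 := h1.fun_add (h2.const_smul Complex.I)
  have key : ∀ x ∈ uIcc a b, ((∫ y in a..x, (g y).re : ℝ) : ℂ) +
      Complex.I • ((∫ y in a..x, (g y).im : ℝ) : ℂ) = ∫ y in a..x, g y := by
    intro x hx
    have hgx : IntervalIntegrable g volume a x := hg.mono_set (uIcc_subset_uIcc_left hx)
    rw [← intervalIntegral.integral_ofReal, ← intervalIntegral.integral_ofReal,
      ← intervalIntegral.integral_smul, ← intervalIntegral.integral_add]
    · refine intervalIntegral.integral_congr fun y _ => ?_
      simp [mul_comm Complex.I, Complex.re_add_im]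
    · exact ⟨hgx.1.re.ofReal, hgx.2.re.ofReal⟩
    · have him' : IntervalIntegrable (fun y => ((g y).im : ℂ)) volume a x :=
        ⟨hgx.1.im.ofReal, hgx.2.im.ofReal⟩
      exact him'.smul Complex.I
  -- Absolute continuity tests only values at endpoints inside `[a, b]`, so the pointwise identity
  -- `key` transfers it.
  rw [absolutelyContinuousOnInterval_iff] at h3 ⊢
  intro ε hε
  obtain ⟨δ, hδ, H⟩ := h3 ε hε
  refine ⟨δ, hδ, fun E hE hs => ?_⟩
  have := H E hE hs
  rw [Finset.sum_congr rfl] at this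
  · exact this
  · intro i hi
    have := hE.1 i hi
    rw [key _ this.1, key _ this.2]

/-- The product rule for indefinite integrals. -/
lemma primitive_mul {u v g h : ℝ → ℂ} {a b : ℝ} (hab : a ≤ b)
    (hg : IntervalIntegrable g volume a b) (hh : IntervalIntegrable h volume a b)
    (hu : ∀ x ∈ Icc a b, u x = u a + ∫ y in a..x, g y)
    (hv : ∀ x ∈ Icc a b, v x = v a + ∫ y in a..x, h y) :
    IntervalIntegrable (fun x => g x * v x + u x * h x) volume a b ∧
    u b * v b - u a * v a = ∫ x in a..b, (g x * v x + u x * h x) := by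
  have huc : ContinuousOn u (uIcc a b) := by
    refine ((continuousOn_const (c := u a)).add
      (intervalIntegral.continuousOn_primitive_interval' hg left_mem_uIcc)).congr ?_
    rw [uIcc_of_le hab]
    exact hu
  have hvc : ContinuousOn v (uIcc a b) := by
    refine ((continuousOn_const (c := v a)).add
      (intervalIntegral.continuousOn_primitive_interval' hh left_mem_uIcc)).congr ?_
    rw [uIcc_of_le hab]
    exact hv
  have hI : IntervalIntegrable (fun x => g x * v x + u x * h x) volume a b :=
    (hg.mul_continuousOn hvc).add (hh.continuousOn_mul huc)
  refine ⟨hI, ?_⟩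
  have hconst : AbsolutelyContinuousOnInterval (fun _ : ℝ => (1 : ℂ)) a b := by
    simpa [AbsolutelyContinuousOnInterval] using tendsto_const_nhds
  have hU : AbsolutelyContinuousOnInterval (fun x => u a • (1 : ℂ) + ∫ y in a..x, g y) a b :=
    (hconst.const_smul (u a)).fun_add (absolutelyContinuous_primitive hg)
  have hV : AbsolutelyContinuousOnInterval (fun x => v a • (1 : ℂ) + ∫ y in a..x, h y) a b :=
    (hconst.const_smul (v a)).fun_add (absolutelyContinuous_primitive hh)
  -- The product minus the integral of its formal derivative is absolutely continuous with zero
  -- derivative almost everywhere, hence constant.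
  have hW := (hU.fun_smul hV).fun_sub (absolutelyContinuous_primitive hI)
  obtain ⟨C, hC⟩ := hW.const_of_ae_hasDerivAt_zero (by
    filter_upwards [hg.ae_hasDerivAt_integral, hh.ae_hasDerivAt_integral,
      hI.ae_hasDerivAt_integral] with x h1 h2 h3 hx
    have d1 := (h1 hx a left_mem_uIcc).const_add (u a • (1 : ℂ))
    have d2 := (h2 hx a left_mem_uIcc).const_add (v a • (1 : ℂ))
    have d3 := (d1.mul d2).sub (h3 hx a left_mem_uIcc)
    refine d3.congr_deriv ?_
    rw [uIcc_of_le hab] at hx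
    rw [hu x hx, hv x hx]
    simp)
  have e1 := hC a left_mem_uIcc
  have e2 := hC b right_mem_uIcc
  have hb : b ∈ Icc a b := right_mem_Icc.2 hab
  simp only [intervalIntegral.integral_same, smul_eq_mul, mul_one, add_zero, sub_zero,
    ← hu b hb, ← hv b hb] at e1 e2
  rw [e1, ← e2]
  ring

/-! ### Volterra equations -/

section Volterra

variable {E : Type*} [NormedAddCommGroup E] [NormedSpace ℂ E]

/-- The iterates of the Volterra operator `u ↦ ∫₀ˣ A u`. -/
noncomputable def volterraIter (A : ℝ → E →L[ℂ] E) (w : ℝ → E) : ℕ → ℝ → E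
  | 0 => w
  | n + 1 => fun x => ∫ s in (0 : ℝ)..x, A s (volterraIter A w n s)

variable {A : ℝ → E →L[ℂ] E} {C : ℝ}

lemma aestronglyMeasurable_apply {μ : Measure ℝ} (hA : AEStronglyMeasurable A μ)
    {u : ℝ → E} (hu : AEStronglyMeasurable u μ) :
    AEStronglyMeasurable (fun s => A s (u s)) μ :=
  (isBoundedBilinearMap_apply (𝕜 := ℂ) (E := E) (F := E)).continuous.comp_aestronglyMeasurable
    (hA.prodMk hu)

lemma intervalIntegrable_apply (hA : AEStronglyMeasurable A volume) (hC : ∀ s, ‖A s‖ ≤ C)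
    {u : ℝ → E} {a b : ℝ} (hu : ContinuousOn u (uIcc a b)) :
    IntervalIntegrable (fun s => A s (u s)) volume a b := by
  have hm : AEStronglyMeasurable (fun s => A s (u s)) (volume.restrict (uIoc a b)) :=
    aestronglyMeasurable_apply hA.restrict
      ((hu.mono uIoc_subset_uIcc).aestronglyMeasurable measurableSet_uIoc)
  refine ((hu.norm.intervalIntegrable).const_mul C).mono_fun hm ?_
  filter_upwards with s
  have h0 : 0 ≤ C := (norm_nonneg _).trans (hC s)
  rw [Real.norm_of_nonneg (by positivity)]
  exact (A s).le_of_opNorm_le (hC s) _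

lemma volterraIter_continuous (hA : AEStronglyMeasurable A volume) (hC : ∀ s, ‖A s‖ ≤ C)
    {w : ℝ → E} (hw : Continuous w) (n : ℕ) : Continuous (volterraIter A w n) := by
  induction n with
  | zero => exact hw
  | succ n ih =>
    exact intervalIntegral.continuous_primitive
      (fun a b => intervalIntegrable_apply hA hC ih.continuousOn) 0

/-- Each iteration integrates the previous bound once, which produces the factorial and makes the
Neumann series converge for every `x`. -/
lemma volterraIter_norm_le (hC : ∀ s, ‖A s‖ ≤ C)
    {w : ℝ → E} {K : ℝ} (hK : ∀ x, ‖w x‖ ≤ K) (n : ℕ) (x : ℝ) :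
    ‖volterraIter A w n x‖ ≤ K * ((C * |x|) ^ n / n.factorial) := by
  have h0 : 0 ≤ C := (norm_nonneg _).trans (hC 0)
  have hK0 : 0 ≤ K := (norm_nonneg _).trans (hK 0)
  induction n generalizing x with
  | zero => simpa [volterraIter] using hK x
  | succ n ih =>
    have hb : ∀ s, ‖A s (volterraIter A w n s)‖ ≤ C * (K * ((C * |s|) ^ n / n.factorial)) := by
      intro s
      exact ((A s).le_of_opNorm_le (hC s) _).trans (by gcongr; exact ih s)
    have key : ∫ s in (0 : ℝ)..|x|, C * (K * ((C * |s|) ^ n / n.factorial)) =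
        K * ((C * |x|) ^ (n + 1) / (n + 1).factorial) := by
      have : ∫ s in (0 : ℝ)..|x|, C * (K * ((C * |s|) ^ n / n.factorial)) =
          ∫ s in (0 : ℝ)..|x|, (C ^ (n + 1) * K / n.factorial) * s ^ n := by
        refine intervalIntegral.integral_congr fun s hs => ?_
        rw [uIcc_of_le (abs_nonneg x)] at hs
        simp only [abs_of_nonneg hs.1]
        rw [mul_pow]; ring
      rw [this, intervalIntegral.integral_const_mul, integral_pow, Nat.factorial_succ]
      have : (n.factorial : ℝ) ≠ 0 := by positivity
      push_cast
      field_simp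
      simp only [mul_pow]
      ring
    rw [← key]
    simp only [volterraIter]
    rcases le_total 0 x with hx | hx
    · rw [abs_of_nonneg hx]
      exact intervalIntegral.norm_integral_le_of_norm_le hx
        (Eventually.of_forall fun s _ => hb s) (Continuous.intervalIntegrable (by fun_prop) _ _)
    · rw [abs_of_nonpos hx, intervalIntegral.integral_symm, norm_neg]
      have h2 : ∫ s in (0 : ℝ)..-x, C * (K * ((C * |s|) ^ n / n.factorial)) =
          ∫ s in x..0, C * (K * ((C * |s|) ^ n / n.factorial)) := by
        have := intervalIntegral.integral_comp_neg (a := x) (b := 0)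
          (fun s => C * (K * ((C * |s|) ^ n / n.factorial)))
        simpa using this.symm
      rw [h2]
      exact intervalIntegral.norm_integral_le_of_norm_le hx
        (Eventually.of_forall fun s _ => hb s) (Continuous.intervalIntegrable (by fun_prop) _ _)

/-- Solvability of the Volterra equation `u = w + ∫₀ˣ A u`. -/
lemma exists_volterra [CompleteSpace E] (hA : AEStronglyMeasurable A volume) (hC : ∀ s, ‖A s‖ ≤ C)
    {w : ℝ → E} (hw : Continuous w) {K : ℝ} (hK : ∀ x, ‖w x‖ ≤ K) :
    ∃ u : ℝ → E, Continuous u ∧ ∀ x, u x = w x + ∫ s in (0 : ℝ)..x, A s (u s) := by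
  have h0 : 0 ≤ C := (norm_nonneg _).trans (hC 0)
  have hK0 : 0 ≤ K := (norm_nonneg _).trans (hK 0)
  have hsum : ∀ x : ℝ, Summable fun n => K * ((C * |x|) ^ n / n.factorial) := fun x =>
    (Real.summable_pow_div_factorial _).mul_left K
  have hs : ∀ x, Summable fun n => volterraIter A w n x := fun x =>
    .of_norm_bounded (hsum x) fun n => volterraIter_norm_le hC hK n x
  have hcont : Continuous fun x => ∑' n, volterraIter A w n x := by
    rw [continuous_iff_continuousAt]
    intro x₀
    -- Near `x₀` the factorial bounds with `|x| ≤ |x₀| + 1` dominate uniformly.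
    have : ContinuousOn (fun x => ∑' n, volterraIter A w n x) (Ioo (-(|x₀| + 1)) (|x₀| + 1)) := by
      refine continuousOn_tsum (u := fun n : ℕ => K * ((C * (|x₀| + 1)) ^ n / n.factorial))
        (fun n => (volterraIter_continuous hA hC hw n).continuousOn)
        ((Real.summable_pow_div_factorial _).mul_left K) ?_
      intro n x hx
      refine (volterraIter_norm_le hC hK n x).trans ?_
      gcongr
      exact (abs_lt.2 hx).le
    refine this.continuousAt (Ioo_mem_nhds ?_ ?_)
    · linarith [neg_abs_le x₀]
    · linarith [le_abs_self x₀]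
  refine ⟨fun x => ∑' n, volterraIter A w n x, hcont, fun x => ?_⟩
  simp only
  -- The zeroth term is `w`; the tail is the Volterra operator applied to the whole series, once sum
  -- and integral are exchanged.
  rw [(hs x).tsum_eq_zero_add]
  congr 1
  simp only [volterraIter]
  refine (intervalIntegral.hasSum_integral_of_dominated_convergence
    (fun n _ => C * (K * ((C * |x|) ^ n / n.factorial))) ?_ ?_ ?_ ?_ ?_).tsum_eq
  · intro n
    exact aestronglyMeasurable_apply hA.restrict
      (volterraIter_continuous hA hC hw n).aestronglyMeasurable
  · intro n
    filter_upwards with s hs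
    refine ((A s).le_of_opNorm_le (hC s) _).trans ?_
    gcongr
    refine (volterraIter_norm_le hC hK n s).trans ?_
    have : |s| ≤ |x| := by
      rcases le_total 0 x with hx | hx
      · rw [uIoc_of_le hx] at hs
        rw [abs_of_pos hs.1, abs_of_nonneg hx]; exact hs.2
      · rw [uIoc_of_ge hx] at hs
        rw [abs_of_nonpos hs.2, abs_of_nonpos hx]; linarith [hs.1]
    gcongr
  · exact Eventually.of_forall fun _ _ => (hsum x).mul_left C
  · exact intervalIntegrable_const
  · filter_upwards with s _
    exact (A s).hasSum (hs s).hasSum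

end Volterra

/-- Growth estimate for solutions of a Volterra inequality. -/
lemma norm_le_of_volterra {E : Type*} [NormedAddCommGroup E] {u : ℝ → E} {b c C : ℝ} (hC : 0 < C)
    (hu : ContinuousOn u (Icc 0 b))
    (h : ∀ x ∈ Icc 0 b, ‖u x‖ ≤ c + C * ∫ s in (0 : ℝ)..x, ‖u s‖) :
    ∀ x ∈ Icc 0 b, ‖u x‖ ≤ 2 * c * Real.exp (2 * C * x) := by
  intro x₁ hx₁
  -- In the weighted maximum norm with weight `exp (-2Cx)` the integral operator `C ∫` has norm at
  -- most one half, so its term can be absorbed on the left.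
  have hw : ContinuousOn (fun x => Real.exp (-(2 * C * x)) * ‖u x‖) (Icc 0 b) := by fun_prop
  obtain ⟨x₀, hx₀, hmax⟩ := isCompact_Icc.exists_isMaxOn ⟨x₁, hx₁⟩ hw
  set m := Real.exp (-(2 * C * x₀)) * ‖u x₀‖ with hm
  have hle : ∀ s ∈ Icc 0 b, ‖u s‖ ≤ m * Real.exp (2 * C * s) := by
    intro s hs
    have := hmax hs
    simp only [mem_ofPred_eq] at this
    calc ‖u s‖ = Real.exp (-(2 * C * s)) * ‖u s‖ * Real.exp (2 * C * s) := by
          rw [mul_right_comm, ← Real.exp_add]; simp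
      _ ≤ m * Real.exp (2 * C * s) := by gcongr
  have hm0 : 0 ≤ m := by positivity
  have hint : ∫ s in (0 : ℝ)..x₀, ‖u s‖ ≤ m * Real.exp (2 * C * x₀) / (2 * C) := by
    calc ∫ s in (0 : ℝ)..x₀, ‖u s‖ ≤ ∫ s in (0 : ℝ)..x₀, m * Real.exp (2 * C * s) := by
          refine intervalIntegral.integral_mono_on hx₀.1 ?_ ?_ ?_
          · refine ContinuousOn.intervalIntegrable ?_
            rw [uIcc_of_le hx₀.1]
            exact (hu.mono (Icc_subset_Icc_right hx₀.2)).norm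
          · exact Continuous.intervalIntegrable (by fun_prop) _ _
          · exact fun s hs => hle s ⟨hs.1, hs.2.trans hx₀.2⟩
      _ = m * ((Real.exp (2 * C * x₀) - 1) / (2 * C)) := by
          rw [intervalIntegral.integral_const_mul]
          have : (2 * C) ≠ 0 := by positivity
          rw [intervalIntegral.integral_comp_mul_left (fun x => Real.exp x) this, integral_exp]
          simp [div_eq_inv_mul]
      _ ≤ m * Real.exp (2 * C * x₀) / (2 * C) := by
          rw [mul_div_assoc]
          gcongr
          linarith
  -- At the maximum point the inequality is `m e ≤ c + m e / 2` with `e = exp (2 C x₀) ≥ 1`, and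
  -- only the second alternative is derived.
  have h1 : m ≤ c + m / 2 ∨ m ≤ 2 * c := by
    have h2 := h x₀ hx₀
    have h3 : ‖u x₀‖ = m * Real.exp (2 * C * x₀) := by
      rw [hm, mul_right_comm, ← Real.exp_add]; simp
    have h4 : C * (m * Real.exp (2 * C * x₀) / (2 * C)) = m * Real.exp (2 * C * x₀) / 2 := by
      field_simp
    have h5 : m * Real.exp (2 * C * x₀) ≤ c + m * Real.exp (2 * C * x₀) / 2 := by
      rw [← h3, h3, ← h4]
      calc _ = ‖u x₀‖ := h3.symm
        _ ≤ _ := h2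
        _ ≤ _ := by gcongr
    have he : 1 ≤ Real.exp (2 * C * x₀) := Real.one_le_exp (by have := hx₀.1; positivity)
    right
    nlinarith
  have h2 : m ≤ 2 * c := by rcases h1 with h1 | h1 <;> linarith
  exact (hle x₁ hx₁).trans (by gcongr)

/-! ### Periodic functions of bounded variation -/

/-- Periodicity moves every point into `[0, π)`, where `f` differs from `f 0` by at most the total
variation. -/
lemma exists_bound_of_boundedVariation {f : ℝ → ℂ} (hf : Function.Periodic f Real.pi)
    (hv : BoundedVariationOn f (Icc 0 Real.pi)) : ∃ B, ∀ x, ‖f x‖ ≤ B := by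
  refine ⟨‖f 0‖ + (eVariationOn f (Icc 0 Real.pi)).toReal, fun x => ?_⟩
  obtain ⟨y, hy, hxy⟩ := hf.exists_mem_Ico₀ Real.pi_pos x
  rw [hxy]
  have := hv.dist_le (Ico_subset_Icc_self hy) (left_mem_Icc.2 Real.pi_pos.le)
  rw [dist_eq_norm] at this
  calc ‖f y‖ = ‖f 0 + (f y - f 0)‖ := by congr 1; ring
    _ ≤ _ := (norm_add_le _ _).trans (by gcongr)

lemma intervalIntegrable_of_boundedVariation_real {f : ℝ → ℝ} {a b : ℝ} (hab : a ≤ b)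
    (hv : BoundedVariationOn f (Icc a b)) : IntervalIntegrable f volume a b := by
  obtain ⟨f₁, f₂, h₁, h₂, rfl⟩ := hv.locallyBoundedVariationOn.exists_monotoneOn_sub_monotoneOn
  rw [← uIcc_of_le hab] at h₁ h₂
  exact h₁.intervalIntegrable.sub h₂.intervalIntegrable

/-- Real and imaginary parts are differences of monotone functions on one period, hence integrable
there; periodicity carries this to all bounded intervals, which exhaust the line. -/
lemma aestronglyMeasurable_of_boundedVariation {f : ℝ → ℂ} (hf : Function.Periodic f Real.pi)
    (hv : BoundedVariationOn f (Icc 0 Real.pi)) : AEStronglyMeasurable f volume := by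
  have hre : BoundedVariationOn (fun x => (f x).re) (Icc 0 Real.pi) :=
    (LipschitzWith.of_dist_le_mul (K := 1) fun x y => by
      simpa [dist_eq_norm] using Complex.abs_re_le_norm (x - y) :
      LipschitzWith 1 Complex.re).comp_boundedVariationOn hv
  have him : BoundedVariationOn (fun x => (f x).im) (Icc 0 Real.pi) :=
    (LipschitzWith.of_dist_le_mul (K := 1) fun x y => by
      simpa [dist_eq_norm] using Complex.abs_im_le_norm (x - y) :
      LipschitzWith 1 Complex.im).comp_boundedVariationOn hv
  have hre' := intervalIntegrable_of_boundedVariation_real Real.pi_pos.le hre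
  have him' := intervalIntegrable_of_boundedVariation_real Real.pi_pos.le him
  have hI : IntervalIntegrable f volume 0 Real.pi := by
    have h1 : IntervalIntegrable (fun x => ((f x).re : ℂ)) volume 0 Real.pi :=
      ⟨hre'.1.ofReal, hre'.2.ofReal⟩
    have h2 : IntervalIntegrable (fun x => ((f x).im : ℂ)) volume 0 Real.pi :=
      ⟨him'.1.ofReal, him'.2.ofReal⟩
    refine (h1.add (h2.mul_const Complex.I)).congr ?_
    exact fun x _ => Complex.re_add_im _
  have h := hf.intervalIntegrable₀ Real.pi_ne_zero hI
  have hU : (⋃ n : ℕ, Ioc (-(n : ℝ)) n) = univ := by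
    refine eq_univ_of_forall fun x => ?_
    obtain ⟨n, hn⟩ := exists_nat_gt |x|
    exact mem_iUnion.2 ⟨n, (abs_lt.1 hn).1, (abs_lt.1 hn).2.le⟩
  rw [← Measure.restrict_univ (μ := (volume : Measure ℝ)), ← hU, aestronglyMeasurable_iUnion_iff]
  exact fun n => (h (-n) n).1.aestronglyMeasurable


/-! ### The Dirac system -/

/-- The bilinear (not sesquilinear) scalar product of `ℂ²`. -/
def dot (u v : C2) : ℂ := u 0 * v 0 + u 1 * v 1

/-- The determinant of two vectors of `ℂ²`. -/
def wron (u v : C2) : ℂ := u 0 * v 1 - u 1 * v 0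

/-- `u` solves `J u' + Q u = z u + f` almost everywhere on `s`. -/
def IsSol (p q : ℝ → ℂ) (s : Set ℝ) (z : ℂ) (f u : ℝ → C2) : Prop :=
  ∃ g : ℝ → C2, IsPrimitive s u g ∧
    ∀ᵐ x ∂volume.restrict s, diracExpr p q u g x = z • u x + f x

/-- The entries of `Q` are measurable and bounded by `B`. -/
structure BddPotential (p q : ℝ → ℂ) (B : ℝ) : Prop where
  meas_p : AEStronglyMeasurable p volume
  meas_q : AEStronglyMeasurable q volume
  bound_p : ∀ x, ‖p x‖ ≤ B
  bound_q : ∀ x, ‖q x‖ ≤ B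

lemma diracExpr_apply_zero (p q : ℝ → ℂ) (u g : ℝ → C2) (x : ℝ) :
    diracExpr p q u g x 0 = g x 1 + (p x * u x 0 + q x * u x 1) := by
  simp [diracExpr, dotProduct, Fin.sum_univ_two]

lemma diracExpr_apply_one (p q : ℝ → ℂ) (u g : ℝ → C2) (x : ℝ) :
    diracExpr p q u g x 1 = -g x 0 + (q x * u x 0 - p x * u x 1) := by
  simp [diracExpr, dotProduct, Fin.sum_univ_two]
  ring

lemma C2.ext {u v : C2} (h0 : u 0 = v 0) (h1 : u 1 = v 1) : u = v := by
  ext i; fin_cases i <;> assumption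

lemma norm_apply_le (u : C2) (i : Fin 2) : ‖u i‖ ≤ ‖u‖ := PiLp.norm_apply_le u i

lemma norm_dot_le (u v : C2) : ‖dot u v‖ ≤ 2 * (‖u‖ * ‖v‖) := by
  unfold dot
  refine (norm_add_le _ _).trans ?_
  rw [norm_mul, norm_mul, two_mul]
  gcongr <;> exact norm_apply_le _ _

/-- Cramer's rule in the plane: it expands a vector in a basis whose determinant is known. -/
lemma wron_self_expand (u v w : C2) : wron v w • u = wron u w • v - wron u v • w := by
  apply C2.ext <;> simp [wron] <;> ring

section Primitive

variable {s : Set ℝ} {u g : ℝ → C2} {a b : ℝ}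

lemma IsPrimitive.mono {s' : Set ℝ} (h : IsPrimitive s u g) (hs : s' ⊆ s) : IsPrimitive s' u g :=
  fun a ha b hb => h a (hs ha) b (hs hb)

lemma IsPrimitive.continuousOn (h : IsPrimitive s u g) (hs : Icc a b ⊆ s) :
    ContinuousOn u (Icc a b) := by
  rcases le_or_gt a b with hab | hab
  · have ha : a ∈ s := hs (left_mem_Icc.2 hab)
    have h1 := intervalIntegral.continuousOn_primitive_interval'
      (h a ha b (hs (right_mem_Icc.2 hab))).1 left_mem_uIcc
    rw [uIcc_of_le hab] at h1
    refine ((continuousOn_const (c := u a)).add h1).congr fun x hx => ?_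
    simp [← (h a ha x (hs hx)).2]
  · simp [Icc_eq_empty hab.not_ge]

lemma IsPrimitive.coord (h : IsPrimitive s u g) (hs : Icc a b ⊆ s) (hab : a ≤ b) (i : Fin 2) :
    IntervalIntegrable (fun x => g x i) volume a b ∧
      ∀ x ∈ Icc a b, u x i = u a i + ∫ y in a..x, g y i := by
  have ha : a ∈ s := hs (left_mem_Icc.2 hab)
  let L : C2 →L[ℂ] ℂ := EuclideanSpace.proj i
  have hI := (h a ha b (hs (right_mem_Icc.2 hab))).1
  refine ⟨⟨L.integrable_comp hI.1, L.integrable_comp hI.2⟩, fun x hx => ?_⟩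
  have h1 := h a ha x (hs hx)
  have h2 := L.intervalIntegral_comp_comm h1.1
  rw [← h1.2] at h2
  have h3 : ∫ y in a..x, g y i = L (u x - u a) := h2
  rw [h3]
  simp [L]

end Primitive

section Solutions

variable {p q : ℝ → ℂ} {s : Set ℝ} {z : ℂ} {f k u v : ℝ → C2} {a b : ℝ}

lemma IsSol.mono {s' : Set ℝ} (h : IsSol p q s z f u) (hs : s' ⊆ s) : IsSol p q s' z f u := by
  obtain ⟨g, hg, hd⟩ := h
  exact ⟨g, hg.mono hs, ae_restrict_of_ae_restrict_of_subset hs hd⟩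

lemma IsSol.congr (h : IsSol p q s z f u) (hf : f =ᵐ[volume.restrict s] k) :
    IsSol p q s z k u := by
  obtain ⟨g, hg, hd⟩ := h
  refine ⟨g, hg, ?_⟩
  filter_upwards [hd, hf] with x h1 h2
  rw [h1, h2]

lemma IsSol.add (h : IsSol p q s z f u) (h' : IsSol p q s z k v) :
    IsSol p q s z (f + k) (u + v) := by
  obtain ⟨g, hg, hd⟩ := h
  obtain ⟨g', hg', hd'⟩ := h'
  refine ⟨g + g', hg.add hg', ?_⟩
  filter_upwards [hd, hd'] with x h1 h2
  rw [diracExpr_add, h1, h2]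
  simp only [Pi.add_apply, smul_add]
  abel

lemma IsSol.smul (c : ℂ) (h : IsSol p q s z f u) : IsSol p q s z (c • f) (c • u) := by
  obtain ⟨g, hg, hd⟩ := h
  refine ⟨c • g, hg.smul c, ?_⟩
  filter_upwards [hd] with x h1
  rw [diracExpr_smul, h1]
  simp only [Pi.smul_apply, smul_add]
  rw [smul_comm]

/-- Shifting the spectral parameter. -/
lemma IsSol.shift (h : IsSol p q s z f u) (ζ : ℂ) : IsSol p q s ζ (f + (z - ζ) • u) u := by
  obtain ⟨g, hg, hd⟩ := h
  refine ⟨g, hg, ?_⟩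
  filter_upwards [hd] with x h1
  rw [h1]
  change z • u x + f x = ζ • u x + (f x + (z - ζ) • u x)
  rw [sub_smul]
  abel

lemma IsSol.continuousOn (h : IsSol p q s z f u) (hs : Icc a b ⊆ s) : ContinuousOn u (Icc a b) :=
  h.choose_spec.1.continuousOn hs

/-- Lagrange's identity. -/
lemma IsSol.lagrange (hu : IsSol p q s z f u) (hv : IsSol p q s z k v) (hab : a ≤ b)
    (hs : Icc a b ⊆ s) :
    wron (u b) (v b) - wron (u a) (v a) =
      ∫ x in a..b, (dot (u x) (k x) - dot (f x) (v x)) := by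
  obtain ⟨g, hg, hd⟩ := hu
  obtain ⟨h, hh, hd'⟩ := hv
  have g0 := hg.coord hs hab 0
  have g1 := hg.coord hs hab 1
  have h0 := hh.coord hs hab 0
  have h1 := hh.coord hs hab 1
  have A := primitive_mul hab g0.1 h1.1 g0.2 h1.2
  have B := primitive_mul hab g1.1 h0.1 g1.2 h0.2
  have C : wron (u b) (v b) - wron (u a) (v a) =
      (u b 0 * v b 1 - u a 0 * v a 1) - (u b 1 * v b 0 - u a 1 * v a 0) := by
    simp only [wron]; ring
  rw [C, A.2, B.2, ← intervalIntegral.integral_sub A.1 B.1]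
  refine intervalIntegral.integral_congr_ae ?_
  rw [uIoc_of_le hab, ← ae_restrict_iff' measurableSet_Ioc]
  filter_upwards [ae_restrict_of_ae_restrict_of_subset (Ioc_subset_Icc_self.trans hs) hd,
    ae_restrict_of_ae_restrict_of_subset (Ioc_subset_Icc_self.trans hs) hd'] with x hx hx'
  have e0 := congrArg (fun w : C2 => w 0) hx
  have e1 := congrArg (fun w : C2 => w 1) hx
  have e0' := congrArg (fun w : C2 => w 0) hx'
  have e1' := congrArg (fun w : C2 => w 1) hx'
  simp only [diracExpr_apply_zero, diracExpr_apply_one, PiLp.add_apply, PiLp.smul_apply,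
    smul_eq_mul] at e0 e1 e0' e1'
  simp only [dot]
  -- This is the second equation paired with `u` minus the first paired with `v`. The terms with `z`
  -- and the symmetric matrix `Q` cancel, leaving the derivative of `wron u v`.
  linear_combination (-v x 1) * e1 + u x 0 * e0' - v x 0 * e0 + u x 1 * e1'

end Solutions

/-! ### Existence -/

/-- Multiplication by `-J`. -/
noncomputable def rotCLM : C2 →L[ℂ] C2 :=
  Matrix.toEuclideanCLM (n := Fin 2) (𝕜 := ℂ) !![0, -1; 1, 0]

lemma rotCLM_apply_zero (u : C2) : rotCLM u 0 = -u 1 := by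
  simp [rotCLM, Matrix.ofLp_toEuclideanCLM, Matrix.mulVec, dotProduct, Fin.sum_univ_two]

lemma rotCLM_apply_one (u : C2) : rotCLM u 1 = u 0 := by
  simp [rotCLM, Matrix.ofLp_toEuclideanCLM, Matrix.mulVec, dotProduct, Fin.sum_univ_two]

/-- The coefficient matrix `-J (z - Q)` of the system `u' = -J (z - Q) u`. -/
noncomputable def coefCLM (p q : ℝ → ℂ) (z : ℂ) (x : ℝ) : C2 →L[ℂ] C2 :=
  z • rotCLM + (p x • Matrix.toEuclideanCLM (n := Fin 2) (𝕜 := ℂ) !![0, -1; -1, 0] +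
    q x • Matrix.toEuclideanCLM (n := Fin 2) (𝕜 := ℂ) !![1, 0; 0, -1])

lemma coefCLM_apply_zero (p q : ℝ → ℂ) (z : ℂ) (x : ℝ) (u : C2) :
    coefCLM p q z x u 0 = -z * u 1 - p x * u 1 + q x * u 0 := by
  simp [coefCLM, rotCLM_apply_zero, Matrix.ofLp_toEuclideanCLM, Matrix.mulVec, dotProduct,
    Fin.sum_univ_two]
  ring

lemma coefCLM_apply_one (p q : ℝ → ℂ) (z : ℂ) (x : ℝ) (u : C2) :
    coefCLM p q z x u 1 = z * u 0 - p x * u 0 - q x * u 1 := by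
  simp [coefCLM, rotCLM_apply_one, Matrix.ofLp_toEuclideanCLM, Matrix.mulVec, dotProduct,
    Fin.sum_univ_two]
  ring

/-- A bound for the coefficient matrix when `‖z‖ ≤ R`. -/
noncomputable def coefBound (B R : ℝ) : ℝ :=
  R * ‖rotCLM‖ + (B * ‖Matrix.toEuclideanCLM (n := Fin 2) (𝕜 := ℂ) !![0, -1; -1, 0]‖ +
    B * ‖Matrix.toEuclideanCLM (n := Fin 2) (𝕜 := ℂ) !![1, 0; 0, -1]‖) + 1

namespace BddPotential

variable {p q : ℝ → ℂ} {B : ℝ} (h : BddPotential p q B)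

include h

lemma bound_nonneg : 0 ≤ B := (norm_nonneg _).trans (h.bound_p 0)

lemma norm_coefCLM_le {z : ℂ} {R : ℝ} (hz : ‖z‖ ≤ R) (x : ℝ) :
    ‖coefCLM p q z x‖ ≤ coefBound B R := by
  have h1 := h.bound_p x
  have h2 := h.bound_q x
  unfold coefCLM coefBound
  refine (norm_add_le _ _).trans ?_
  rw [add_assoc]
  refine add_le_add ?_ (((norm_add_le _ _).trans ?_).trans (le_add_of_nonneg_right zero_le_one))
  · rw [norm_smul]; gcongr
  · rw [norm_smul, norm_smul]; gcongr

/-- The summand `1` in `coefBound` serves this strict inequality, which `norm_le_of_volterra`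
requires. -/
lemma coefBound_pos {R : ℝ} (hR : 0 ≤ R) : 0 < coefBound B R := by
  have := h.bound_nonneg
  unfold coefBound
  positivity

lemma aestronglyMeasurable_coefCLM (z : ℂ) : AEStronglyMeasurable (coefCLM p q z) volume :=
  aestronglyMeasurable_const.add ((h.meas_p.smul_const _).add (h.meas_q.smul_const _))

/-- The initial value problem for the inhomogeneous system. -/
lemma exists_isSol (z : ℂ) {f : ℝ → C2} (hf : Integrable f volume) (c : C2) :
    ∃ u, Continuous u ∧ IsSol p q univ z f u ∧ u 0 = c := by
  have hT : Integrable (fun x => rotCLM (f x)) volume := rotCLM.integrable_comp hf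
  have hTi : ∀ a b, IntervalIntegrable (fun x => rotCLM (f x)) volume a b :=
    fun a b => hT.intervalIntegrable
  have hA := h.aestronglyMeasurable_coefCLM z
  have hC := h.norm_coefCLM_le (le_refl ‖z‖)
  obtain ⟨u, huc, hu⟩ := exists_volterra hA hC
    -- The system in the form `u' = -J f - J (z - Q) u`: the source and the initial value form the
    -- free term, bounded because `f` is integrable on the line.
    (w := fun x => c + ∫ s in (0 : ℝ)..x, rotCLM (f s))
    (continuous_const.add (intervalIntegral.continuous_primitive hTi 0))
    (K := ‖c‖ + ∫ s, ‖rotCLM (f s)‖) (fun x => by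
      refine (norm_add_le _ _).trans ?_
      gcongr
      refine (intervalIntegral.norm_integral_le_integral_norm_uIoc).trans ?_
      exact setIntegral_le_integral hT.norm (Eventually.of_forall fun _ => norm_nonneg _))
  have hAi : ∀ a b, IntervalIntegrable (fun x => coefCLM p q z x (u x)) volume a b :=
    fun a b => intervalIntegrable_apply hA hC huc.continuousOn
  refine ⟨u, huc, ⟨fun x => rotCLM (f x) + coefCLM p q z x (u x), ?_, ?_⟩, by simp [hu 0]⟩
  · intro a _ b _
    refine ⟨(hTi a b).add (hAi a b), ?_⟩
    rw [intervalIntegral.integral_add (hTi a b) (hAi a b), hu a, hu b,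
      ← intervalIntegral.integral_interval_sub_left (hTi 0 b) (hTi 0 a),
      ← intervalIntegral.integral_interval_sub_left (hAi 0 b) (hAi 0 a)]
    abel
  · filter_upwards with x
    apply C2.ext
    · simp only [diracExpr_apply_zero, PiLp.add_apply, PiLp.smul_apply, smul_eq_mul,
        rotCLM_apply_one, coefCLM_apply_one]
      ring
    · simp only [diracExpr_apply_one, PiLp.add_apply, PiLp.smul_apply, smul_eq_mul,
        rotCLM_apply_zero, coefCLM_apply_zero]
      ring

/-- Growth of the solutions of the homogeneous system. -/
lemma norm_le_exp {z : ℂ} {R b : ℝ} (hz : ‖z‖ ≤ R) {u : ℝ → C2}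
    (hu : IsSol p q (Icc 0 b) z 0 u) :
    ∀ x ∈ Icc 0 b, ‖u x‖ ≤ 2 * ‖u 0‖ * Real.exp (2 * coefBound B R * x) := by
  have hcont := hu.continuousOn (a := 0) (b := b) subset_rfl
  obtain ⟨g, hg, hd⟩ := hu
  refine norm_le_of_volterra (h.coefBound_pos ((norm_nonneg _).trans hz)) hcont ?_
  intro x hx
  have h0 : (0 : ℝ) ∈ Icc 0 b := ⟨le_rfl, hx.1.trans hx.2⟩
  have h1 := (hg 0 h0 x hx).2
  have h2 : u x = u 0 + ∫ s in (0 : ℝ)..x, g s := by rw [← h1]; abel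
  rw [h2, ← intervalIntegral.integral_const_mul]
  refine (norm_add_le _ _).trans ?_
  gcongr
  refine intervalIntegral.norm_integral_le_of_norm_le hx.1 ?_ ?_
  · rw [← ae_restrict_iff' measurableSet_Ioc]
    filter_upwards [ae_restrict_of_ae_restrict_of_subset
      (Ioc_subset_Icc_self.trans (Icc_subset_Icc_right hx.2)) hd] with s hs
    have : g s = coefCLM p q z s (u s) := by
      have e0 := congrArg (fun w : C2 => w 0) hs
      have e1 := congrArg (fun w : C2 => w 1) hs
      simp only [diracExpr_apply_zero, diracExpr_apply_one, PiLp.add_apply, PiLp.smul_apply,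
        smul_eq_mul, Pi.zero_apply, PiLp.zero_apply] at e0 e1
      apply C2.ext
      · rw [coefCLM_apply_zero]; linear_combination -e1
      · rw [coefCLM_apply_one]; linear_combination e0
    rw [this]
    exact (coefCLM p q z s).le_of_opNorm_le (h.norm_coefCLM_le hz s) _
  · refine ContinuousOn.intervalIntegrable ?_
    rw [uIcc_of_le hx.1]
    exact continuousOn_const.mul (hcont.mono (Icc_subset_Icc_right hx.2)).norm

end BddPotential


/-! ### The fundamental system -/

open Classical in
/-- The solution on the line of `J u' + Q u = z u` with `u 0 = c`. -/
noncomputable def fund (p q : ℝ → ℂ) (z : ℂ) (c : C2) : ℝ → C2 :=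
  if h : ∃ u, Continuous u ∧ IsSol p q univ z 0 u ∧ u 0 = c then h.choose else 0

/-- The solution with initial value `(1, 0)`. -/
noncomputable def phi (p q : ℝ → ℂ) (z : ℂ) : ℝ → C2 := fund p q z !₂[1, 0]

/-- The solution with initial value `(0, 1)`. -/
noncomputable def psi (p q : ℝ → ℂ) (z : ℂ) : ℝ → C2 := fund p q z !₂[0, 1]

/-- The bilinear pairing of functions on `[0, π]`. -/
noncomputable def pair (f u : ℝ → C2) : ℂ := ∫ x in (0 : ℝ)..Real.pi, dot (f x) (u x)

/-- The Hill discriminant: the trace of the monodromy matrix. -/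
noncomputable def discr (p q : ℝ → ℂ) (z : ℂ) : ℂ :=
  phi p q z Real.pi 0 + psi p q z Real.pi 1

/-- The derivative of the discriminant. -/
noncomputable def discrDeriv (p q : ℝ → ℂ) (z : ℂ) : ℂ :=
  psi p q z Real.pi 0 * pair (phi p q z) (phi p q z) +
    (psi p q z Real.pi 1 - phi p q z Real.pi 0) * pair (phi p q z) (psi p q z) -
    phi p q z Real.pi 1 * pair (psi p q z) (psi p q z)

lemma dot_comm (u v : C2) : dot u v = dot v u := by unfold dot; ring

lemma pair_comm (f u : ℝ → C2) : pair f u = pair u f := by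
  unfold pair; simp_rw [dot_comm]

lemma intervalIntegrable_dot {f u : ℝ → C2} {a b : ℝ} (hf : IntervalIntegrable f volume a b)
    (hu : ContinuousOn u (uIcc a b)) :
    IntervalIntegrable (fun x => dot (f x) (u x)) volume a b := by
  have h : ∀ i : Fin 2, IntervalIntegrable (fun x => f x i) volume a b := fun i =>
    ⟨(EuclideanSpace.proj (𝕜 := ℂ) i).integrable_comp hf.1,
      (EuclideanSpace.proj (𝕜 := ℂ) i).integrable_comp hf.2⟩
  have hc : ∀ i : Fin 2, ContinuousOn (fun x => u x i) (uIcc a b) := fun i =>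
    (EuclideanSpace.proj (𝕜 := ℂ) i).continuous.comp_continuousOn hu
  exact ((h 0).mul_continuousOn (hc 0)).add ((h 1).mul_continuousOn (hc 1))

lemma pair_add_smul {f u v : ℝ → C2} (hf : IntervalIntegrable f volume 0 Real.pi)
    (hu : ContinuousOn u (Icc 0 Real.pi)) (hv : ContinuousOn v (Icc 0 Real.pi)) (a b : ℂ) :
    pair f (fun x => a • u x + b • v x) = a * pair f u + b * pair f v := by
  rw [← uIcc_of_le Real.pi_pos.le] at hu hv
  unfold pair
  rw [← intervalIntegral.integral_const_mul, ← intervalIntegral.integral_const_mul,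
    ← intervalIntegral.integral_add ((intervalIntegrable_dot hf hu).const_mul _)
      ((intervalIntegrable_dot hf hv).const_mul _)]
  refine intervalIntegral.integral_congr fun x _ => ?_
  simp [dot]; ring

lemma norm_integral_dot_le {f u : ℝ → C2} (hf : IntervalIntegrable f volume 0 Real.pi)
    {K : ℝ} (hu : ∀ x ∈ Icc 0 Real.pi, ‖u x‖ ≤ K) {x : ℝ} (hx : x ∈ Icc 0 Real.pi) :
    ‖∫ s in (0 : ℝ)..x, dot (f s) (u s)‖ ≤ 2 * K * ∫ s in (0 : ℝ)..Real.pi, ‖f s‖ := by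
  have hK : 0 ≤ K := (norm_nonneg _).trans (hu x hx)
  have h1 : ‖∫ s in (0 : ℝ)..x, dot (f s) (u s)‖ ≤ ∫ s in (0 : ℝ)..x, 2 * K * ‖f s‖ := by
    refine intervalIntegral.norm_integral_le_of_norm_le hx.1 ?_ ?_
    · refine Eventually.of_forall fun s hs => (norm_dot_le _ _).trans ?_
      have := hu s ⟨hs.1.le, hs.2.trans hx.2⟩
      calc 2 * (‖f s‖ * ‖u s‖) ≤ 2 * (‖f s‖ * K) := by gcongr
        _ = 2 * K * ‖f s‖ := by ring
    · refine (hf.norm.const_mul _).mono_set ?_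
      rw [uIcc_of_le hx.1, uIcc_of_le Real.pi_pos.le]
      exact Icc_subset_Icc_right hx.2
  refine h1.trans ?_
  rw [intervalIntegral.integral_const_mul]
  gcongr
  exact intervalIntegral.integral_mono_interval le_rfl hx.1 hx.2
    (Eventually.of_forall fun _ => norm_nonneg _) hf.norm

namespace BddPotential

variable {p q : ℝ → ℂ} {B : ℝ} (h : BddPotential p q B)

include h

lemma fund_spec (z : ℂ) (c : C2) :
    Continuous (fund p q z c) ∧ IsSol p q univ z 0 (fund p q z c) ∧ fund p q z c 0 = c := by
  have H := h.exists_isSol z (f := 0) (integrable_zero _ _ _) c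
  rw [fund, dif_pos H]
  exact H.choose_spec

lemma continuous_phi (z : ℂ) : Continuous (phi p q z) := (h.fund_spec z _).1

lemma continuous_psi (z : ℂ) : Continuous (psi p q z) := (h.fund_spec z _).1

lemma isSol_phi (z : ℂ) (s : Set ℝ) : IsSol p q s z 0 (phi p q z) :=
  (h.fund_spec z _).2.1.mono (subset_univ _)

lemma isSol_psi (z : ℂ) (s : Set ℝ) : IsSol p q s z 0 (psi p q z) :=
  (h.fund_spec z _).2.1.mono (subset_univ _)

lemma phi_zero (z : ℂ) : phi p q z 0 = !₂[1, 0] := (h.fund_spec z _).2.2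

lemma psi_zero (z : ℂ) : psi p q z 0 = !₂[0, 1] := (h.fund_spec z _).2.2

/-- Liouville's formula. -/
lemma wron_phi_psi (z : ℂ) {x : ℝ} (hx : 0 ≤ x) : wron (phi p q z x) (psi p q z x) = 1 := by
  have := (h.isSol_phi z univ).lagrange (h.isSol_psi z univ) hx (subset_univ _)
  simp only [h.phi_zero, h.psi_zero, Pi.zero_apply] at this
  have h0 : wron !₂[1, 0] !₂[0, 1] = 1 := by simp [wron]
  rw [h0] at this
  have h1 : ∀ u v : C2, dot u 0 - dot 0 v = 0 := by simp [dot]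
  simp only [h1, intervalIntegral.integral_zero] at this
  linear_combination this

/-- Variation of constants. -/
lemma representation {z : ℂ} {f u : ℝ → C2} {b : ℝ} (hu : IsSol p q (Icc 0 b) z f u)
    {x : ℝ} (hx : x ∈ Icc 0 b) :
    u x = (u 0 0 - ∫ s in (0 : ℝ)..x, dot (f s) (psi p q z s)) • phi p q z x +
      (u 0 1 + ∫ s in (0 : ℝ)..x, dot (f s) (phi p q z s)) • psi p q z x := by
  have hs : Icc 0 x ⊆ Icc 0 b := Icc_subset_Icc_right hx.2
  -- Lagrange's identity against `psi` and `phi` computes the two Wronskians that are the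
  -- coordinates of `u x` in the basis `phi`, `psi` of determinant one.
  have h1 := hu.lagrange (h.isSol_psi z _) hx.1 hs
  have h2 := hu.lagrange (h.isSol_phi z _) hx.1 hs
  have e0 : ∀ u : C2, wron u !₂[0, 1] = u 0 := by simp [wron]
  have e1 : ∀ u : C2, wron u !₂[1, 0] = -u 1 := by simp [wron]
  have d0 : ∀ u : C2, dot u 0 = 0 := by simp [dot]
  simp only [h.phi_zero, h.psi_zero, Pi.zero_apply, e0, e1, d0, zero_sub,
    intervalIntegral.integral_neg] at h1 h2
  have h3 := wron_self_expand (u x) (phi p q z x) (psi p q z x)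
  rw [h.wron_phi_psi z hx.1, one_smul] at h3
  rw [h3, sub_eq_add_neg, ← neg_smul]
  congr 2
  · linear_combination h1
  · linear_combination -h2

/-- Local uniform bounds for the fundamental system. -/
lemma exists_bound (R : ℝ) : ∃ K, 0 < K ∧ ∀ z : ℂ, ‖z‖ ≤ R → ∀ x ∈ Icc 0 Real.pi,
    ‖phi p q z x‖ ≤ K ∧ ‖psi p q z x‖ ≤ K := by
  by_cases hR : 0 ≤ R
  · refine ⟨2 * Real.exp (2 * coefBound B R * Real.pi), by positivity, fun z hz x hx => ?_⟩
    have hc := (h.coefBound_pos hR).le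
    have e : ∀ c : C2, ‖c‖ = 1 → 2 * ‖c‖ * Real.exp (2 * coefBound B R * x) ≤
        2 * Real.exp (2 * coefBound B R * Real.pi) := by
      intro c hc1
      rw [hc1, mul_one]
      gcongr
      exact hx.2
    refine ⟨(h.norm_le_exp hz (h.isSol_phi z _) x hx).trans (e _ ?_),
      (h.norm_le_exp hz (h.isSol_psi z _) x hx).trans (e _ ?_)⟩
    · simp [h.phi_zero, EuclideanSpace.norm_eq, Fin.sum_univ_two]
    · simp [h.psi_zero, EuclideanSpace.norm_eq, Fin.sum_univ_two]
  · exact ⟨1, one_pos, fun z hz => absurd ((norm_nonneg _).trans hz) hR⟩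

/-- Comparison of solutions of the homogeneous system for different spectral parameters. -/
lemma representation_shift {z ζ : ℂ} {u : ℝ → C2} (hu : IsSol p q univ ζ 0 u)
    {x : ℝ} (hx : 0 ≤ x) :
    u x = (u 0 0 - (ζ - z) * ∫ s in (0 : ℝ)..x, dot (u s) (psi p q z s)) • phi p q z x +
      (u 0 1 + (ζ - z) * ∫ s in (0 : ℝ)..x, dot (u s) (phi p q z s)) • psi p q z x := by
  -- A solution for `ζ` solves the system for `z` with source `(ζ - z) u`.
  have h1 := h.representation (b := x) ((hu.shift z).mono (subset_univ _)) ⟨hx, le_rfl⟩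
  have h2 : ∀ a b : C2, dot ((ζ - z) • a) b = (ζ - z) * dot a b := by
    intro a b; simp [dot]; ring
  simpa only [zero_add, Pi.smul_apply, h2, intervalIntegral.integral_const_mul] using h1

/-- By `representation_shift` the difference of two solutions carries an explicit factor `ζ - z`,
and the remaining integrals are bounded uniformly by `exists_bound`. -/
lemma exists_lipschitz (R : ℝ) : ∃ K, 0 < K ∧ ∀ z ζ : ℂ, ‖z‖ ≤ R → ‖ζ‖ ≤ R →
    ∀ x ∈ Icc 0 Real.pi, ‖phi p q ζ x - phi p q z x‖ ≤ K * ‖ζ - z‖ ∧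
      ‖psi p q ζ x - psi p q z x‖ ≤ K * ‖ζ - z‖ := by
  obtain ⟨K, hK, hb⟩ := h.exists_bound R
  refine ⟨4 * K * (Real.pi * K) * K, by have := Real.pi_pos; positivity,
    fun z ζ hz hζ x hx => ?_⟩
  have hint : ∀ u : ℝ → C2, Continuous u → (∀ x ∈ Icc 0 Real.pi, ‖u x‖ ≤ K) →
      ∫ s in (0 : ℝ)..Real.pi, ‖u s‖ ≤ Real.pi * K := by
    intro u hu hle
    have := intervalIntegral.integral_mono_on (μ := volume) Real.pi_pos.le
      (hu.norm.intervalIntegrable 0 Real.pi) (intervalIntegrable_const (c := K)) hle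
    simpa using this
  have key : ∀ u : ℝ → C2, Continuous u → (∀ x ∈ Icc 0 Real.pi, ‖u x‖ ≤ K) →
      ∀ a b : C2, ‖a‖ ≤ K → ‖b‖ ≤ K → ∀ I J : ℂ, ‖I‖ ≤ 2 * K * ∫ s in (0 : ℝ)..Real.pi, ‖u s‖ →
      ‖J‖ ≤ 2 * K * ∫ s in (0 : ℝ)..Real.pi, ‖u s‖ →
      ‖((ζ - z) * J) • b - ((ζ - z) * I) • a‖ ≤ 4 * K * (Real.pi * K) * K * ‖ζ - z‖ := by
    intro u hu hle a b ha hb I J hI hJ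
    have hI' : ‖I‖ ≤ 2 * K * (Real.pi * K) := hI.trans (by gcongr; exact hint u hu hle)
    have hJ' : ‖J‖ ≤ 2 * K * (Real.pi * K) := hJ.trans (by gcongr; exact hint u hu hle)
    calc _ ≤ ‖ζ - z‖ * ‖J‖ * ‖b‖ + ‖ζ - z‖ * ‖I‖ * ‖a‖ := by
          refine (norm_sub_le _ _).trans ?_
          rw [norm_smul, norm_smul, norm_mul, norm_mul]
      _ ≤ ‖ζ - z‖ * (2 * K * (Real.pi * K)) * K + ‖ζ - z‖ * (2 * K * (Real.pi * K)) * K := by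
          gcongr
      _ = _ := by ring
  have cphi := h.continuous_phi ζ
  have cpsi := h.continuous_psi ζ
  have bphi := fun x hx => (hb ζ hζ x hx).1
  have bpsi := fun x hx => (hb ζ hζ x hx).2
  have bphi' := fun x hx => (hb z hz x hx).1
  have bpsi' := fun x hx => (hb z hz x hx).2
  constructor
  · have e := h.representation_shift (z := z) (h.isSol_phi ζ univ) hx.1
    have e' : phi p q ζ x - phi p q z x =
        ((ζ - z) * ∫ s in (0 : ℝ)..x, dot (phi p q ζ s) (phi p q z s)) • psi p q z x -
        ((ζ - z) * ∫ s in (0 : ℝ)..x, dot (phi p q ζ s) (psi p q z s)) • phi p q z x := by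
      rw [e, h.phi_zero]
      simp only [Matrix.cons_val_zero, Matrix.cons_val_one]
      module
    rw [e']
    exact key _ cphi bphi _ _ (bphi' x hx) (bpsi' x hx) _ _
      (norm_integral_dot_le (cphi.intervalIntegrable _ _) bpsi' hx)
      (norm_integral_dot_le (cphi.intervalIntegrable _ _) bphi' hx)
  · have e := h.representation_shift (z := z) (h.isSol_psi ζ univ) hx.1
    have e' : psi p q ζ x - psi p q z x =
        ((ζ - z) * ∫ s in (0 : ℝ)..x, dot (psi p q ζ s) (phi p q z s)) • psi p q z x -
        ((ζ - z) * ∫ s in (0 : ℝ)..x, dot (psi p q ζ s) (psi p q z s)) • phi p q z x := by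
      rw [e, h.psi_zero]
      simp only [Matrix.cons_val_zero, Matrix.cons_val_one]
      module
    rw [e']
    exact key _ cpsi bpsi _ _ (bphi' x hx) (bpsi' x hx) _ _
      (norm_integral_dot_le (cpsi.intervalIntegrable _ _) bpsi' hx)
      (norm_integral_dot_le (cpsi.intervalIntegrable _ _) bphi' hx)

lemma exists_lipschitz_nhds (z : ℂ) : ∃ K, 0 < K ∧ ∀ᶠ ζ in 𝓝 z,
    ∀ x ∈ Icc 0 Real.pi, ‖phi p q ζ x - phi p q z x‖ ≤ K * ‖ζ - z‖ ∧
      ‖psi p q ζ x - psi p q z x‖ ≤ K * ‖ζ - z‖ := by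
  obtain ⟨K, hK, hL⟩ := h.exists_lipschitz (‖z‖ + 1)
  refine ⟨K, hK, ?_⟩
  filter_upwards [Metric.ball_mem_nhds z one_pos] with ζ hζ
  refine hL z ζ (by linarith) ?_
  rw [Metric.mem_ball, dist_eq_norm] at hζ
  calc ‖ζ‖ = ‖z + (ζ - z)‖ := by congr 1; ring
    _ ≤ _ := (norm_add_le _ _).trans (by linarith)

lemma continuous_phi_param {x : ℝ} (hx : x ∈ Icc 0 Real.pi) : Continuous fun z => phi p q z x := by
  rw [continuous_iff_continuousAt]
  intro z
  obtain ⟨K, hK, hL⟩ := h.exists_lipschitz_nhds z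
  exact tendsto_iff_norm_sub_tendsto_zero.2 (squeeze_zero' (Eventually.of_forall fun _ =>
    norm_nonneg _) (hL.mono fun ζ hζ => (hζ x hx).1)
    (by simpa using (tendsto_iff_norm_sub_tendsto_zero.1 (tendsto_id (x := 𝓝 z))).const_mul K))

lemma continuous_psi_param {x : ℝ} (hx : x ∈ Icc 0 Real.pi) : Continuous fun z => psi p q z x := by
  rw [continuous_iff_continuousAt]
  intro z
  obtain ⟨K, hK, hL⟩ := h.exists_lipschitz_nhds z
  exact tendsto_iff_norm_sub_tendsto_zero.2 (squeeze_zero' (Eventually.of_forall fun _ =>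
    norm_nonneg _) (hL.mono fun ζ hζ => (hζ x hx).2)
    (by simpa using (tendsto_iff_norm_sub_tendsto_zero.1 (tendsto_id (x := 𝓝 z))).const_mul K))

omit h in
lemma continuousAt_pair {U : ℂ → ℝ → C2} {z : ℂ} {f : ℝ → C2}
    (hf : IntervalIntegrable f volume 0 Real.pi)
    (hU : ∀ ζ, Continuous (U ζ)) {K : ℝ}
    (hL : ∀ᶠ ζ in 𝓝 z, ∀ x ∈ Icc 0 Real.pi, ‖U ζ x - U z x‖ ≤ K * ‖ζ - z‖) :
    ContinuousAt (fun ζ => pair f (U ζ)) z := by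
  refine tendsto_iff_norm_sub_tendsto_zero.2 (squeeze_zero' (Eventually.of_forall fun _ =>
    norm_nonneg _) (g := fun ζ => 2 * (K * ‖ζ - z‖) * ∫ s in (0 : ℝ)..Real.pi, ‖f s‖) ?_ ?_)
  · filter_upwards [hL] with ζ hζ
    have : pair f (U ζ) - pair f (U z) = ∫ s in (0 : ℝ)..Real.pi, dot (f s) (U ζ s - U z s) := by
      unfold pair
      rw [← intervalIntegral.integral_sub (intervalIntegrable_dot hf (hU ζ).continuousOn)
        (intervalIntegrable_dot hf (hU z).continuousOn)]
      refine intervalIntegral.integral_congr fun x _ => ?_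
      simp [dot]; ring
    rw [this]
    exact norm_integral_dot_le (u := fun s => U ζ s - U z s) hf hζ
      (right_mem_Icc.2 Real.pi_pos.le)
  · have h1 : Tendsto (fun ζ => ‖ζ - z‖) (𝓝 z) (𝓝 0) := by
      simpa using tendsto_iff_norm_sub_tendsto_zero.1 (tendsto_id (x := 𝓝 z))
    simpa using ((h1.const_mul K).const_mul 2).mul_const (∫ s in (0 : ℝ)..Real.pi, ‖f s‖)

lemma continuous_pair_phi {f : ℝ → C2} (hf : IntervalIntegrable f volume 0 Real.pi) :
    Continuous fun z => pair f (phi p q z) := by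
  rw [continuous_iff_continuousAt]
  intro z
  obtain ⟨K, hK, hL⟩ := h.exists_lipschitz_nhds z
  exact continuousAt_pair hf h.continuous_phi (hL.mono fun ζ hζ x hx => (hζ x hx).1)

lemma continuous_pair_psi {f : ℝ → C2} (hf : IntervalIntegrable f volume 0 Real.pi) :
    Continuous fun z => pair f (psi p q z) := by
  rw [continuous_iff_continuousAt]
  intro z
  obtain ⟨K, hK, hL⟩ := h.exists_lipschitz_nhds z
  exact continuousAt_pair hf h.continuous_psi (hL.mono fun ζ hζ x hx => (hζ x hx).2)

/-- At `x = π`, `representation_shift` is an exact formula for the difference quotient, in terms of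
pairings of solutions for `z` with solutions for `ζ`. Continuity of these pairings in `ζ` gives the
limit. -/
lemma hasDerivAt_discr (z : ℂ) : HasDerivAt (discr p q) (discrDeriv p q z) z := by
  have ip := (h.continuous_phi z).intervalIntegrable (μ := volume) 0 Real.pi
  have is := (h.continuous_psi z).intervalIntegrable (μ := volume) 0 Real.pi
  have hlim : Tendsto (fun ζ => psi p q z Real.pi 0 * pair (phi p q z) (phi p q ζ) +
      (psi p q z Real.pi 1 * pair (phi p q z) (psi p q ζ) -
        phi p q z Real.pi 0 * pair (psi p q z) (phi p q ζ)) -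
      phi p q z Real.pi 1 * pair (psi p q z) (psi p q ζ)) (𝓝[≠] z) (𝓝 (discrDeriv p q z)) := by
    have c1 := (h.continuous_pair_phi ip).tendsto z
    have c2 := (h.continuous_pair_psi ip).tendsto z
    have c3 := (h.continuous_pair_phi is).tendsto z
    have c4 := (h.continuous_pair_psi is).tendsto z
    have := ((c1.const_mul (psi p q z Real.pi 0)).add ((c2.const_mul (psi p q z Real.pi 1)).sub
      (c3.const_mul (phi p q z Real.pi 0)))).sub (c4.const_mul (phi p q z Real.pi 1))
    convert this.mono_left nhdsWithin_le_nhds using 2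
    rw [pair_comm (psi p q z) (phi p q z), discrDeriv]
    ring
  rw [hasDerivAt_iff_tendsto_slope]
  refine hlim.congr' ?_
  filter_upwards [self_mem_nhdsWithin] with ζ hζ
  have hne : ζ - z ≠ 0 := sub_ne_zero.2 hζ
  have e1 := congrArg (fun w : C2 => w 0)
    (h.representation_shift (z := z) (h.isSol_phi ζ univ) Real.pi_pos.le)
  have e2 := congrArg (fun w : C2 => w 1)
    (h.representation_shift (z := z) (h.isSol_psi ζ univ) Real.pi_pos.le)
  simp only [h.phi_zero, h.psi_zero, PiLp.add_apply, PiLp.smul_apply, smul_eq_mul,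
    PiLp.toLp_apply, Matrix.cons_val_zero, Matrix.cons_val_one] at e1 e2
  have : discr p q ζ - discr p q z = (ζ - z) * (psi p q z Real.pi 0 * pair (phi p q z) (phi p q ζ) +
      (psi p q z Real.pi 1 * pair (phi p q z) (psi p q ζ) -
        phi p q z Real.pi 0 * pair (psi p q z) (phi p q ζ)) -
      phi p q z Real.pi 1 * pair (psi p q z) (psi p q ζ)) := by
    rw [pair_comm (phi p q z), pair_comm (phi p q z), pair_comm (psi p q z),
      pair_comm (psi p q z), discr, discr, e1, e2]
    simp only [pair]
    ring
  rw [slope_def_field, this]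
  field_simp

lemma differentiable_discr : Differentiable ℂ (discr p q) :=
  fun z => (h.hasDerivAt_discr z).differentiableAt

end BddPotential

/-! ### Complex conjugation -/

/-- Complex conjugation of the coordinates. -/
noncomputable def conjC2 : C2 →L[ℝ] C2 where
  toFun u := !₂[starRingEnd ℂ (u 0), starRingEnd ℂ (u 1)]
  map_add' u v := by apply C2.ext <;> simp
  map_smul' c u := by apply C2.ext <;> simp
  cont := by fun_prop

@[simp] lemma conjC2_apply (u : C2) (i : Fin 2) : conjC2 u i = starRingEnd ℂ (u i) := by
  fin_cases i <;> rfl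

lemma inner_eq_dot (u v : C2) : inner ℂ u v = dot v (conjC2 u) := by
  simp [dot, PiLp.inner_apply, Fin.sum_univ_two]

lemma dot_conjC2_self (u : C2) : dot u (conjC2 u) = ((‖u‖ ^ 2 : ℝ) : ℂ) := by
  rw [EuclideanSpace.norm_sq_eq, Fin.sum_univ_two]
  simp [dot, Complex.mul_conj, Complex.normSq_eq_norm_sq]

lemma integral_norm_sq_pos {u : ℝ → C2} (hu : ContinuousOn u (Icc 0 Real.pi)) (h0 : u 0 ≠ 0) :
    0 < ∫ x in (0 : ℝ)..Real.pi, ‖u x‖ ^ 2 :=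
  intervalIntegral.integral_pos Real.pi_pos (hu.norm.pow 2) (fun _ _ => by positivity)
    ⟨0, left_mem_Icc.2 Real.pi_pos.le, by positivity⟩

/-- The conjugate of a solution solves the system with the conjugate spectral parameter, up to a
bounded perturbation. -/
lemma IsSol.conj {p q : ℝ → ℂ} {s : Set ℝ} {z : ℂ} {u : ℝ → C2} (hu : IsSol p q s z 0 u) :
    IsSol p q s z (fun x => !₂[
      (starRingEnd ℂ z - z + (p x - starRingEnd ℂ (p x))) * starRingEnd ℂ (u x 0) +
        (q x - starRingEnd ℂ (q x)) * starRingEnd ℂ (u x 1),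
      (starRingEnd ℂ z - z - (p x - starRingEnd ℂ (p x))) * starRingEnd ℂ (u x 1) +
        (q x - starRingEnd ℂ (q x)) * starRingEnd ℂ (u x 0)]) (fun x => conjC2 (u x)) := by
  obtain ⟨g, hg, hd⟩ := hu
  refine ⟨fun x => conjC2 (g x), ?_, ?_⟩
  · intro a ha b hb
    have := hg a ha b hb
    refine ⟨⟨conjC2.integrable_comp this.1.1, conjC2.integrable_comp this.1.2⟩, ?_⟩
    rw [conjC2.intervalIntegral_comp_comm this.1, ← this.2, map_sub]
  · filter_upwards [hd] with x hx
    have e0 := congrArg (fun w : C2 => starRingEnd ℂ (w 0)) hx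
    have e1 := congrArg (fun w : C2 => starRingEnd ℂ (w 1)) hx
    simp only [diracExpr_apply_zero, diracExpr_apply_one, PiLp.add_apply, PiLp.smul_apply,
      smul_eq_mul, Pi.zero_apply, PiLp.zero_apply, map_add, map_mul, map_neg, map_sub,
      map_zero] at e0 e1
    apply C2.ext
    · simp only [diracExpr_apply_zero, PiLp.add_apply, PiLp.smul_apply, smul_eq_mul, conjC2_apply,
        Matrix.cons_val_zero]
      linear_combination e0
    · simp only [diracExpr_apply_one, PiLp.add_apply, PiLp.smul_apply, smul_eq_mul, conjC2_apply,
        Matrix.cons_val_one, Matrix.cons_val_fin_one]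
      linear_combination e1

/-- Quasi-periodic solutions with a unimodular multiplier exist only near the real axis. -/
lemma BddPotential.abs_im_le {p q : ℝ → ℂ} {B : ℝ} (h : BddPotential p q B) {z ω : ℂ}
    (hω : ‖ω‖ = 1) {u : ℝ → C2} (hu : IsSol p q (Icc 0 Real.pi) z 0 u)
    (hbc : u Real.pi = ω • u 0) (h0 : u 0 ≠ 0) : |z.im| ≤ 3 * B := by
  have hcont := hu.continuousOn (a := 0) (b := Real.pi) subset_rfl
  have hpos := integral_norm_sq_pos hcont h0
  have hL := hu.lagrange hu.conj Real.pi_pos.le subset_rfl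
  have hω' : ω * starRingEnd ℂ ω = 1 := by
    rw [Complex.mul_conj, Complex.normSq_eq_norm_sq, hω]; simp
  -- The boundary term of Lagrange's identity for `u` and its conjugate is multiplied by `|ω|² = 1`
  -- over a period, so it drops out.
  have hl : wron (u Real.pi) (conjC2 (u Real.pi)) - wron (u 0) (conjC2 (u 0)) = 0 := by
    rw [hbc]
    simp only [wron, conjC2_apply, PiLp.smul_apply, smul_eq_mul, map_mul]
    linear_combination (u 0 0 * starRingEnd ℂ (u 0 1) - u 0 1 * starRingEnd ℂ (u 0 0)) * hω'
  rw [hl] at hL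
  have hi2 : IntervalIntegrable (fun x => ‖u x‖ ^ 2) volume 0 Real.pi := by
    refine ContinuousOn.intervalIntegrable ?_
    rw [uIcc_of_le Real.pi_pos.le]
    exact hcont.norm.pow 2
  -- `P` collects the contribution of the non-real part of `Q`; what remains is `(z̄ - z) ‖u‖²`, so
  -- `2 |Im z|` is bounded by the relative size `6 B` of `P`.
  let P : ℝ → ℂ := fun x => (p x - starRingEnd ℂ (p x)) *
      (u x 0 * starRingEnd ℂ (u x 0) - u x 1 * starRingEnd ℂ (u x 1)) +
      (q x - starRingEnd ℂ (q x)) *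
      (u x 0 * starRingEnd ℂ (u x 1) + u x 1 * starRingEnd ℂ (u x 0))
  have hsplit : ∀ x, dot (u x) !₂[
      (starRingEnd ℂ z - z + (p x - starRingEnd ℂ (p x))) * starRingEnd ℂ (u x 0) +
        (q x - starRingEnd ℂ (q x)) * starRingEnd ℂ (u x 1),
      (starRingEnd ℂ z - z - (p x - starRingEnd ℂ (p x))) * starRingEnd ℂ (u x 1) +
        (q x - starRingEnd ℂ (q x)) * starRingEnd ℂ (u x 0)] -
      dot ((0 : ℝ → C2) x) (conjC2 (u x)) =
      (starRingEnd ℂ z - z) * ((‖u x‖ ^ 2 : ℝ) : ℂ) + P x := by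
    intro x
    rw [← dot_conjC2_self]
    simp only [dot, P, conjC2_apply, Pi.zero_apply, PiLp.zero_apply, Matrix.cons_val_zero,
      Matrix.cons_val_one]
    ring
  have hP : ∀ x, ‖P x‖ ≤ 6 * B * ‖u x‖ ^ 2 := by
    intro x
    have n0 : ‖u x‖ ^ 2 = ‖u x 0‖ ^ 2 + ‖u x 1‖ ^ 2 := by
      rw [EuclideanSpace.norm_sq_eq, Fin.sum_univ_two]
    have hB := h.bound_nonneg
    have hp2 : ‖p x - starRingEnd ℂ (p x)‖ ≤ 2 * B := by
      refine (norm_sub_le _ _).trans ?_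
      rw [RCLike.norm_conj]; linarith [h.bound_p x]
    have hq2 : ‖q x - starRingEnd ℂ (q x)‖ ≤ 2 * B := by
      refine (norm_sub_le _ _).trans ?_
      rw [RCLike.norm_conj]; linarith [h.bound_q x]
    have m1 : ‖u x 0 * starRingEnd ℂ (u x 0) - u x 1 * starRingEnd ℂ (u x 1)‖ ≤ ‖u x‖ ^ 2 := by
      refine (norm_sub_le _ _).trans ?_
      rw [norm_mul, norm_mul, RCLike.norm_conj, RCLike.norm_conj, n0, sq, sq]
    have m2 : ‖u x 0 * starRingEnd ℂ (u x 1) + u x 1 * starRingEnd ℂ (u x 0)‖ ≤ ‖u x‖ ^ 2 := by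
      refine (norm_add_le _ _).trans ?_
      rw [norm_mul, norm_mul, RCLike.norm_conj, RCLike.norm_conj, n0]
      nlinarith [sq_nonneg (‖u x 0‖ - ‖u x 1‖)]
    calc ‖P x‖ ≤ 2 * B * ‖u x‖ ^ 2 + 2 * B * ‖u x‖ ^ 2 := by
          refine (norm_add_le _ _).trans ?_
          rw [norm_mul, norm_mul]
          gcongr
      _ ≤ _ := by nlinarith [mul_nonneg hB (sq_nonneg ‖u x‖)]
  set N := ∫ x in (0 : ℝ)..Real.pi, ‖u x‖ ^ 2 with hN
  simp_rw [hsplit] at hL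
  have hreal : ∫ x in (0 : ℝ)..Real.pi, (starRingEnd ℂ z - z) * ((‖u x‖ ^ 2 : ℝ) : ℂ) =
      (starRingEnd ℂ z - z) * (N : ℂ) := by
    rw [intervalIntegral.integral_const_mul, intervalIntegral.integral_ofReal]
  have hcz : starRingEnd ℂ z - z = ((-2 * z.im : ℝ) : ℂ) * Complex.I := by
    apply Complex.ext <;> simp; ring
  have hNle : ‖(starRingEnd ℂ z - z) * (N : ℂ)‖ ≤ 6 * B * N := by
    by_cases hPi : IntervalIntegrable P volume 0 Real.pi
    · rw [intervalIntegral.integral_add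
        (by
          have : IntervalIntegrable (fun x => ((‖u x‖ ^ 2 : ℝ) : ℂ)) volume 0 Real.pi :=
            ⟨hi2.1.ofReal, hi2.2.ofReal⟩
          exact this.const_mul _) hPi, hreal] at hL
      have : (starRingEnd ℂ z - z) * (N : ℂ) = -∫ x in (0 : ℝ)..Real.pi, P x := by
        linear_combination -hL
      rw [this, norm_neg, hN, ← intervalIntegral.integral_const_mul]
      exact intervalIntegral.norm_integral_le_of_norm_le Real.pi_pos.le
        (Eventually.of_forall fun x _ => hP x) (hi2.const_mul _)
    -- Vacuous case: `P` is measurable and dominated by a multiple of `‖u‖²`.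
    · exfalso
      apply hPi
      have cc : ∀ i, ContinuousOn (fun x => u x i) (Icc 0 Real.pi) := fun i =>
        (EuclideanSpace.proj (𝕜 := ℂ) i).continuous.comp_continuousOn hcont
      have cs : ∀ i, ContinuousOn (fun x => starRingEnd ℂ (u x i)) (Icc 0 Real.pi) := fun i =>
        Complex.continuous_conj.comp_continuousOn (cc i)
      have hm : ∀ f : ℝ → ℂ, ContinuousOn f (Icc 0 Real.pi) →
          AEStronglyMeasurable f (volume.restrict (uIoc 0 Real.pi)) := by
        intro f hf
        rw [uIoc_of_le Real.pi_pos.le]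
        exact (hf.mono Ioc_subset_Icc_self).aestronglyMeasurable measurableSet_Ioc
      refine (hi2.const_mul (6 * B)).mono_fun ?_ ?_
      · refine AEStronglyMeasurable.add (.mul ?_ (hm _ (by
          exact ((cc 0).mul (cs 0)).sub ((cc 1).mul (cs 1)))))
          (.mul ?_ (hm _ (((cc 0).mul (cs 1)).add ((cc 1).mul (cs 0)))))
        · exact h.meas_p.restrict.sub
            (Complex.continuous_conj.comp_aestronglyMeasurable h.meas_p.restrict)
        · exact h.meas_q.restrict.sub
            (Complex.continuous_conj.comp_aestronglyMeasurable h.meas_q.restrict)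
      · exact Eventually.of_forall fun x => (hP x).trans (le_abs_self _)
  rw [norm_mul, hcz, norm_mul, Complex.norm_I, mul_one, Complex.norm_real, Complex.norm_real,
    Real.norm_of_nonneg hpos.le, Real.norm_eq_abs, abs_mul] at hNle
  have := le_of_mul_le_mul_right hNle hpos
  norm_num at this
  linarith


/-! ### Quasi-periodic solutions -/

/-- The coefficient at `phi` of the residue function. -/
noncomputable def resCoef₀ (p q : ℝ → ℂ) (z ω : ℂ) (f : ℝ → C2) : ℂ :=
  (psi p q z Real.pi 1 - ω) * pair f (psi p q z) + psi p q z Real.pi 0 * pair f (phi p q z)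

/-- The coefficient at `psi` of the residue function. -/
noncomputable def resCoef₁ (p q : ℝ → ℂ) (z ω : ℂ) (f : ℝ → C2) : ℂ :=
  -phi p q z Real.pi 1 * pair f (psi p q z) - (phi p q z Real.pi 0 - ω) * pair f (phi p q z)

/-- Up to the factor `-1 / discrDeriv`, the residue of the resolvent applied to `f`. -/
noncomputable def resFun (p q : ℝ → ℂ) (z ω : ℂ) (f : ℝ → C2) (x : ℝ) : C2 :=
  resCoef₀ p q z ω f • phi p q z x + resCoef₁ p q z ω f • psi p q z x

/-- A singular nonzero `2 × 2` matrix has a one-dimensional kernel. -/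
lemma exists_kernel_generator {A B C D : ℂ} (hdet : A * D - B * C = 0)
    (hne : ¬(A = 0 ∧ B = 0 ∧ C = 0 ∧ D = 0)) : ∃ v : C2, v ≠ 0 ∧
      A * v 0 + B * v 1 = 0 ∧ C * v 0 + D * v 1 = 0 ∧
      ∀ w : C2, A * w 0 + B * w 1 = 0 → C * w 0 + D * w 1 = 0 → ∃ κ : ℂ, w = κ • v := by
  by_cases hA : A = 0
  · by_cases hB : B = 0
    · by_cases hC : C = 0
      · have hD : D ≠ 0 := fun hD => hne ⟨hA, hB, hC, hD⟩
        refine ⟨!₂[1, 0], fun hv => by simpa using congrArg (fun w : C2 => w 0) hv,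
          by simp [hA], by simp [hC], fun w h1 h2 => ⟨w 0, ?_⟩⟩
        rw [hC, zero_mul, zero_add] at h2
        apply C2.ext
        · simp
        · simpa [hD] using h2
      · refine ⟨!₂[-D, C], fun hv => hC (by simpa using congrArg (fun w : C2 => w 1) hv),
          by simp [hA, hB], by simp; ring, fun w h1 h2 => ⟨w 1 / C, ?_⟩⟩
        apply C2.ext
        · simp; field_simp; linear_combination h2
        · simp; field_simp
    · refine ⟨!₂[-B, A], fun hv => hB (by simpa using congrArg (fun w : C2 => w 0) hv),
        by simp; ring, by simp; linear_combination hdet, fun w h1 h2 => ⟨-w 0 / B, ?_⟩⟩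
      apply C2.ext
      · simp; field_simp
      · simp; field_simp; linear_combination h1
  · refine ⟨!₂[-B, A], fun hv => hA (by simpa using congrArg (fun w : C2 => w 1) hv),
      by simp; ring, by simp; linear_combination hdet, fun w h1 h2 => ⟨w 1 / A, ?_⟩⟩
    apply C2.ext
    · simp; field_simp; linear_combination h1
    · simp; field_simp

/-- Solvability of a singular `2 × 2` system. -/
lemma exists_solution_of_singular {A B C D a b : ℂ} (hdet : A * D - B * C = 0)
    (hne : ¬(A = 0 ∧ B = 0 ∧ C = 0 ∧ D = 0)) (h0 : D * a - B * b = 0) (h1 : A * b - C * a = 0) :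
    ∃ x y : ℂ, A * x + B * y = a ∧ C * x + D * y = b := by
  by_cases hA : A = 0
  · by_cases hB : B = 0
    · by_cases hC : C = 0
      · have hD : D ≠ 0 := fun hD => hne ⟨hA, hB, hC, hD⟩
        subst hA hB hC
        refine ⟨0, b / D, ?_, by field_simp; ring⟩
        have : a = 0 := by simpa [hD] using h0
        simp [this]
      · subst hA hB
        refine ⟨b / C, 0, ?_, by field_simp; ring⟩
        have : a = 0 := by simpa [hC] using h1
        simp [this]
    · refine ⟨0, a / B, by field_simp; ring, ?_⟩
      field_simp
      linear_combination h0
  · refine ⟨a / A, 0, by field_simp; ring, ?_⟩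
    field_simp
    linear_combination -h1

lemma pair_congr {f k : ℝ → C2} (u : ℝ → C2) (hf : f =ᵐ[volume.restrict (Icc 0 Real.pi)] k) :
    pair f u = pair k u := by
  unfold pair
  refine intervalIntegral.integral_congr_ae ?_
  rw [uIoc_of_le Real.pi_pos.le, ← ae_restrict_iff' measurableSet_Ioc]
  filter_upwards [ae_restrict_of_ae_restrict_of_subset Ioc_subset_Icc_self hf] with x hx
  rw [hx]

lemma pair_smul_left (c : ℂ) (f u : ℝ → C2) : pair (c • f) u = c * pair f u := by
  unfold pair
  rw [← intervalIntegral.integral_const_mul]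
  congr 1; ext x
  simp [dot]; ring

namespace BddPotential

variable {p q : ℝ → ℂ} {B : ℝ} (h : BddPotential p q B) {z ω : ℂ} {f u : ℝ → C2}

include h

lemma det_monodromy (z : ℂ) : phi p q z Real.pi 0 * psi p q z Real.pi 1 -
    phi p q z Real.pi 1 * psi p q z Real.pi 0 = 1 :=
  h.wron_phi_psi z Real.pi_pos.le

/-- The characteristic polynomial of a matrix of determinant one, `ω² - Δ ω + 1`, with `-ω` factored
out. -/
lemma det_sub (hω : ω ≠ 0) : (phi p q z Real.pi 0 - ω) * (psi p q z Real.pi 1 - ω) -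
    psi p q z Real.pi 0 * phi p q z Real.pi 1 = -ω * (discr p q z - (ω + ω⁻¹)) := by
  have h1 := h.det_monodromy z
  have h2 : ω * ω⁻¹ = 1 := mul_inv_cancel₀ hω
  rw [discr]
  linear_combination h1 - h2

/-- A scalar monodromy matrix `ω` would have determinant `ω² = 1`. This is where periodic and
antiperiodic quasimomenta are set aside. -/
lemma monodromy_ne (hω : ω ^ 2 ≠ 1) : ¬(phi p q z Real.pi 0 - ω = 0 ∧ psi p q z Real.pi 0 = 0 ∧
    phi p q z Real.pi 1 = 0 ∧ psi p q z Real.pi 1 - ω = 0) := by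
  rintro ⟨h0, h1, h2, h3⟩
  have := h.det_monodromy z
  rw [h1, h2, sub_eq_zero.1 h0, sub_eq_zero.1 h3] at this
  exact hω (by linear_combination this)

lemma apply_pi (hu : IsSol p q (Icc 0 Real.pi) z f u) :
    u Real.pi = (u 0 0 - pair f (psi p q z)) • phi p q z Real.pi +
      (u 0 1 + pair f (phi p q z)) • psi p q z Real.pi :=
  h.representation hu (right_mem_Icc.2 Real.pi_pos.le)

/-- The unknowns are the coefficients of `u π` along `phi π`, `psi π` rather than the initial
values, so the linear system has matrix `M - ω`. -/
lemma boundary_iff (hu : IsSol p q (Icc 0 Real.pi) z f u) :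
    u Real.pi = ω • u 0 ↔
      (phi p q z Real.pi 0 - ω) * (u 0 0 - pair f (psi p q z)) +
        psi p q z Real.pi 0 * (u 0 1 + pair f (phi p q z)) = ω * pair f (psi p q z) ∧
      phi p q z Real.pi 1 * (u 0 0 - pair f (psi p q z)) +
        (psi p q z Real.pi 1 - ω) * (u 0 1 + pair f (phi p q z)) = -ω * pair f (phi p q z) := by
  rw [h.apply_pi hu]
  constructor
  · intro e
    have e0 := congrArg (fun w : C2 => w 0) e
    have e1 := congrArg (fun w : C2 => w 1) e
    simp only [PiLp.add_apply, PiLp.smul_apply, smul_eq_mul] at e0 e1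
    exact ⟨by linear_combination e0, by linear_combination e1⟩
  · rintro ⟨e0, e1⟩
    apply C2.ext
    · simp only [PiLp.add_apply, PiLp.smul_apply, smul_eq_mul]
      linear_combination e0
    · simp only [PiLp.add_apply, PiLp.smul_apply, smul_eq_mul]
      linear_combination e1

/-- Cramer's rule for the system of `boundary_iff`: the determinant contributes `-ω (Δ - ω - ω⁻¹)`
and the right-hand side a factor `ω`, which cancels. -/
lemma discr_mul (hω : ω ≠ 0) (hu : IsSol p q (Icc 0 Real.pi) z f u) (hb : u Real.pi = ω • u 0) :
    (discr p q z - (ω + ω⁻¹)) * (u 0 0 - pair f (psi p q z)) = -resCoef₀ p q z ω f ∧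
      (discr p q z - (ω + ω⁻¹)) * (u 0 1 + pair f (phi p q z)) = -resCoef₁ p q z ω f := by
  obtain ⟨e0, e1⟩ := (h.boundary_iff hu).1 hb
  have hd := h.det_sub (z := z) hω
  constructor
  · apply mul_left_cancel₀ hω
    rw [resCoef₀]
    linear_combination (-(psi p q z Real.pi 1 - ω)) * e0 + psi p q z Real.pi 0 * e1 +
      (u 0 0 - pair f (psi p q z)) * hd
  · apply mul_left_cancel₀ hω
    rw [resCoef₁]
    linear_combination (-(phi p q z Real.pi 0 - ω)) * e1 + phi p q z Real.pi 1 * e0 +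
      (u 0 1 + pair f (phi p q z)) * hd

lemma exists_isSol_Icc (z : ℂ) (hf : IntervalIntegrable f volume 0 Real.pi) (c : C2) :
    ∃ u, IsSol p q (Icc 0 Real.pi) z f u ∧ u 0 = c := by
  rw [intervalIntegrable_iff_integrableOn_Icc_of_le Real.pi_pos.le] at hf
  obtain ⟨u, -, hu, h0⟩ := h.exists_isSol z (hf.integrable_indicator measurableSet_Icc) c
  exact ⟨u, (hu.mono (subset_univ _)).congr (indicator_ae_eq_restrict measurableSet_Icc), h0⟩

lemma exists_isSol_boundary_aux (hf : IntervalIntegrable f volume 0 Real.pi) {x y : ℂ}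
    (e0 : (phi p q z Real.pi 0 - ω) * x + psi p q z Real.pi 0 * y = ω * pair f (psi p q z))
    (e1 : phi p q z Real.pi 1 * x + (psi p q z Real.pi 1 - ω) * y = -ω * pair f (phi p q z)) :
    ∃ u, IsSol p q (Icc 0 Real.pi) z f u ∧ u Real.pi = ω • u 0 := by
  obtain ⟨u, hu, h0⟩ := h.exists_isSol_Icc z hf
    !₂[x + pair f (psi p q z), y - pair f (phi p q z)]
  refine ⟨u, hu, (h.boundary_iff hu).2 ?_⟩
  have c0 : u 0 0 = x + pair f (psi p q z) := by rw [h0]; simp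
  have c1 : u 0 1 = y - pair f (phi p q z) := by rw [h0]; simp
  rw [c0, c1]
  exact ⟨by linear_combination e0, by linear_combination e1⟩

lemma exists_isSol_boundary (hω : ω ≠ 0) (hD : discr p q z ≠ ω + ω⁻¹)
    (hf : IntervalIntegrable f volume 0 Real.pi) :
    ∃ u, IsSol p q (Icc 0 Real.pi) z f u ∧ u Real.pi = ω • u 0 := by
  have hd := h.det_sub (z := z) hω
  have hD' := sub_ne_zero.2 hD
  refine h.exists_isSol_boundary_aux hf (x := -resCoef₀ p q z ω f / (discr p q z - (ω + ω⁻¹)))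
    (y := -resCoef₁ p q z ω f / (discr p q z - (ω + ω⁻¹))) ?_ ?_
  · rw [mul_div_assoc', mul_div_assoc', ← add_div, div_eq_iff hD', resCoef₀, resCoef₁]
    linear_combination (-pair f (psi p q z)) * hd
  · rw [mul_div_assoc', mul_div_assoc', ← add_div, div_eq_iff hD', resCoef₀, resCoef₁]
    linear_combination (pair f (phi p q z)) * hd

/-- The Fredholm alternative at an eigenvalue: `M - ω` has rank one, and the vanishing of the two
residue coefficients, which is the adjugate applied to the right-hand side, is the solvability
condition. `resCoef_eq_zero` is the converse. -/
lemma exists_isSol_boundary_of_resCoef (hω : ω ≠ 0) (hω2 : ω ^ 2 ≠ 1)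
    (hD : discr p q z = ω + ω⁻¹) (hf : IntervalIntegrable f volume 0 Real.pi)
    (h0 : resCoef₀ p q z ω f = 0) (h1 : resCoef₁ p q z ω f = 0) :
    ∃ u, IsSol p q (Icc 0 Real.pi) z f u ∧ u Real.pi = ω • u 0 := by
  have hd := h.det_sub (z := z) hω
  rw [hD, sub_self, mul_zero] at hd
  rw [resCoef₀] at h0
  rw [resCoef₁] at h1
  obtain ⟨x, y, e0, e1⟩ := exists_solution_of_singular (a := ω * pair f (psi p q z))
    (b := -ω * pair f (phi p q z)) hd (h.monodromy_ne hω2)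
    (by linear_combination ω * h0) (by linear_combination ω * h1)
  exact h.exists_isSol_boundary_aux hf e0 e1

lemma resCoef_eq_zero (hω : ω ≠ 0) (hD : discr p q z = ω + ω⁻¹)
    (hu : IsSol p q (Icc 0 Real.pi) z f u) (hb : u Real.pi = ω • u 0) :
    resCoef₀ p q z ω f = 0 ∧ resCoef₁ p q z ω f = 0 := by
  have := h.discr_mul hω hu hb
  rw [hD, sub_self, zero_mul, zero_mul] at this
  exact ⟨neg_eq_zero.1 this.1.symm, neg_eq_zero.1 this.2.symm⟩

/-- `v` spans the space of initial values of the Bloch solutions. -/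
lemma exists_bloch (hω : ω ≠ 0) (hω2 : ω ^ 2 ≠ 1) (hD : discr p q z = ω + ω⁻¹) :
    ∃ v : C2, v ≠ 0 ∧
      (phi p q z Real.pi 0 - ω) * v 0 + psi p q z Real.pi 0 * v 1 = 0 ∧
      phi p q z Real.pi 1 * v 0 + (psi p q z Real.pi 1 - ω) * v 1 = 0 ∧
      ∀ w : C2, (phi p q z Real.pi 0 - ω) * w 0 + psi p q z Real.pi 0 * w 1 = 0 →
        phi p q z Real.pi 1 * w 0 + (psi p q z Real.pi 1 - ω) * w 1 = 0 → ∃ κ : ℂ, w = κ • v := by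
  have hd := h.det_sub (z := z) hω
  rw [hD, sub_self, mul_zero] at hd
  exact exists_kernel_generator hd (h.monodromy_ne hω2)

/-- The residue coefficients are the adjugate of `M - ω` applied to a vector, and a singular matrix
annihilates the image of its adjugate. So residues are Bloch solutions. -/
lemma resCoef_mem_kernel (hω : ω ≠ 0) (hD : discr p q z = ω + ω⁻¹) (f : ℝ → C2) :
    (phi p q z Real.pi 0 - ω) * resCoef₀ p q z ω f +
        psi p q z Real.pi 0 * resCoef₁ p q z ω f = 0 ∧
      phi p q z Real.pi 1 * resCoef₀ p q z ω f +
        (psi p q z Real.pi 1 - ω) * resCoef₁ p q z ω f = 0 := by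
  have hd := h.det_sub (z := z) hω
  rw [hD, sub_self, mul_zero] at hd
  rw [resCoef₀, resCoef₁]
  exact ⟨by linear_combination pair f (psi p q z) * hd,
    by linear_combination (-pair f (phi p q z)) * hd⟩

/-- Bloch solutions are eigenvectors of the residue map, with eigenvalue `discrDeriv`. -/
lemma resCoef_bloch {v : C2}
    (h0 : (phi p q z Real.pi 0 - ω) * v 0 + psi p q z Real.pi 0 * v 1 = 0)
    (h1 : phi p q z Real.pi 1 * v 0 + (psi p q z Real.pi 1 - ω) * v 1 = 0) :
    resCoef₀ p q z ω (fun x => v 0 • phi p q z x + v 1 • psi p q z x) =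
        discrDeriv p q z * v 0 ∧
      resCoef₁ p q z ω (fun x => v 0 • phi p q z x + v 1 • psi p q z x) =
        discrDeriv p q z * v 1 := by
  have cp := h.continuous_phi z
  have cs := h.continuous_psi z
  have ep := pair_add_smul (f := phi p q z) (cp.intervalIntegrable _ _) cp.continuousOn
    cs.continuousOn (v 0) (v 1)
  have es := pair_add_smul (f := psi p q z) (cs.intervalIntegrable _ _) cp.continuousOn
    cs.continuousOn (v 0) (v 1)
  rw [pair_comm] at ep es
  rw [pair_comm (psi p q z) (phi p q z)] at es
  rw [resCoef₀, resCoef₁, discrDeriv, ep, es]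
  constructor
  · linear_combination (pair (phi p q z) (psi p q z)) * h0 + pair (psi p q z) (psi p q z) * h1
  · linear_combination (-pair (phi p q z) (phi p q z)) * h0 -
      pair (phi p q z) (psi p q z) * h1

/-- Homogeneous solutions are determined by their initial values. -/
lemma eqOn_of_homogeneous (hu : IsSol p q (Icc 0 Real.pi) z 0 u) {x : ℝ}
    (hx : x ∈ Icc 0 Real.pi) : u x = u 0 0 • phi p q z x + u 0 1 • psi p q z x := by
  have := h.representation hu hx
  have d0 : ∀ u : C2, dot 0 u = 0 := by simp [dot]
  simpa [d0] using this

lemma bloch_spec (v : C2) : IsSol p q univ z 0 (fun x => v 0 • phi p q z x + v 1 • psi p q z x) ∧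
    v 0 • phi p q z 0 + v 1 • psi p q z 0 = v := by
  constructor
  · have := ((h.isSol_phi z univ).smul (v 0)).add ((h.isSol_psi z univ).smul (v 1))
    simp only [smul_zero, add_zero] at this
    exact this
  · rw [h.phi_zero, h.psi_zero]
    apply C2.ext <;> simp

lemma bloch_boundary {v : C2}
    (h0 : (phi p q z Real.pi 0 - ω) * v 0 + psi p q z Real.pi 0 * v 1 = 0)
    (h1 : phi p q z Real.pi 1 * v 0 + (psi p q z Real.pi 1 - ω) * v 1 = 0) :
    v 0 • phi p q z Real.pi + v 1 • psi p q z Real.pi =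
      ω • (v 0 • phi p q z 0 + v 1 • psi p q z 0) := by
  rw [(h.bloch_spec v).2]
  apply C2.ext
  · simp; linear_combination h0
  · simp; linear_combination h1

/-! ### Estimates -/

omit h in
lemma norm_resCoef_le {K N : ℝ} (hω : ‖ω‖ = 1) (hN : 0 ≤ N)
    (hK : ∀ x ∈ Icc 0 Real.pi, ‖phi p q z x‖ ≤ K ∧ ‖psi p q z x‖ ≤ K)
    (hf : IntervalIntegrable f volume 0 Real.pi) (hfN : ∫ x in (0 : ℝ)..Real.pi, ‖f x‖ ≤ N) :
    ‖resCoef₀ p q z ω f‖ ≤ (2 * K + 1) * (2 * K * N) ∧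
      ‖resCoef₁ p q z ω f‖ ≤ (2 * K + 1) * (2 * K * N) := by
  have hπ : Real.pi ∈ Icc 0 Real.pi := right_mem_Icc.2 Real.pi_pos.le
  have hK0 : 0 ≤ K := (norm_nonneg _).trans (hK _ hπ).1
  have b1 : ‖pair f (phi p q z)‖ ≤ 2 * K * N :=
    (norm_integral_dot_le hf (fun x hx => (hK x hx).1) hπ).trans (by gcongr)
  have b2 : ‖pair f (psi p q z)‖ ≤ 2 * K * N :=
    (norm_integral_dot_le hf (fun x hx => (hK x hx).2) hπ).trans (by gcongr)
  have m : ∀ i, ‖phi p q z Real.pi i‖ ≤ K ∧ ‖psi p q z Real.pi i‖ ≤ K := fun i =>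
    ⟨(norm_apply_le _ _).trans (hK _ hπ).1, (norm_apply_le _ _).trans (hK _ hπ).2⟩
  have n1 : ‖psi p q z Real.pi 1 - ω‖ ≤ K + 1 := (norm_sub_le _ _).trans (by
    rw [hω]; linarith [(m 1).2])
  have n2 : ‖phi p q z Real.pi 0 - ω‖ ≤ K + 1 := (norm_sub_le _ _).trans (by
    rw [hω]; linarith [(m 0).1])
  have hM : 0 ≤ 2 * K * N := by positivity
  constructor
  · rw [resCoef₀]
    refine (norm_add_le _ _).trans ?_
    rw [norm_mul, norm_mul]
    calc _ ≤ (K + 1) * (2 * K * N) + K * (2 * K * N) := by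
          gcongr
          exact (m 0).2
      _ = _ := by ring
  · rw [resCoef₁]
    refine (norm_sub_le _ _).trans ?_
    rw [norm_mul, norm_mul, norm_neg]
    calc _ ≤ K * (2 * K * N) + (K + 1) * (2 * K * N) := by
          gcongr
          exact (m 1).1
      _ = _ := by ring

omit h in
lemma norm_resFun_le {K N : ℝ} (hω : ‖ω‖ = 1) (hN : 0 ≤ N)
    (hK : ∀ x ∈ Icc 0 Real.pi, ‖phi p q z x‖ ≤ K ∧ ‖psi p q z x‖ ≤ K)
    (hf : IntervalIntegrable f volume 0 Real.pi) (hfN : ∫ x in (0 : ℝ)..Real.pi, ‖f x‖ ≤ N)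
    {x : ℝ} (hx : x ∈ Icc 0 Real.pi) :
    ‖resFun p q z ω f x‖ ≤ 4 * K ^ 2 * (2 * K + 1) * N := by
  obtain ⟨r0, r1⟩ := norm_resCoef_le hω hN hK hf hfN
  have hK0 : 0 ≤ K := (norm_nonneg _).trans (hK _ hx).1
  rw [resFun]
  refine (norm_add_le _ _).trans ?_
  rw [norm_smul, norm_smul]
  calc _ ≤ (2 * K + 1) * (2 * K * N) * K + (2 * K + 1) * (2 * K * N) * K := by
        gcongr
        · exact (hK x hx).1
        · exact (hK x hx).2
    _ = _ := by ring

/-- Near the spectrum the resolvent is given by the residue function, up to a bounded error. -/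
lemma norm_discr_smul_add_resFun_le {K N : ℝ} (hω : ω ≠ 0)
    (hK : ∀ x ∈ Icc 0 Real.pi, ‖phi p q z x‖ ≤ K ∧ ‖psi p q z x‖ ≤ K)
    (hf : IntervalIntegrable f volume 0 Real.pi) (hfN : ∫ x in (0 : ℝ)..Real.pi, ‖f x‖ ≤ N)
    (hu : IsSol p q (Icc 0 Real.pi) z f u) (hb : u Real.pi = ω • u 0)
    {x : ℝ} (hx : x ∈ Icc 0 Real.pi) :
    ‖(discr p q z - (ω + ω⁻¹)) • u x + resFun p q z ω f x‖ ≤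
      ‖discr p q z - (ω + ω⁻¹)‖ * (8 * K ^ 2 * N) := by
  have hK0 : 0 ≤ K := (norm_nonneg _).trans (hK _ hx).1
  have hπ : Real.pi ∈ Icc 0 Real.pi := right_mem_Icc.2 Real.pi_pos.le
  obtain ⟨e0, e1⟩ := h.discr_mul hω hu hb
  set D := discr p q z - (ω + ω⁻¹)
  have b1 : ∀ y ∈ Icc 0 Real.pi, ‖∫ s in (0 : ℝ)..y, dot (f s) (phi p q z s)‖ ≤ 2 * K * N :=
    fun y hy => (norm_integral_dot_le hf (fun x hx => (hK x hx).1) hy).trans (by gcongr)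
  have b2 : ∀ y ∈ Icc 0 Real.pi, ‖∫ s in (0 : ℝ)..y, dot (f s) (psi p q z s)‖ ≤ 2 * K * N :=
    fun y hy => (norm_integral_dot_le hf (fun x hx => (hK x hx).2) hy).trans (by gcongr)
  -- Substituting `discr_mul` eliminates the initial values of `u`, the only quantities that may
  -- blow up as `D → 0`.
  have key : D • u x + resFun p q z ω f x =
      D • ((pair f (psi p q z) - ∫ s in (0 : ℝ)..x, dot (f s) (psi p q z s)) • phi p q z x +
      ((∫ s in (0 : ℝ)..x, dot (f s) (phi p q z s)) - pair f (phi p q z)) • psi p q z x) := by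
    rw [h.representation hu hx, resFun]
    apply C2.ext
    · simp only [PiLp.add_apply, PiLp.smul_apply, smul_eq_mul]
      linear_combination phi p q z x 0 * e0 + psi p q z x 0 * e1
    · simp only [PiLp.add_apply, PiLp.smul_apply, smul_eq_mul]
      linear_combination phi p q z x 1 * e0 + psi p q z x 1 * e1
  rw [key, norm_smul]
  gcongr
  have c1 : ‖pair f (psi p q z) - ∫ s in (0 : ℝ)..x, dot (f s) (psi p q z s)‖ ≤ 4 * K * N :=
    (norm_sub_le _ _).trans (by
      have := b2 _ hπ; have := b2 _ hx; unfold pair; linarith)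
  have c2 : ‖(∫ s in (0 : ℝ)..x, dot (f s) (phi p q z s)) - pair f (phi p q z)‖ ≤ 4 * K * N :=
    (norm_sub_le _ _).trans (by
      have := b1 _ hπ; have := b1 _ hx; unfold pair; linarith)
  refine (norm_add_le _ _).trans ?_
  rw [norm_smul, norm_smul]
  calc _ ≤ 4 * K * N * K + 4 * K * N * K := by
        gcongr
        · exact (norm_nonneg _).trans c1
        · exact (hK x hx).1
        · exact (norm_nonneg _).trans c2
        · exact (hK x hx).2
    _ = _ := by ring

/-- The a priori bound behind the boundedness of the resolvent off the roots of the characteristic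
equation. -/
lemma norm_isSol_le {K N : ℝ} (hω : ‖ω‖ = 1) (hD : discr p q z ≠ ω + ω⁻¹) (hN : 0 ≤ N)
    (hK : ∀ x ∈ Icc 0 Real.pi, ‖phi p q z x‖ ≤ K ∧ ‖psi p q z x‖ ≤ K)
    (hf : IntervalIntegrable f volume 0 Real.pi) (hfN : ∫ x in (0 : ℝ)..Real.pi, ‖f x‖ ≤ N)
    (hu : IsSol p q (Icc 0 Real.pi) z f u) (hb : u Real.pi = ω • u 0)
    {x : ℝ} (hx : x ∈ Icc 0 Real.pi) :
    ‖u x‖ ≤ (8 * K ^ 2 + ‖discr p q z - (ω + ω⁻¹)‖⁻¹ * (4 * K ^ 2 * (2 * K + 1))) * N := by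
  have hω0 : ω ≠ 0 := norm_pos_iff.1 (by rw [hω]; exact one_pos)
  have h1 := h.norm_discr_smul_add_resFun_le hω0 hK hf hfN hu hb hx
  have h2 := norm_resFun_le hω hN hK hf hfN hx
  have hD' : 0 < ‖discr p q z - (ω + ω⁻¹)‖ := norm_pos_iff.2 (sub_ne_zero.2 hD)
  set D := discr p q z - (ω + ω⁻¹)
  have h3 : ‖D‖ * ‖u x‖ ≤ ‖D‖ * (8 * K ^ 2 * N) + 4 * K ^ 2 * (2 * K + 1) * N := by
    rw [← norm_smul]
    calc ‖D • u x‖ = ‖(D • u x + resFun p q z ω f x) - resFun p q z ω f x‖ := by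
          rw [add_sub_cancel_right]
      _ ≤ _ := (norm_sub_le _ _).trans (add_le_add h1 h2)
  refine le_of_mul_le_mul_left (h3.trans (le_of_eq ?_)) hD'
  field_simp

end BddPotential


/-! ### Resolvents of unbounded operators -/

section Resolvent

variable {E : Type*} [NormedAddCommGroup E] [NormedSpace ℂ E] {T : E →ₗ.[ℂ] E} {z w : ℂ}

lemma resolvent_spec (hz : z ∈ resolventSet T) : IsResolventAt T z (resolvent T z) := by
  have hz' : ∃ R : E →L[ℂ] E, IsResolventAt T z R := hz
  rw [resolvent, dif_pos hz']
  exact hz'.choose_spec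

/-- Bijectivity of `T - z` with a bound for the inverse. -/
lemma mem_resolventSet_of_bound (hs : ∀ f : E, ∃ y : T.domain, T y - z • (y : E) = f) (C : ℝ)
    (hb : ∀ y : T.domain, ‖(y : E)‖ ≤ C * ‖T y - z • (y : E)‖) : z ∈ resolventSet T := by
  have huniq : ∀ y y' : T.domain, T y - z • (y : E) = T y' - z • (y' : E) → y = y' := by
    intro y y' e
    have h1 := hb (y - y')
    have h2 : T (y - y') - z • ((y - y' : T.domain) : E) = 0 := by
      rw [LinearPMap.map_sub, AddSubgroupClass.coe_sub, smul_sub, sub_sub_sub_comm, e, sub_self]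
    rw [h2, norm_zero, mul_zero, norm_le_zero_iff] at h1
    exact sub_eq_zero.1 (Subtype.ext h1)
  choose r hr using hs
  let L : E →ₗ[ℂ] E :=
    { toFun := fun f => r f
      map_add' := fun f g => by
        rw [← AddMemClass.coe_add]
        congr 1
        apply huniq
        rw [hr, LinearPMap.map_add, AddMemClass.coe_add, smul_add, add_sub_add_comm, hr, hr]
      map_smul' := fun c f => by
        rw [RingHom.id_apply, ← SetLike.val_smul]
        congr 1
        apply huniq
        rw [hr, LinearPMap.map_smul, SetLike.val_smul, smul_comm z, ← smul_sub, hr] }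
  refine ⟨L.mkContinuous C fun f => ?_, fun f => ⟨(r f).2, hr f⟩, fun y => ?_⟩
  · have := hb (r f)
    rwa [hr] at this
  · exact congrArg Subtype.val (huniq _ _ (hr _))

/-- The first resolvent identity, in a form that determines `R(z)` from `R(w)`. -/
lemma resolvent_mul (hz : z ∈ resolventSet T) (hw : w ∈ resolventSet T) :
    resolvent T z * (1 - (z - w) • resolvent T w) = resolvent T w := by
  ext f
  obtain ⟨hd, he⟩ := (resolvent_spec hw).1 f
  have h1 := (resolvent_spec hz).2 ⟨_, hd⟩
  have h2 : T ⟨resolvent T w f, hd⟩ - z • resolvent T w f = f - (z - w) • resolvent T w f := by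
    rw [sub_eq_iff_eq_add.1 he, sub_smul]
    abel
  simp only at h1
  rw [h2] at h1
  exact h1

/-- Near `w` the identity `resolvent_mul` reads `R(z) = R(w) (1 - (z - w) R(w))⁻¹`, and inversion is
differentiable at units. -/
lemma resolvent_differentiableAt [CompleteSpace E] {U : Set ℂ} (hU : IsOpen U)
    (hUT : U ⊆ resolventSet T) (hw : w ∈ U) : DifferentiableAt ℂ (resolvent T) w := by
  let G : ℂ → E →L[ℂ] E := fun z => 1 - (z - w) • resolvent T w
  have hG : Differentiable ℂ G := by fun_prop
  have hGw : G w = 1 := by simp [G]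
  have hunit : ∀ᶠ z in 𝓝 w, IsUnit (G z) := by
    have : ∀ᶠ A in 𝓝 (G w), IsUnit A := by
      rw [hGw]
      exact (Units.isOpen (R := E →L[ℂ] E)).mem_nhds isUnit_one
    exact hG.continuous.continuousAt.eventually this
  have hd : DifferentiableAt ℂ (fun z => resolvent T w * Ring.inverse (G z)) w := by
    refine (differentiableAt_const _).mul ?_
    exact (differentiableAt_inverse (by rw [hGw]; exact isUnit_one)).comp w (hG w)
  refine hd.congr_of_eventuallyEq ?_
  filter_upwards [hunit, hU.mem_nhds hw] with z hz hzU
  have := resolvent_mul (hUT hzU) (hUT hw)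
  calc resolvent T z = resolvent T z * (G z * Ring.inverse (G z)) := by
        rw [Ring.mul_inverse_cancel _ hz, mul_one]
    _ = _ := by rw [← mul_assoc, this]

end Resolvent

/-! ### The quasi-periodic operators -/

/-- The multiplier `e^{iπt}`. -/
noncomputable def mult (t : ℝ) : ℂ := Complex.exp (Complex.I * Real.pi * t)

lemma norm_mult (t : ℝ) : ‖mult t‖ = 1 := by
  have : Complex.I * Real.pi * t = ((Real.pi * t : ℝ) : ℂ) * Complex.I := by push_cast; ring
  rw [mult, this, Complex.norm_exp_ofReal_mul_I]

lemma mult_ne_zero (t : ℝ) : mult t ≠ 0 := Complex.exp_ne_zero _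

lemma mult_add_inv (t : ℝ) : mult t + (mult t)⁻¹ = ((2 * Real.cos (Real.pi * t) : ℝ) : ℂ) := by
  rw [mult, ← Complex.exp_neg]
  push_cast
  rw [Complex.two_cos]
  congr 2 <;> ring

lemma mult_sq_ne_one {t : ℝ} (h : Real.sin (Real.pi * t) ≠ 0) : mult t ^ 2 ≠ 1 := by
  intro e
  have e1 : (mult t - (mult t)⁻¹) = 0 :=
    sub_eq_zero.2 (eq_inv_of_mul_eq_one_left (by rw [← sq, e]))
  apply h
  have : (Real.sin (Real.pi * t) : ℂ) = 0 := by
    have h2 := Complex.two_sin ((Real.pi * t : ℝ) : ℂ)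
    have h3 : Complex.exp (-((Real.pi * t : ℝ) : ℂ) * Complex.I) -
        Complex.exp (((Real.pi * t : ℝ) : ℂ) * Complex.I) = -(mult t - (mult t)⁻¹) := by
      rw [mult, ← Complex.exp_neg, neg_sub]
      push_cast
      congr 2 <;> ring
    rw [h3, e1] at h2
    push_cast at h2 ⊢
    simpa using h2
  exact_mod_cast this

lemma intervalIntegrable_L2 (f : L2 (Icc 0 Real.pi)) : IntervalIntegrable f volume 0 Real.pi := by
  rw [intervalIntegrable_iff_integrableOn_Icc_of_le Real.pi_pos.le]
  exact (Lp.memLp f).integrable (by norm_num)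

lemma exists_integral_norm_le : ∃ C, 0 < C ∧ ∀ f : L2 (Icc 0 Real.pi),
    ∫ x in (0 : ℝ)..Real.pi, ‖f x‖ ≤ C * ‖f‖ := by
  set μ := (volume : Measure ℝ).restrict (Icc 0 Real.pi)
  refine ⟨(μ univ ^ (1 / (1 : ENNReal).toReal - 1 / (2 : ENNReal).toReal)).toReal + 1,
    by positivity, fun f => ?_⟩
  have hm := Lp.memLp f
  have h1 := eLpNorm_le_eLpNorm_mul_rpow_measure_univ (p := 1) (q := 2) (by norm_num)
    hm.aestronglyMeasurable
  have hfin : μ univ ^ (1 / (1 : ENNReal).toReal - 1 / (2 : ENNReal).toReal) ≠ ⊤ :=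
    ENNReal.rpow_ne_top_of_nonneg (by norm_num) (measure_ne_top μ _)
  rw [intervalIntegral.integral_of_le Real.pi_pos.le, ← integral_Icc_eq_integral_Ioc,
    integral_norm_eq_lintegral_enorm hm.aestronglyMeasurable, ← eLpNorm_one_eq_lintegral_enorm]
  calc (eLpNorm f 1 μ).toReal ≤ (eLpNorm f 2 μ * μ univ ^ (1 / (1 : ENNReal).toReal -
        1 / (2 : ENNReal).toReal)).toReal :=
        ENNReal.toReal_mono (ENNReal.mul_ne_top hm.eLpNorm_ne_top hfin) h1
    _ = ‖f‖ * (μ univ ^ (1 / (1 : ENNReal).toReal - 1 / (2 : ENNReal).toReal)).toReal := by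
        rw [ENNReal.toReal_mul, Lp.norm_def]
    _ ≤ _ := by nlinarith [norm_nonneg f]

lemma exists_norm_L2_le : ∃ C, 0 < C ∧ ∀ (f : L2 (Icc 0 Real.pi)) (u : ℝ → C2) (b : ℝ), 0 ≤ b →
    f =ᵐ[volume.restrict (Icc 0 Real.pi)] u → (∀ x ∈ Icc 0 Real.pi, ‖u x‖ ≤ b) →
    ‖f‖ ≤ C * b := by
  refine ⟨(measureUnivNNReal (volume.restrict (Icc 0 Real.pi)) : ℝ) ^ (2 : ENNReal).toReal⁻¹ + 1,
    by positivity, fun f u b hb hf hu => ?_⟩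
  have := Lp.norm_le_of_ae_bound (f := f) hb (by
    filter_upwards [hf, ae_restrict_mem measurableSet_Icc] with x hx hxI
    rw [hx]; exact hu x hxI)
  refine this.trans ?_
  nlinarith

lemma memLp_of_continuousOn {u : ℝ → C2} (hu : ContinuousOn u (Icc 0 Real.pi)) :
    MemLp u 2 (volume.restrict (Icc 0 Real.pi)) := by
  obtain ⟨C, hC⟩ := isCompact_Icc.exists_bound_of_continuousOn hu
  refine MemLp.of_bound (hu.aestronglyMeasurable measurableSet_Icc) C ?_
  filter_upwards [ae_restrict_mem measurableSet_Icc] with x hx using hC x hx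

section Op

variable {p q : ℝ → ℂ} {t : ℝ} {z : ℂ}

/-- Passage from the operator to the boundary value problem, with `(L_t - z) y` as the source;
`op_of_isSol` goes back. -/
lemma mem_graph_op {y w : L2 (Icc 0 Real.pi)} (hyw : (y, w) ∈ (op p q t).graph) (z : ℂ) :
    ∃ u, IsSol p q (Icc 0 Real.pi) z (w - z • y : L2 (Icc 0 Real.pi)) u ∧
      u Real.pi = mult t • u 0 ∧ y =ᵐ[volume.restrict (Icc 0 Real.pi)] u := by
  rw [op_graph] at hyw
  obtain ⟨u, g, hu, hb, hy, hw⟩ := hyw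
  refine ⟨u, ⟨g, hu, ?_⟩, hb, hy⟩
  filter_upwards [hy, hw, Lp.coeFn_sub w (z • y), Lp.coeFn_smul z y] with x h1 h2 h3 h4
  rw [h3, Pi.sub_apply, h4, Pi.smul_apply, h1, h2, add_sub_cancel]

lemma op_spec (z : ℂ) (y : (op p q t).domain) :
    ∃ u, IsSol p q (Icc 0 Real.pi) z (op p q t y - z • (y : L2 (Icc 0 Real.pi)) :
        L2 (Icc 0 Real.pi)) u ∧
      u Real.pi = mult t • u 0 ∧
      (y : L2 (Icc 0 Real.pi)) =ᵐ[volume.restrict (Icc 0 Real.pi)] u :=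
  mem_graph_op ((op p q t).mem_graph y) z

lemma op_of_isSol {y w : L2 (Icc 0 Real.pi)} {f u : ℝ → C2}
    (hu : IsSol p q (Icc 0 Real.pi) z f u) (hb : u Real.pi = mult t • u 0)
    (hy : y =ᵐ[volume.restrict (Icc 0 Real.pi)] u)
    (hw : w =ᵐ[volume.restrict (Icc 0 Real.pi)] f) :
    ∃ hd : y ∈ (op p q t).domain, op p q t ⟨y, hd⟩ - z • y = w := by
  obtain ⟨g, hg, hd⟩ := hu
  have hgr : (y, w + z • y) ∈ (op p q t).graph := by
    rw [op_graph]
    refine ⟨u, g, hg, hb, hy, ?_⟩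
    filter_upwards [hy, hw, hd, Lp.coeFn_add w (z • y), Lp.coeFn_smul z y] with x h1 h2 h3 h4 h5
    rw [h4, Pi.add_apply, h5, Pi.smul_apply, h1, h2, h3, add_comm]
  obtain ⟨y', hy', hw'⟩ := ((op p q t).mem_graph_iff).1 hgr
  simp only at hy' hw'
  subst hy'
  exact ⟨y'.2, by rw [Subtype.coe_eta, hw', add_sub_cancel_right]⟩

lemma exists_L2_of_isSol {f u : ℝ → C2} (hu : IsSol p q (Icc 0 Real.pi) z f u) :
    ∃ y : L2 (Icc 0 Real.pi), y =ᵐ[volume.restrict (Icc 0 Real.pi)] u :=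
  ⟨(memLp_of_continuousOn (hu.continuousOn subset_rfl)).toLp u, MemLp.coeFn_toLp _⟩

end Op

namespace BddPotential

variable {p q : ℝ → ℂ} {B : ℝ} (h : BddPotential p q B) {t : ℝ} {z : ℂ}

include h

/-- Solvability comes from `exists_isSol_boundary`. The bound runs from `L²` to `L¹` for the source,
to the supremum norm of the solution by `norm_isSol_le`, and back to `L²`. -/
lemma mem_resolventSet (hD : discr p q z ≠ mult t + (mult t)⁻¹) :
    z ∈ resolventSet (op p q t) := by
  obtain ⟨K, hK0, hK⟩ := h.exists_bound ‖z‖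
  obtain ⟨C₁, hC₁, hN⟩ := exists_integral_norm_le
  obtain ⟨C₂, hC₂, hM⟩ := exists_norm_L2_le
  refine mem_resolventSet_of_bound (fun f => ?_) (C₂ * ((8 * K ^ 2 +
    ‖discr p q z - (mult t + (mult t)⁻¹)‖⁻¹ * (4 * K ^ 2 * (2 * K + 1))) * C₁)) fun y => ?_
  · obtain ⟨u, hu, hb⟩ := h.exists_isSol_boundary (mult_ne_zero t) hD (intervalIntegrable_L2 f)
    obtain ⟨y, hy⟩ := exists_L2_of_isSol hu
    obtain ⟨hd, he⟩ := op_of_isSol hu hb hy (EventuallyEq.refl _ _)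
    exact ⟨⟨y, hd⟩, he⟩
  · obtain ⟨u, hu, hb, hy⟩ := op_spec z y
    have hb' := fun x hx => h.norm_isSol_le (x := x) (norm_mult t) hD (by positivity)
      (hK z le_rfl) (intervalIntegrable_L2 _) (hN _) hu hb hx
    refine (hM _ u _ (by positivity) hy hb').trans (le_of_eq ?_)
    ring

/-- The eigenvalues are the roots of the characteristic equation. -/
lemma discr_eq_of_isEigenvector {y : L2 (Icc 0 Real.pi)} (hy : IsEigenvector (op p q t) z y) :
    discr p q z = mult t + (mult t)⁻¹ := by
  by_contra hD
  obtain ⟨hy0, hd, he⟩ := hy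
  apply hy0
  have := (resolvent_spec (h.mem_resolventSet hD)).2 ⟨y, hd⟩
  rw [he] at this
  simpa using this.symm

omit h in
lemma coeFn_eq_zero_of_sub {y w : L2 (Icc 0 Real.pi)} (e : w = z • y) :
    ((w - z • y : L2 (Icc 0 Real.pi)) : ℝ → C2) =ᵐ[volume.restrict (Icc 0 Real.pi)]
      (0 : ℝ → C2) := by
  rw [e, sub_self]
  exact Lp.coeFn_zero _ _ _

/-- The function in `L²` that solves a homogeneous boundary problem is a Bloch function. -/
lemma exists_bloch_L2 (hω2 : mult t ^ 2 ≠ 1) (hD : discr p q z = mult t + (mult t)⁻¹) :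
    ∃ (v : C2) (Y : L2 (Icc 0 Real.pi)), v ≠ 0 ∧
      (phi p q z Real.pi 0 - mult t) * v 0 + psi p q z Real.pi 0 * v 1 = 0 ∧
      phi p q z Real.pi 1 * v 0 + (psi p q z Real.pi 1 - mult t) * v 1 = 0 ∧
      (∀ w : C2, (phi p q z Real.pi 0 - mult t) * w 0 + psi p q z Real.pi 0 * w 1 = 0 →
        phi p q z Real.pi 1 * w 0 + (psi p q z Real.pi 1 - mult t) * w 1 = 0 →
        ∃ κ : ℂ, w = κ • v) ∧
      Y =ᵐ[volume.restrict (Icc 0 Real.pi)] (fun x => v 0 • phi p q z x + v 1 • psi p q z x) ∧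
      ∀ y w : L2 (Icc 0 Real.pi), (y, w) ∈ (op p q t).graph → w = z • y → ∃ κ : ℂ, y = κ • Y := by
  obtain ⟨v, hv, e0, e1, huniq⟩ := h.exists_bloch (mult_ne_zero t) hω2 hD
  have hV := (h.bloch_spec (z := z) v).1.mono (subset_univ (Icc 0 Real.pi))
  obtain ⟨Y, hY⟩ := exists_L2_of_isSol hV
  refine ⟨v, Y, hv, e0, e1, huniq, hY, fun y w hyw e => ?_⟩
  obtain ⟨u, hu, hb, hy⟩ := mem_graph_op hyw z
  have hu0 := hu.congr (coeFn_eq_zero_of_sub e)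
  have hp0 : ∀ U, pair 0 U = 0 := by intro U; simp [pair, dot]
  have hbd := (h.boundary_iff hu0).1 hb
  simp only [hp0, sub_zero, add_zero, mul_zero] at hbd
  obtain ⟨κ, hκ⟩ := huniq (u 0) hbd.1 hbd.2
  refine ⟨κ, Lp.ext ?_⟩
  filter_upwards [hy, hY, Lp.coeFn_smul κ Y, ae_restrict_mem measurableSet_Icc] with x h1 h2 h3 hx
  rw [h1, h3, Pi.smul_apply, h2, h.eqOn_of_homogeneous hu0 hx, hκ]
  simp only [PiLp.smul_apply, smul_add, smul_smul, smul_eq_mul]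

/-- A simple root of the characteristic equation is a simple eigenvalue. -/
lemma algMultiplicity_le_one (hω2 : discr p q z = mult t + (mult t)⁻¹ → mult t ^ 2 ≠ 1)
    (hF : discrDeriv p q z ≠ 0) :
    algMultiplicity (op p q t) z ≤ 1 := by
  -- It is enough that one line contains all root vectors.
  suffices H : ∃ Y : L2 (Icc 0 Real.pi), ∀ k, kerPow (op p q t) z k ≤ Submodule.span ℂ {Y} by
    obtain ⟨Y, hY⟩ := H
    rw [algMultiplicity, Cardinal.toENat_le_one]
    refine (Submodule.rank_mono (iSup_le hY)).trans ((rank_span_le _).trans ?_)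
    simp
  have hstep : ∀ {k : ℕ} {y : L2 (Icc 0 Real.pi)}, y ∈ kerPow (op p q t) z (k + 1) →
      ∃ w, (y, w) ∈ (op p q t).graph ∧ w - z • y ∈ kerPow (op p q t) z k := by
    intro k y hy
    obtain ⟨⟨y', w⟩, ⟨hg, hk⟩, rfl⟩ := hy
    exact ⟨w, hg, hk⟩
  by_cases hD : discr p q z = mult t + (mult t)⁻¹
  · obtain ⟨v, Y, hv, e0, e1, huniq, hY, hYu⟩ := h.exists_bloch_L2 (hω2 hD) hD
    refine ⟨Y, fun k => ?_⟩
    induction k with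
    | zero => exact bot_le
    | succ k ih =>
      intro y hy
      obtain ⟨w, hg, hk⟩ := hstep hy
      obtain ⟨κ, hκ⟩ := Submodule.mem_span_singleton.1 (ih hk)
      obtain ⟨u, hu, hb, hyu⟩ := mem_graph_op hg z
      have hu' := hu.congr (k := κ • fun x => v 0 • phi p q z x + v 1 • psi p q z x) (by
        rw [← hκ]
        filter_upwards [hY, Lp.coeFn_smul κ Y] with x h1 h2
        rw [h2, Pi.smul_apply, h1, Pi.smul_apply])
      -- Solvability of `(L_t - z) y = κ Y` makes the residue coefficients of `κ Y` vanish; by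
      -- `resCoef_bloch` they are `κ Δ'(z) v`, so `κ = 0` and there are no associated vectors.
      obtain ⟨r0, r1⟩ := h.resCoef_eq_zero (mult_ne_zero t) hD hu' hb
      obtain ⟨b0, b1⟩ := h.resCoef_bloch e0 e1
      rw [resCoef₀, pair_smul_left, pair_smul_left] at r0
      rw [resCoef₁, pair_smul_left, pair_smul_left] at r1
      rw [resCoef₀] at b0
      rw [resCoef₁] at b1
      have hκ0 : κ = 0 := by
        by_contra hne
        have c0 : κ * discrDeriv p q z * v 0 = 0 := by linear_combination r0 - κ * b0
        have c1 : κ * discrDeriv p q z * v 1 = 0 := by linear_combination r1 - κ * b1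
        apply hv
        apply C2.ext
        · simpa [hne, hF] using c0
        · simpa [hne, hF] using c1
      rw [hκ0, zero_smul] at hκ
      obtain ⟨κ', hκ'⟩ := hYu y w hg (sub_eq_zero.1 hκ.symm)
      exact Submodule.mem_span_singleton.2 ⟨κ', hκ'.symm⟩
  -- Off the roots there are no eigenvectors, so every kernel is trivial.
  · refine ⟨0, fun k => ?_⟩
    rw [Submodule.span_zero_singleton]
    induction k with
    | zero => exact le_rfl
    | succ k ih =>
      intro y hy
      obtain ⟨w, hg, hk⟩ := hstep hy
      have hw : w = z • y := sub_eq_zero.1 ((Submodule.mem_bot ℂ).1 (ih hk))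
      obtain ⟨y', rfl, hy'⟩ := ((op p q t).mem_graph_iff).1 hg
      by_contra hne
      exact hD (h.discr_eq_of_isEigenvector (y := y') ⟨fun e => hne ((Submodule.mem_bot ℂ).2 e),
        y'.2, hy'.trans hw⟩)

end BddPotential


/-! ### Circles -/

/-- The circle with centre `c` and radius `r`, parametrized by `[0, 1]`. -/
noncomputable def circ (c : ℂ) (r : ℝ) (s : ℝ) : ℂ := circleMap c r (2 * Real.pi * s)

lemma hasDerivAt_circ (c : ℂ) (r s : ℝ) :
    HasDerivAt (circ c r) ((2 * Real.pi : ℝ) • deriv (circleMap c r) (2 * Real.pi * s)) s := by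
  have h1 : HasDerivAt (fun s : ℝ => 2 * Real.pi * s) (2 * Real.pi) s := by
    simpa using (hasDerivAt_id s).const_mul (2 * Real.pi)
  have h2 := (differentiable_circleMap c r (2 * Real.pi * s)).hasDerivAt
  exact h2.scomp s h1

lemma contDiff_circ (c : ℂ) (r : ℝ) : ContDiff ℝ 1 (circ c r) :=
  (contDiff_circleMap c r).comp (contDiff_const.mul contDiff_id)

lemma integral_circ {E : Type*} [NormedAddCommGroup E] [NormedSpace ℂ E] (c : ℂ) (r : ℝ)
    (f : ℂ → E) : ∫ s in (0 : ℝ)..1, deriv (circ c r) s • f (circ c r s) = ∮ z in C(c, r), f z := by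
  simp_rw [fun s => (hasDerivAt_circ c r s).deriv, smul_assoc]
  rw [intervalIntegral.integral_smul, circleIntegral]
  have := intervalIntegral.smul_integral_comp_mul_left (a := 0) (b := 1)
    (fun θ => deriv (circleMap c r) θ • f (circleMap c r θ)) (2 * Real.pi)
  simp only [mul_zero, mul_one] at this
  exact this

lemma circ_image_subset {c : ℂ} {r : ℝ} (hr : 0 ≤ r) : circ c r '' Icc 0 1 ⊆ Metric.sphere c r := by
  rintro _ ⟨s, -, rfl⟩
  exact circleMap_mem_sphere c hr _

lemma sphere_subset_circ_image {c : ℂ} {r : ℝ} (hr : 0 ≤ r) :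
    Metric.sphere c r ⊆ circ c r '' Icc 0 1 := by
  intro z hz
  rw [← abs_of_nonneg hr, ← image_circleMap_Ioc c r] at hz
  obtain ⟨θ, hθ, rfl⟩ := hz
  have hπ := Real.two_pi_pos
  refine ⟨θ / (2 * Real.pi), ⟨by have := hθ.1.le; positivity, (div_le_one hπ).2 hθ.2⟩, ?_⟩
  rw [circ, mul_div_cancel₀ _ hπ.ne']

lemma isContour_circ {c : ℂ} {r : ℝ} (hr : 0 < r) : IsContour (circ c r) where
  continuousOn := (contDiff_circ c r).continuous.continuousOn
  closed := by simp [circ, circleMap]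
  simple := by
    intro s hs s' hs' e
    have hπ := Real.two_pi_pos
    have := injOn_circleMap_of_abs_sub_le' (c := c) hr.ne' (a := 0) (b := 2 * Real.pi)
      (by simp) (x₁ := 2 * Real.pi * s) ?_ (x₂ := 2 * Real.pi * s') ?_ e
    · exact mul_left_cancel₀ hπ.ne' this
    · exact ⟨by have := hs.1; positivity, by nlinarith [hs.2]⟩
    · exact ⟨by have := hs'.1; positivity, by nlinarith [hs'.2]⟩
  piecewise := ⟨∅, fun _ _ _ _ _ _ => (contDiff_circ c r).contDiffOn⟩

/-- Outside the closed disc the winding integral vanishes by Cauchy's theorem. Only this direction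
is needed, since the conditions on enclosed eigenvalues are upper bounds. -/
lemma mem_ball_of_encloses {c z : ℂ} {r : ℝ} (hr : 0 < r) (h : Encloses (circ c r) z) :
    z ∈ Metric.ball c r := by
  by_contra hz
  have hz' : z ∉ Metric.closedBall c r := by
    intro hc
    have : z ∈ Metric.sphere c r := by
      rw [Metric.mem_sphere]
      rw [Metric.mem_ball, not_lt] at hz
      exact le_antisymm hc hz
    exact h.1 (sphere_subset_circ_image hr.le this)
  apply h.2
  have := integral_circ c r (fun w => (w - z)⁻¹)
  simp only [smul_eq_mul] at this
  simp_rw [div_eq_mul_inv]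
  rw [this]
  have hne : ∀ w ∈ Metric.closedBall c r, w - z ≠ 0 := by
    intro w hw e
    rw [sub_eq_zero] at e
    exact hz' (e ▸ hw)
  refine Complex.circleIntegral_eq_zero_of_differentiable_on_off_countable hr.le
    countable_empty ?_ ?_
  · exact ContinuousOn.inv₀ (by fun_prop) hne
  · intro w hw
    exact DifferentiableAt.inv (by fun_prop) (hne w (Metric.ball_subset_closedBall hw.1))

/-! ### The residue of the resolvent -/

lemma inner_L2_eq_pair {g y : L2 (Icc 0 Real.pi)} {u : ℝ → C2}
    (hy : y =ᵐ[volume.restrict (Icc 0 Real.pi)] u) :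
    inner ℂ g y = pair (fun x => conjC2 (g x)) u := by
  rw [L2.inner_def, pair, intervalIntegral.integral_of_le Real.pi_pos.le,
    ← integral_Icc_eq_integral_Ioc]
  refine integral_congr_ae ?_
  filter_upwards [hy] with x hx
  rw [hx, inner_eq_dot, dot_comm]

lemma intervalIntegrable_conj (g : L2 (Icc 0 Real.pi)) :
    IntervalIntegrable (fun x => conjC2 (g x)) volume 0 Real.pi :=
  ⟨conjC2.integrable_comp (intervalIntegrable_L2 g).1,
    conjC2.integrable_comp (intervalIntegrable_L2 g).2⟩

/-- The bilinear form of the residue. -/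
noncomputable def resForm (p q : ℝ → ℂ) (z ω : ℂ) (k f : ℝ → C2) : ℂ :=
  resCoef₀ p q z ω f * pair k (phi p q z) + resCoef₁ p q z ω f * pair k (psi p q z)

namespace BddPotential

variable {p q : ℝ → ℂ} {B : ℝ} (h : BddPotential p q B) {t : ℝ} {z : ℂ}

include h

lemma pair_resFun {k : ℝ → C2} (hk : IntervalIntegrable k volume 0 Real.pi) (z ω : ℂ)
    (f : ℝ → C2) : pair k (resFun p q z ω f) = resForm p q z ω k f :=
  pair_add_smul hk (h.continuous_phi z).continuousOn (h.continuous_psi z).continuousOn _ _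

lemma continuous_resForm {k f : ℝ → C2} (hk : IntervalIntegrable k volume 0 Real.pi)
    (hf : IntervalIntegrable f volume 0 Real.pi) :
    Continuous fun x : ℂ × ℂ => resForm p q x.1 x.2 k f := by
  have hπ : Real.pi ∈ Icc 0 Real.pi := right_mem_Icc.2 Real.pi_pos.le
  have c1 : ∀ i : Fin 2, Continuous fun x : ℂ × ℂ => phi p q x.1 Real.pi i := fun i =>
    (EuclideanSpace.proj (𝕜 := ℂ) i).continuous.comp
      ((h.continuous_phi_param hπ).comp continuous_fst)
  have c2 : ∀ i : Fin 2, Continuous fun x : ℂ × ℂ => psi p q x.1 Real.pi i := fun i =>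
    (EuclideanSpace.proj (𝕜 := ℂ) i).continuous.comp
      ((h.continuous_psi_param hπ).comp continuous_fst)
  have d1 := (h.continuous_pair_phi hk).comp (continuous_fst (X := ℂ) (Y := ℂ))
  have d2 := (h.continuous_pair_psi hk).comp (continuous_fst (X := ℂ) (Y := ℂ))
  have d3 := (h.continuous_pair_phi hf).comp (continuous_fst (X := ℂ) (Y := ℂ))
  have d4 := (h.continuous_pair_psi hf).comp (continuous_fst (X := ℂ) (Y := ℂ))
  unfold resForm resCoef₀ resCoef₁
  exact (((((c2 1).sub continuous_snd).mul d4).add ((c2 0).mul d3)).mul d1).add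
    ((((c1 1).neg.mul d4).sub (((c1 0).sub continuous_snd).mul d3)).mul d2)

/-- Pair `a phi + b psi` with its own conjugate: the result is its squared `L²` norm, positive
because the value at `0` is `(a, b)`. -/
lemma exists_pair_ne_zero (z : ℂ) {a b : ℂ} (hab : ¬(a = 0 ∧ b = 0)) :
    ∃ k : ℝ → C2, Continuous k ∧ a * pair k (phi p q z) + b * pair k (psi p q z) ≠ 0 := by
  let w : ℝ → C2 := fun x => a • phi p q z x + b • psi p q z x
  have hw : Continuous w :=
    ((h.continuous_phi z).const_smul a).add ((h.continuous_psi z).const_smul b)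
  refine ⟨fun x => conjC2 (w x), conjC2.continuous.comp hw, ?_⟩
  have hcw : Continuous fun x => conjC2 (w x) := conjC2.continuous.comp hw
  rw [← pair_add_smul (hcw.intervalIntegrable _ _)
    (h.continuous_phi z).continuousOn (h.continuous_psi z).continuousOn]
  have h0 : w 0 ≠ 0 := by
    intro e
    have e0 := congrArg (fun v : C2 => v 0) e
    have e1 := congrArg (fun v : C2 => v 1) e
    simp [w, h.phi_zero, h.psi_zero] at e0 e1
    exact hab ⟨e0, e1⟩
  have hpos := integral_norm_sq_pos hw.continuousOn h0
  have : pair (fun x => conjC2 (w x)) w = ((∫ x in (0 : ℝ)..Real.pi, ‖w x‖ ^ 2 : ℝ) : ℂ) := by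
    rw [pair, ← intervalIntegral.integral_ofReal]
    refine intervalIntegral.integral_congr fun x _ => ?_
    rw [dot_comm, dot_conjC2_self]
  change pair (fun x => conjC2 (w x)) w ≠ 0
  rw [this]
  exact_mod_cast hpos.ne'

/-- The residue form does not vanish identically. -/
lemma exists_resForm_ne_zero (hω2 : mult t ^ 2 ≠ 1) (z : ℂ) :
    ∃ g f : L2 (Icc 0 Real.pi), resForm p q z (mult t) (fun x => conjC2 (g x)) f ≠ 0 := by
  obtain ⟨k, hk, hne⟩ : ∃ k : ℝ → C2, Continuous k ∧
      ¬(resCoef₀ p q z (mult t) k = 0 ∧ resCoef₁ p q z (mult t) k = 0) := by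
    -- The coefficients of `resCoef₀` and `resCoef₁` are, up to sign, the two columns of `M - ω`,
    -- and one of them is nonzero.
    by_cases H : psi p q z Real.pi 0 = 0 ∧ psi p q z Real.pi 1 - mult t = 0
    · have H' : ¬(-(phi p q z Real.pi 0 - mult t) = 0 ∧ -phi p q z Real.pi 1 = 0) := fun H' =>
        h.monodromy_ne (z := z) hω2 ⟨neg_eq_zero.1 H'.1, H.1, neg_eq_zero.1 H'.2, H.2⟩
      obtain ⟨k, hk, hne⟩ := h.exists_pair_ne_zero z H'
      exact ⟨k, hk, fun e => hne (by rw [← e.2, resCoef₁]; ring)⟩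
    · obtain ⟨k, hk, hne⟩ := h.exists_pair_ne_zero z H
      exact ⟨k, hk, fun e => hne (by rw [← e.1, resCoef₀]; ring)⟩
  obtain ⟨k', hk', hne'⟩ := h.exists_pair_ne_zero z hne
  have hc : Continuous fun x => conjC2 (k' x) := conjC2.continuous.comp hk'
  have hg := MemLp.coeFn_toLp (memLp_of_continuousOn hc.continuousOn)
  have hf := MemLp.coeFn_toLp (memLp_of_continuousOn hk.continuousOn)
  refine ⟨(memLp_of_continuousOn hc.continuousOn).toLp _,
    (memLp_of_continuousOn hk.continuousOn).toLp _, ?_⟩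
  have hg' : (fun x => conjC2 (((memLp_of_continuousOn hc.continuousOn).toLp _ :
      L2 (Icc 0 Real.pi)) x)) =ᵐ[volume.restrict (Icc 0 Real.pi)] k' := by
    filter_upwards [hg] with x hx
    rw [hx]
    apply C2.ext <;> simp
  rw [resForm, resCoef₀, resCoef₁, pair_congr _ hf, pair_congr _ hf, pair_congr _ hg',
    pair_congr _ hg']
  exact hne'

lemma exists_isSol_resolvent (hD : discr p q z ≠ mult t + (mult t)⁻¹) (f : L2 (Icc 0 Real.pi)) :
    ∃ u, IsSol p q (Icc 0 Real.pi) z f u ∧ u Real.pi = mult t • u 0 ∧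
      resolvent (op p q t) z f =ᵐ[volume.restrict (Icc 0 Real.pi)] u := by
  obtain ⟨hd, he⟩ := (resolvent_spec (h.mem_resolventSet hD)).1 f
  obtain ⟨u, hu, hb, hy⟩ := mem_graph_op ((op p q t).mem_graph ⟨_, hd⟩) z
  refine ⟨u, ?_, hb, hy⟩
  rwa [he] at hu

lemma norm_discr_mul_pair_add_le {ω : ℂ} (hω : ω ≠ 0) {K N : ℝ}
    (hK : ∀ x ∈ Icc 0 Real.pi, ‖phi p q z x‖ ≤ K ∧ ‖psi p q z x‖ ≤ K) {k f u : ℝ → C2}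
    (hk : IntervalIntegrable k volume 0 Real.pi) (hf : IntervalIntegrable f volume 0 Real.pi)
    (hfN : ∫ x in (0 : ℝ)..Real.pi, ‖f x‖ ≤ N)
    (hu : IsSol p q (Icc 0 Real.pi) z f u) (hb : u Real.pi = ω • u 0) :
    ‖(discr p q z - (ω + ω⁻¹)) * pair k u + resForm p q z ω k f‖ ≤
      2 * (‖discr p q z - (ω + ω⁻¹)‖ * (8 * K ^ 2 * N)) * ∫ x in (0 : ℝ)..Real.pi, ‖k x‖ := by
  have hr : Continuous (resFun p q z ω f) :=
    ((h.continuous_phi z).const_smul (resCoef₀ p q z ω f)).add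
      ((h.continuous_psi z).const_smul (resCoef₁ p q z ω f))
  have e := pair_add_smul hk (hu.continuousOn subset_rfl) hr.continuousOn
    (discr p q z - (ω + ω⁻¹)) 1
  rw [h.pair_resFun hk, one_mul] at e
  rw [← e]
  refine norm_integral_dot_le hk (fun x hx => ?_) (right_mem_Icc.2 Real.pi_pos.le)
  rw [one_smul]
  exact h.norm_discr_smul_add_resFun_le hω hK hf hfN hu hb hx

lemma norm_discr_mul_inner_add_le (hD : discr p q z ≠ mult t + (mult t)⁻¹) {K : ℝ}
    (hK : ∀ x ∈ Icc 0 Real.pi, ‖phi p q z x‖ ≤ K ∧ ‖psi p q z x‖ ≤ K)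
    (g f : L2 (Icc 0 Real.pi)) :
    ‖(discr p q z - (mult t + (mult t)⁻¹)) * inner ℂ g (resolvent (op p q t) z f) +
      resForm p q z (mult t) (fun x => conjC2 (g x)) f‖ ≤
    2 * (‖discr p q z - (mult t + (mult t)⁻¹)‖ *
      (8 * K ^ 2 * ∫ x in (0 : ℝ)..Real.pi, ‖f x‖)) *
      ∫ x in (0 : ℝ)..Real.pi, ‖conjC2 (g x)‖ := by
  obtain ⟨u, hu, hb, hy⟩ := h.exists_isSol_resolvent hD f
  rw [inner_L2_eq_pair hy]
  exact h.norm_discr_mul_pair_add_le (mult_ne_zero t) hK (intervalIntegrable_conj g)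
    (intervalIntegrable_L2 f) le_rfl hu hb

/-- The residue of the resolvent at a simple eigenvalue. -/
lemma tendsto_residue (hD : discr p q z = mult t + (mult t)⁻¹) (hF : discrDeriv p q z ≠ 0)
    (hne : ∀ᶠ ζ in 𝓝[≠] z, discr p q ζ ≠ mult t + (mult t)⁻¹) (g f : L2 (Icc 0 Real.pi)) :
    Tendsto (fun ζ => (ζ - z) * inner ℂ g (resolvent (op p q t) ζ f)) (𝓝[≠] z)
      (𝓝 (-resForm p q z (mult t) (fun x => conjC2 (g x)) f / discrDeriv p q z)) := by
  obtain ⟨K, hK0, hK⟩ := h.exists_bound (‖z‖ + 1)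
  set N := ∫ x in (0 : ℝ)..Real.pi, ‖f x‖
  set ω := mult t
  set k : ℝ → C2 := fun x => conjC2 (g x)
  have hk : IntervalIntegrable k volume 0 Real.pi := intervalIntegrable_conj g
  have hslope : Tendsto (fun ζ => (ζ - z) / (discr p q ζ - (ω + ω⁻¹))) (𝓝[≠] z)
      (𝓝 (discrDeriv p q z)⁻¹) := by
    have := (hasDerivAt_iff_tendsto_slope.1 (h.hasDerivAt_discr z)).inv₀ hF
    refine this.congr fun ζ => ?_
    rw [slope_def_field, inv_div, hD]
  have hDlim : Tendsto (fun ζ => ‖discr p q ζ - (ω + ω⁻¹)‖) (𝓝[≠] z) (𝓝 0) := by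
    have := (h.differentiable_discr.continuous.tendsto z).mono_left
      (nhdsWithin_le_nhds (s := {z}ᶜ))
    rw [hD] at this
    exact tendsto_iff_norm_sub_tendsto_zero.1 this
  have hform : Tendsto (fun ζ => resForm p q ζ ω k f) (𝓝[≠] z) (𝓝 (resForm p q z ω k f)) :=
    (((h.continuous_resForm hk (intervalIntegrable_L2 f)).comp
      (Continuous.prodMk_left ω)).tendsto z).mono_left nhdsWithin_le_nhds
  have herr : Tendsto (fun ζ => (discr p q ζ - (ω + ω⁻¹)) * inner ℂ g (resolvent (op p q t) ζ f) +
      resForm p q ζ ω k f) (𝓝[≠] z) (𝓝 0) := by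
    refine squeeze_zero_norm' (a := fun ζ => 2 * (‖discr p q ζ - (ω + ω⁻¹)‖ * (8 * K ^ 2 * N)) *
      ∫ x in (0 : ℝ)..Real.pi, ‖k x‖) ?_ ?_
    · filter_upwards [hne, mem_nhdsWithin_of_mem_nhds (Metric.ball_mem_nhds z one_pos)] with ζ h1 h2
      have hζ : ‖ζ‖ ≤ ‖z‖ + 1 := by
        rw [Metric.mem_ball, dist_eq_norm] at h2
        calc ‖ζ‖ = ‖z + (ζ - z)‖ := by congr 1; ring
          _ ≤ _ := (norm_add_le _ _).trans (by linarith)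
      exact h.norm_discr_mul_inner_add_le h1 (hK ζ hζ) g f
    · simpa using ((hDlim.mul_const (8 * K ^ 2 * N)).const_mul 2).mul_const
        (∫ x in (0 : ℝ)..Real.pi, ‖k x‖)
  -- The factor `ζ - z` is split as the inverse slope of `Δ` times `Δ(ζ) - 2 cos πt`.
  have := hslope.mul (herr.sub hform)
  rw [zero_sub] at this
  refine (this.congr' ?_).trans (le_of_eq ?_)
  · filter_upwards [hne] with ζ h1
    rw [add_sub_cancel_right, ← mul_assoc, div_mul_cancel₀ _ (sub_ne_zero.2 h1)]
  · congr 1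
    field_simp

lemma isOpen_regular (t : ℝ) : IsOpen {ζ | discr p q ζ ≠ mult t + (mult t)⁻¹} :=
  isOpen_ne_fun h.differentiable_discr.continuous continuous_const

lemma differentiableAt_resolvent (hz : discr p q z ≠ mult t + (mult t)⁻¹) :
    DifferentiableAt ℂ (resolvent (op p q t)) z :=
  resolvent_differentiableAt (h.isOpen_regular t) (fun _ hζ => h.mem_resolventSet hζ) hz

/-- A lower bound for the projections onto simple eigenvalues. -/
lemma norm_contourProj_ge {r : ℝ} (hr : 0 < r) (hD : discr p q z = mult t + (mult t)⁻¹)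
    (hF : discrDeriv p q z ≠ 0)
    (hne : ∀ ζ ∈ Metric.closedBall z r, ζ ≠ z → discr p q ζ ≠ mult t + (mult t)⁻¹)
    (g f : L2 (Icc 0 Real.pi)) :
    2 * Real.pi * ‖resForm p q z (mult t) (fun x => conjC2 (g x)) f‖ ≤
      ‖discrDeriv p q z‖ * (‖g‖ * ‖f‖ * ‖contourProj p q t (circ z r)‖) := by
  have hne' : ∀ᶠ ζ in 𝓝[≠] z, discr p q ζ ≠ mult t + (mult t)⁻¹ := by
    filter_upwards [self_mem_nhdsWithin,
      mem_nhdsWithin_of_mem_nhds (Metric.closedBall_mem_nhds z hr)] with ζ h1 h2 using hne ζ h2 h1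
  set L := -resForm p q z (mult t) (fun x => conjC2 (g x)) f / discrDeriv p q z
  have hlim := h.tendsto_residue hD hF hne' g f
  let Λ : (L2 (Icc 0 Real.pi) →L[ℂ] L2 (Icc 0 Real.pi)) →L[ℂ] ℂ :=
    (innerSL ℂ g).comp (ContinuousLinearMap.apply ℂ (L2 (Icc 0 Real.pi)) f)
  have hΛ : ∀ A, Λ A = inner ℂ g (A f) := fun A => rfl
  have hdiff : ∀ ζ ∈ Metric.closedBall z r, ζ ≠ z → DifferentiableAt ℂ
      (fun ζ => inner ℂ g (resolvent (op p q t) ζ f)) ζ := fun ζ hζ hζz =>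
    Λ.differentiableAt.comp ζ (h.differentiableAt_resolvent (hne ζ hζ hζz))
  -- Filling in the limit at `z` makes `Φ` continuous on the closed disc and differentiable off the
  -- centre, so Cauchy's formula evaluates the contour integral as `2πi` times the residue.
  let Φ : ℂ → ℂ := Function.update (fun ζ => (ζ - z) * inner ℂ g (resolvent (op p q t) ζ f)) z L
  have hΦd : ∀ ζ ∈ Metric.closedBall z r, ζ ≠ z → DifferentiableAt ℂ Φ ζ := by
    intro ζ hζ hζz
    have h1 : DifferentiableAt ℂ
        (fun ζ => (ζ - z) * inner ℂ g (resolvent (op p q t) ζ f)) ζ :=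
      (by fun_prop : DifferentiableAt ℂ (fun ζ => ζ - z) ζ).mul (hdiff ζ hζ hζz)
    refine h1.congr_of_eventuallyEq ?_
    filter_upwards [isOpen_ne.mem_nhds hζz] with w hw
    exact Function.update_of_ne hw _ _
  have hΦc : ContinuousOn Φ (Metric.closedBall z r) := by
    intro ζ hζ
    by_cases hζz : ζ = z
    · rw [hζz]
      exact (continuousAt_update_same.2 hlim).continuousWithinAt
    · exact (hΦd ζ hζ hζz).continuousAt.continuousWithinAt
  have hcauchy := Complex.circleIntegral_sub_inv_smul_of_differentiable_on_off_countable
    (countable_singleton z) (Metric.mem_ball_self hr) hΦc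
    (fun ζ hζ => hΦd ζ (Metric.ball_subset_closedBall hζ.1) hζ.2)
  have hΦz : Φ z = L := Function.update_self _ _ _
  have hcirc : ∮ ζ in C(z, r), inner ℂ g (resolvent (op p q t) ζ f) =
      (2 * Real.pi * Complex.I) * L := by
    rw [hΦz, smul_eq_mul] at hcauchy
    rw [← hcauchy]
    refine circleIntegral.integral_congr hr.le fun ζ hζ => ?_
    have hζz : ζ ≠ z := Metric.ne_of_mem_sphere hζ hr.ne'
    have : ζ - z ≠ 0 := sub_ne_zero.2 hζz
    simp only [Φ, Function.update_of_ne hζz, smul_eq_mul]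
    field_simp
  have hint : IntervalIntegrable (fun s => deriv (circ z r) s • resolvent (op p q t) (circ z r s))
      volume 0 1 := by
    refine Continuous.intervalIntegrable (continuous_iff_continuousAt.2 fun s => ?_) _ _
    refine ((contDiff_circ z r).continuous_deriv le_rfl).continuousAt.smul ?_
    have hs : circ z r s ∈ Metric.sphere z r := circleMap_mem_sphere z hr.le _
    exact (h.differentiableAt_resolvent (hne _ (Metric.sphere_subset_closedBall hs)
      (Metric.ne_of_mem_sphere hs hr.ne'))).continuousAt.comp
      (contDiff_circ z r).continuous.continuousAt
  -- `contourProj` carries no normalization by `2πi`, whence the factor `2π` in the estimate.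
  have hproj : inner ℂ g (contourProj p q t (circ z r) f) = (2 * Real.pi * Complex.I) * L := by
    rw [← hΛ, contourProj, ← Λ.intervalIntegral_comp_comm hint, ← hcirc, ← integral_circ]
    refine intervalIntegral.integral_congr fun s _ => ?_
    simp only [hΛ]
    rw [_root_.smul_apply, inner_smul_right, smul_eq_mul]
  have hle : ‖inner ℂ g (contourProj p q t (circ z r) f)‖ ≤
      ‖g‖ * ‖f‖ * ‖contourProj p q t (circ z r)‖ := by
    refine (norm_inner_le_norm _ _).trans ?_
    calc _ ≤ ‖g‖ * (‖contourProj p q t (circ z r)‖ * ‖f‖) := by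
          gcongr; exact ContinuousLinearMap.le_opNorm _ _
      _ = _ := by ring
  rw [hproj, norm_mul, norm_div, norm_neg] at hle
  have h2 : ‖(2 * Real.pi * Complex.I : ℂ)‖ = 2 * Real.pi := by
    simp [abs_of_pos Real.pi_pos]
  rw [h2] at hle
  have hF' : 0 < ‖discrDeriv p q z‖ := norm_pos_iff.2 hF
  calc _ = ‖discrDeriv p q z‖ * (2 * Real.pi *
        (‖resForm p q z (mult t) (fun x => conjC2 (g x)) f‖ / ‖discrDeriv p q z‖)) := by
        field_simp
    _ ≤ _ := by gcongr

end BddPotential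


/-! ### The discriminant near a multiple eigenvalue -/

lemma injOn_nhds_of_hasStrictDerivAt {F : ℂ → ℂ} {F' z : ℂ} (hF : HasStrictDerivAt F F' z)
    (h0 : F' ≠ 0) : ∃ s ∈ 𝓝 z, InjOn F s := by
  have hs : HasStrictFDerivAt F
      ((ContinuousLinearEquiv.unitsEquivAut ℂ (Units.mk0 F' h0) : ℂ ≃L[ℂ] ℂ) : ℂ →L[ℂ] ℂ) z :=
    hF.hasStrictFDerivAt_equiv h0
  exact ⟨(hs.toOpenPartialHomeomorph F).source,
    (hs.toOpenPartialHomeomorph F).open_source.mem_nhds hs.mem_toOpenPartialHomeomorph_source,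
    (hs.toOpenPartialHomeomorph F).injOn⟩

lemma mult_continuous : Continuous mult := by unfold mult; fun_prop

lemma hasDerivAt_cos_pi_mul (t : ℝ) :
    HasDerivAt (fun s => Real.cos (Real.pi * s)) (-Real.sin (Real.pi * t) * Real.pi) t := by
  have h1 : HasDerivAt (fun s : ℝ => Real.pi * s) Real.pi t := by
    simpa using (hasDerivAt_id t).const_mul Real.pi
  exact (Real.hasDerivAt_cos _).comp t h1

lemma eventually_mult_add_inv_ne {t : ℝ} (hs : Real.sin (Real.pi * t) ≠ 0) :
    ∀ᶠ s in 𝓝[≠] t, mult s + (mult s)⁻¹ ≠ mult t + (mult t)⁻¹ := by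
  filter_upwards [(hasDerivAt_cos_pi_mul t).eventually_ne (c := Real.cos (Real.pi * t))
    (mul_ne_zero (neg_ne_zero.2 hs) Real.pi_ne_zero)] with s h1 h2
  rw [mult_add_inv, mult_add_inv] at h2
  have h3 : 2 * Real.cos (Real.pi * s) = 2 * Real.cos (Real.pi * t) := by exact_mod_cast h2
  exact h1 (by linarith)

lemma mult_sq_ne_one_of_add_inv {t : ℝ} (h1 : mult t + (mult t)⁻¹ ≠ 2)
    (h2 : mult t + (mult t)⁻¹ ≠ -2) : mult t ^ 2 ≠ 1 := by
  intro e
  rcases (sq_eq_sq_iff_eq_or_eq_neg (b := (1 : ℂ))).1 (by rw [e, one_pow]) with e | e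
  · exact h1 (by rw [e]; norm_num)
  · exact h2 (by rw [e]; norm_num)

lemma mult_add_inv_ne {t : ℝ} (hs : Real.sin (Real.pi * t) ≠ 0) :
    mult t + (mult t)⁻¹ ≠ 2 ∧ mult t + (mult t)⁻¹ ≠ -2 := by
  have h1 := Real.sin_sq_add_cos_sq (Real.pi * t)
  have h2 : 0 < Real.sin (Real.pi * t) ^ 2 := by positivity
  rw [mult_add_inv]
  constructor
  · intro e
    have : 2 * Real.cos (Real.pi * t) = 2 := by exact_mod_cast e
    nlinarith
  · intro e
    have : 2 * Real.cos (Real.pi * t) = -2 := by exact_mod_cast e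
    nlinarith

namespace BddPotential

variable {p q : ℝ → ℂ} {B : ℝ} (h : BddPotential p q B) {t : ℝ} {z : ℂ}

include h

lemma deriv_discr : deriv (discr p q) = discrDeriv p q :=
  funext fun z => (h.hasDerivAt_discr z).deriv

/-- Were `Δ` constantly equal to `ω + ω⁻¹`, there would be a Bloch solution at a point outside the
strip `|Im z| ≤ 3B` of `abs_im_le`. -/
lemma discr_not_const (hω2 : mult t ^ 2 ≠ 1) :
    ¬∀ z, discr p q z = mult t + (mult t)⁻¹ := by
  intro H
  set z : ℂ := ((3 * B + 1 : ℝ) : ℂ) * Complex.I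
  obtain ⟨v, hv, e0, e1, -⟩ := h.exists_bloch (mult_ne_zero t) hω2 (H z)
  obtain ⟨hs, h0⟩ := h.bloch_spec (z := z) v
  have := h.abs_im_le (norm_mult t) (hs.mono (subset_univ _)) (h.bloch_boundary e0 e1)
    (by rw [h0]; exact hv)
  have hz : z.im = 3 * B + 1 := by simp [z]
  rw [hz] at this
  linarith [le_abs_self (3 * B + 1)]

lemma analyticOnNhd_discr : AnalyticOnNhd ℂ (discr p q) univ :=
  h.differentiable_discr.differentiableOn.analyticOnNhd isOpen_univ

lemma not_eventually_const (hω2 : mult t ^ 2 ≠ 1) (hD : discr p q z = mult t + (mult t)⁻¹) :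
    ¬∀ᶠ ζ in 𝓝 z, discr p q ζ = discr p q z := by
  intro H
  have := h.analyticOnNhd_discr.eq_of_eventuallyEq (g := fun _ => discr p q z)
    (fun _ _ => analyticAt_const) H
  exact h.discr_not_const hω2 fun ζ => (congrFun this ζ).trans hD

lemma eventually_discrDeriv_ne_zero (hω2 : mult t ^ 2 ≠ 1)
    (hD : discr p q z = mult t + (mult t)⁻¹) : ∀ᶠ ζ in 𝓝[≠] z, discrDeriv p q ζ ≠ 0 := by
  have ha : AnalyticOnNhd ℂ (discrDeriv p q) univ := by
    rw [← h.deriv_discr]; exact h.analyticOnNhd_discr.deriv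
  rcases (ha z trivial).eventually_eq_zero_or_eventually_ne_zero with H | H
  · exfalso
    have h0 := ha.eq_of_eventuallyEq (g := fun _ => 0) (fun _ _ => analyticAt_const) H
    refine h.not_eventually_const hω2 hD (Eventually.of_forall fun ζ => ?_)
    exact is_const_of_deriv_eq_zero h.differentiable_discr
      (fun x => by rw [h.deriv_discr]; exact congrFun h0 x) _ _
  · exact H

lemma continuous_discrDeriv : Continuous (discrDeriv p q) := by
  have ha : AnalyticOnNhd ℂ (discrDeriv p q) univ := by
    rw [← h.deriv_discr]; exact h.analyticOnNhd_discr.deriv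
  exact continuousOn_univ.1 ha.continuousOn

/-- Near a multiple eigenvalue there are contours with arbitrarily large projections. -/
lemma exists_contour (ht : t ∈ Ioo (-1 : ℝ) 1) (hs : Real.sin (Real.pi * t) ≠ 0)
    (hD : discr p q z = mult t + (mult t)⁻¹) (hF : discrDeriv p q z = 0) {ε : ℝ} (hε : 0 < ε)
    (C : ℝ) : ∃ γ : ℝ → ℂ, (IsContour γ ∧ γ '' Icc 0 1 ⊆ Metric.ball z ε ∧
      ∀ s ∈ Ioc (-1 : ℝ) 1, EnclosesAtMostOne p q s γ) ∧
      ∃ s : ℝ, (s ∈ Ioc (-1 : ℝ) 1 ∧ γ '' Icc 0 1 ⊆ resolventSet (op p q s)) ∧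
        C ≤ ‖contourProj p q s γ‖ := by
  have hω2 := mult_sq_ne_one hs
  -- The matrix element `(g, f)` of the residue is fixed once; by continuity its numerator keeps at
  -- least half its size nearby.
  obtain ⟨g, f, hgf⟩ := h.exists_resForm_ne_zero hω2 z
  set c := ‖resForm p q z (mult t) (fun x => conjC2 (g x)) f‖ with hc
  have hc0 : 0 < c := norm_pos_iff.2 hgf
  have hform : ∀ᶠ x in 𝓝 z ×ˢ 𝓝 (mult t),
      c / 2 < ‖resForm p q x.1 x.2 (fun x => conjC2 (g x)) f‖ := by
    rw [← nhds_prod_eq]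
    exact (h.continuous_resForm (intervalIntegrable_conj g)
      (intervalIntegrable_L2 f)).norm.continuousAt.eventually
      (lt_mem_nhds (by change c / 2 < c; linarith))
  obtain ⟨P, hP, P', hP', hPP⟩ := eventually_prod_iff.1 hform
  -- `G` dominates `‖g‖ ‖f‖` times the projection norm if that norm is below `C`. Where `‖Δ'‖ G < π
  -- c`, this contradicts `norm_contourProj_ge`.
  set G := (‖g‖ * ‖f‖ + 1) * (|C| + 1) with hG
  have hG0 : 0 < G := by positivity
  have hsmall : ∀ᶠ ζ in 𝓝 z, ‖discrDeriv p q ζ‖ * G < Real.pi * c := by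
    have h1 : Continuous fun ζ => ‖discrDeriv p q ζ‖ * G :=
      h.continuous_discrDeriv.norm.mul_const G
    refine h1.continuousAt.eventually (gt_mem_nhds ?_)
    simp only [hF, norm_zero, zero_mul]
    exact mul_pos Real.pi_pos hc0
  obtain ⟨hne2, hne2'⟩ := mult_add_inv_ne hs
  have hFc := h.differentiable_discr.continuous
  -- Keeping `Δ ≠ ±2` gives `ω² ≠ 1` at any quasimomentum having an eigenvalue in this
  -- neighbourhood, so simplicity can be checked for all `t` at once.
  have hgood : ∀ᶠ ζ in 𝓝 z, ζ ∈ Metric.ball z ε ∧ discr p q ζ ≠ 2 ∧ discr p q ζ ≠ -2 ∧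
      (ζ ≠ z → discrDeriv p q ζ ≠ 0) := by
    filter_upwards [Metric.ball_mem_nhds z hε,
      hFc.continuousAt.eventually (isOpen_ne.mem_nhds (by rw [hD]; exact hne2)),
      hFc.continuousAt.eventually (isOpen_ne.mem_nhds (by rw [hD]; exact hne2')),
      eventually_nhdsWithin_iff.1 (h.eventually_discrDeriv_ne_zero hω2 hD)]
      with ζ h1 h2 h3 h4 using ⟨h1, h2, h3, h4⟩
  obtain ⟨V, hV, hVo, hzV⟩ := eventually_nhds_iff.1 (hgood.and (hsmall.and hP))
  -- The open mapping theorem: every `s` close to `t` has a root of the characteristic equation in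
  -- `V`.
  have hopen : discr p q '' V ∈ 𝓝 (mult t + (mult t)⁻¹) := by
    rw [← hD]
    rcases (h.analyticOnNhd_discr z trivial).eventually_constant_or_nhds_le_map_nhds with H | H
    · exact absurd H (h.not_eventually_const hω2 hD)
    · exact H (image_mem_map (hVo.mem_nhds hzV))
  have hmc : Continuous fun s => mult s + (mult s)⁻¹ :=
    mult_continuous.add (mult_continuous.inv₀ mult_ne_zero)
  have hev : ∀ᶠ s in 𝓝[≠] t, s ∈ Ioo (-1 : ℝ) 1 ∧ P' (mult s) ∧
      mult s + (mult s)⁻¹ ∈ discr p q '' V ∧ mult s + (mult s)⁻¹ ≠ mult t + (mult t)⁻¹ := by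
    filter_upwards [mem_nhdsWithin_of_mem_nhds (Ioo_mem_nhds ht.1 ht.2),
      eventually_nhdsWithin_of_eventually_nhds (mult_continuous.continuousAt.eventually hP'),
      eventually_nhdsWithin_of_eventually_nhds (hmc.continuousAt.eventually hopen),
      eventually_mult_add_inv_ne hs] with s h1 h2 h3 h4 using ⟨h1, h2, h3, h4⟩
  obtain ⟨s, hs1, hs2, ⟨w, hwV, hw⟩, hs4⟩ := hev.exists
  have hwz : w ≠ z := by
    rintro rfl
    exact hs4 (hw.symm.trans hD)
  obtain ⟨⟨-, -, -, hw4⟩, hw5, hw6⟩ := hV w hwV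
  have hFw := hw4 hwz
  obtain ⟨N, hN, hinj⟩ := injOn_nhds_of_hasStrictDerivAt
    ((h.analyticOnNhd_discr w trivial).hasStrictDerivAt)
    (by rw [h.deriv_discr]; exact hFw)
  -- The disc about `w` avoids `z`, the possible zero of `Δ'` in `V`, and is so small that `Δ` is
  -- injective on it; both are independent of the quasimomentum.
  obtain ⟨r, hr, hball⟩ := Metric.nhds_basis_closedBall.mem_iff.1
    (inter_mem hN (inter_mem (hVo.mem_nhds hwV) (isOpen_ne.mem_nhds hwz)))
  have himg : circ w r '' Icc 0 1 ⊆ Metric.sphere w r := circ_image_subset hr.le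
  have hwb : w ∈ Metric.closedBall w r := Metric.mem_closedBall_self hr.le
  have hne : ∀ ζ ∈ Metric.closedBall w r, ζ ≠ w → discr p q ζ ≠ mult s + (mult s)⁻¹ := by
    intro ζ hζ hζw e
    exact hζw (hinj (hball hζ).1 (hball hwb).1 (e.trans hw.symm))
  refine ⟨circ w r, ⟨isContour_circ hr, ?_, ?_⟩, s, ⟨Ioo_subset_Ioc_self hs1, ?_⟩, ?_⟩
  · exact fun ζ hζ => (hV ζ (hball (Metric.sphere_subset_closedBall (himg hζ))).2.1).1.1
  · intro s' _
    refine ⟨?_, ?_⟩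
    · rintro a ⟨⟨y, hy⟩, ha⟩ b ⟨⟨y', hy'⟩, hb⟩
      have ha' := Metric.ball_subset_closedBall (mem_ball_of_encloses hr ha)
      have hb' := Metric.ball_subset_closedBall (mem_ball_of_encloses hr hb)
      exact hinj (hball ha').1 (hball hb').1
        ((h.discr_eq_of_isEigenvector hy).trans (h.discr_eq_of_isEigenvector hy').symm)
    · intro a ha
      have ha' := hball (Metric.ball_subset_closedBall (mem_ball_of_encloses hr ha))
      obtain ⟨⟨-, h2, h3, h4⟩, -⟩ := hV a ha'.2.1
      refine h.algMultiplicity_le_one (fun e => ?_) (h4 ha'.2.2)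
      rw [e] at h2 h3
      exact mult_sq_ne_one_of_add_inv h2 h3
  · exact fun ζ hζ => h.mem_resolventSet (hne ζ (Metric.sphere_subset_closedBall (himg hζ))
      (Metric.ne_of_mem_sphere (himg hζ) hr.ne'))
  · have hge := h.norm_contourProj_ge hr hw hFw hne g f
    have hc2 := hPP hw6 hs2
    simp only at hc2
    by_contra hlt
    rw [not_le] at hlt
    have hle : ‖g‖ * ‖f‖ * ‖contourProj p q s (circ w r)‖ ≤ G := by
      rw [hG]
      gcongr
      · linarith
      · linarith [le_abs_self C]
    have : Real.pi * c < Real.pi * c := by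
      calc Real.pi * c = 2 * Real.pi * (c / 2) := by ring
        _ ≤ 2 * Real.pi * ‖resForm p q w (mult s) (fun x => conjC2 (g x)) f‖ := by gcongr
        _ ≤ _ := hge
        _ ≤ ‖discrDeriv p q w‖ * G := by gcongr
        _ < _ := hw5
    exact lt_irrefl _ this

lemma exists_contours (ht : t ∈ Ioo (-1 : ℝ) 1) (hs : Real.sin (Real.pi * t) ≠ 0)
    (hD : discr p q z = mult t + (mult t)⁻¹) (hF : discrDeriv p q z = 0) {ε : ℝ} (hε : 0 < ε) :
    ∃ γ : ℕ → ℝ → ℂ, (∀ n, IsContour (γ n) ∧ γ n '' Icc 0 1 ⊆ Metric.ball z ε ∧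
      ∀ t ∈ Ioc (-1 : ℝ) 1, EnclosesAtMostOne p q t (γ n)) ∧
    Tendsto (fun n => ⨆ t ∈ {t : ℝ | t ∈ Ioc (-1 : ℝ) 1 ∧
        γ n '' Icc 0 1 ⊆ resolventSet (op p q t)}, ‖contourProj p q t (γ n)‖ₑ)
      atTop (𝓝 ⊤) := by
  choose γ hγ s hs' hC using fun n : ℕ => h.exists_contour ht hs hD hF hε n
  refine ⟨γ, hγ, ?_⟩
  refine tendsto_nhds_top_mono ENNReal.tendsto_nat_nhds_top (Eventually.of_forall fun n => ?_)
  refine le_trans ?_ (le_iSup₂ (f := fun t _ => ‖contourProj p q t (γ n)‖ₑ) (s n) (hs' n))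
  change (n : ENNReal) ≤ _
  rw [← ofReal_norm, ← ENNReal.ofReal_natCast]
  exact ENNReal.ofReal_le_ofReal (hC n)

end BddPotential


/-! ### The projections and the adjoint eigenfunctions -/

lemma pair_add_smul_left {f k u : ℝ → C2} (hf : IntervalIntegrable f volume 0 Real.pi)
    (hk : IntervalIntegrable k volume 0 Real.pi)
    (hu : ContinuousOn u (Icc 0 Real.pi)) (a b : ℂ) :
    pair (fun x => a • f x + b • k x) u = a * pair f u + b * pair k u := by
  rw [← uIcc_of_le Real.pi_pos.le] at hu
  unfold pair
  rw [← intervalIntegral.integral_const_mul, ← intervalIntegral.integral_const_mul,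
    ← intervalIntegral.integral_add ((intervalIntegrable_dot hf hu).const_mul _)
      ((intervalIntegrable_dot hk hu).const_mul _)]
  refine intervalIntegral.integral_congr fun x _ => ?_
  simp [dot]; ring

namespace BddPotential

variable {p q : ℝ → ℂ} {B : ℝ} (h : BddPotential p q B) {t : ℝ} {z : ℂ}

include h

lemma memLp_diracExpr {u g : ℝ → C2} (hu : Continuous u) (hg : Continuous g) :
    MemLp (diracExpr p q u g) 2 (volume.restrict (Icc 0 Real.pi)) := by
  have e : diracExpr p q u g = fun x => -rotCLM (g x) + rotCLM (coefCLM p q 0 x (u x)) := by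
    funext x
    apply C2.ext
    · simp only [diracExpr_apply_zero, PiLp.add_apply, PiLp.neg_apply, rotCLM_apply_zero,
        coefCLM_apply_one]
      ring
    · simp only [diracExpr_apply_one, PiLp.add_apply, PiLp.neg_apply, rotCLM_apply_one,
        coefCLM_apply_zero]
      ring
  have h1 : MemLp (fun x => coefCLM p q 0 x (u x)) 2 (volume.restrict (Icc 0 Real.pi)) := by
    obtain ⟨C, hC⟩ := isCompact_Icc.exists_bound_of_continuousOn
      (hu.continuousOn (s := Icc 0 Real.pi))
    refine MemLp.of_bound (aestronglyMeasurable_apply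
      (h.aestronglyMeasurable_coefCLM 0).restrict hu.aestronglyMeasurable)
      (coefBound B 0 * C) ?_
    filter_upwards [ae_restrict_mem measurableSet_Icc] with x hx
    have hn := h.norm_coefCLM_le (z := 0) (R := 0) (by simp) x
    exact ((coefCLM p q 0 x).le_of_opNorm_le hn _).trans
      (mul_le_mul_of_nonneg_left (hC x hx) ((norm_nonneg _).trans hn))
  have h2 : MemLp (fun x => rotCLM (g x)) 2 (volume.restrict (Icc 0 Real.pi)) :=
    memLp_of_continuousOn (rotCLM.continuous.comp hg).continuousOn
  rw [e]
  exact h2.neg.add (rotCLM.comp_memLp' h1)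

/-- Test functions supported in the open interval satisfy every quasi-periodic condition, so a
vector orthogonal to the domain vanishes. Density is what makes the adjoint a formal adjoint. -/
lemma dense_domain (t : ℝ) : Dense ((op p q t).domain : Set (L2 (Icc 0 Real.pi))) := by
  rw [Submodule.dense_iff_topologicalClosure_eq_top, Submodule.topologicalClosure_eq_top_iff,
    Submodule.eq_bot_iff]
  intro g hg
  have hgi := intervalIntegrable_L2 g
  rw [intervalIntegrable_iff_integrableOn_Icc_of_le Real.pi_pos.le] at hgi
  have key : ∀ i : Fin 2, ∀ᵐ x : ℝ, x ∈ Ioo 0 Real.pi → g x i = 0 := by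
    intro i
    have hgi' : IntegrableOn (fun x => g x i) (Icc 0 Real.pi) :=
      (EuclideanSpace.proj (𝕜 := ℂ) i).integrable_comp hgi
    refine isOpen_Ioo.ae_eq_zero_of_integral_contDiff_smul_eq_zero
      ((hgi'.mono_set Ioo_subset_Icc_self).locallyIntegrableOn) fun χ hχ hχc hχs => ?_
    have hχd : Continuous (deriv χ) := hχ.continuous_deriv (by simp)
    have hχi : ∀ a b : ℝ, ∫ x in a..b, deriv χ x = χ b - χ a := fun a b =>
      intervalIntegral.integral_deriv_eq_sub
        (fun x _ => (hχ.differentiable (by simp)).differentiableAt)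
        (hχd.intervalIntegrable _ _)
    have hχ0 : ∀ x, x ∉ Ioo 0 Real.pi → χ x = 0 := fun x hx =>
      image_eq_zero_of_notMem_tsupport fun hx' => hx (hχs hx')
    let e : C2 := EuclideanSpace.single i 1
    have hu : Continuous fun x => χ x • e := hχ.continuous.smul continuous_const
    have hd : Continuous fun x => deriv χ x • e := hχd.smul continuous_const
    have hprim : IsPrimitive (Icc 0 Real.pi) (fun x => χ x • e) (fun x => deriv χ x • e) := by
      intro a _ b _
      refine ⟨hd.intervalIntegrable _ _, ?_⟩
      rw [intervalIntegral.integral_smul_const, hχi, sub_smul]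
    have hsol : IsSol p q (Icc 0 Real.pi) 0
        (diracExpr p q (fun x => χ x • e) (fun x => deriv χ x • e)) (fun x => χ x • e) :=
      ⟨_, hprim, Eventually.of_forall fun x => by rw [zero_smul, zero_add]⟩
    have hbc : χ Real.pi • e = mult t • χ 0 • e := by
      rw [hχ0 _ (by simp), hχ0 _ (by simp)]; simp
    obtain ⟨y, hy⟩ := exists_L2_of_isSol hsol
    obtain ⟨hyd, -⟩ := op_of_isSol hsol hbc hy (MemLp.coeFn_toLp (h.memLp_diracExpr hu hd))
    have h0 := (Submodule.mem_orthogonal _ _).1 hg y hyd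
    rw [L2.inner_def] at h0
    rw [← setIntegral_eq_integral_of_forall_compl_eq_zero (s := Icc 0 Real.pi), ← h0]
    · refine integral_congr_ae ?_
      filter_upwards [hy] with x hx
      rw [hx, inner_eq_dot]
      fin_cases i <;> simp [dot, e, mul_comm]
    · intro x hx
      rw [hχ0 x fun hx' => hx (Ioo_subset_Icc_self hx'), zero_smul]
  refine Lp.ext ?_
  filter_upwards [Lp.coeFn_zero C2 2 (volume.restrict (Icc 0 Real.pi)),
    ae_restrict_of_ae (key 0), ae_restrict_of_ae (key 1), ae_restrict_mem measurableSet_Icc,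
    ae_restrict_of_ae ((measure_eq_zero_iff_ae_notMem (μ := volume)).1
      ((Set.toFinite {0, Real.pi}).measure_zero volume))] with x h0 h1 h2 h3 h4
  simp only [mem_insert_iff, mem_singleton_iff, not_or] at h4
  have hx : x ∈ Ioo 0 Real.pi :=
    ⟨lt_of_le_of_ne h3.1 (Ne.symm h4.1), lt_of_le_of_ne h3.2 h4.2⟩
  rw [h0]
  exact C2.ext (h1 hx) (h2 hx)

lemma continuous_bloch (z : ℂ) (v : C2) :
    Continuous fun x => v 0 • phi p q z x + v 1 • psi p q z x :=
  ((h.continuous_phi z).const_smul (v 0)).add ((h.continuous_psi z).const_smul (v 1))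

lemma resCoef_add_smul {f k : ℝ → C2} {ω : ℂ} (hf : IntervalIntegrable f volume 0 Real.pi)
    (hk : IntervalIntegrable k volume 0 Real.pi) (a b : ℂ) :
    resCoef₀ p q z ω (fun x => a • f x + b • k x) =
        a * resCoef₀ p q z ω f + b * resCoef₀ p q z ω k ∧
      resCoef₁ p q z ω (fun x => a • f x + b • k x) =
        a * resCoef₁ p q z ω f + b * resCoef₁ p q z ω k := by
  simp only [resCoef₀, resCoef₁,
    pair_add_smul_left hf hk (h.continuous_phi z).continuousOn,
    pair_add_smul_left hf hk (h.continuous_psi z).continuousOn]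
  constructor <;> ring

/-- Eigenfunctions of the adjoint are orthogonal to the range. -/
lemma inner_adjoint_eq_zero {Ψs w : L2 (Icc 0 Real.pi)} {f : ℝ → C2} (hω2 : mult t ^ 2 ≠ 1)
    (hD : discr p q z = mult t + (mult t)⁻¹)
    (hΨs : IsEigenvector (op p q t).adjoint (star z) Ψs)
    (hf : IntervalIntegrable f volume 0 Real.pi) (r0 : resCoef₀ p q z (mult t) f = 0)
    (r1 : resCoef₁ p q z (mult t) f = 0) (hw : w =ᵐ[volume.restrict (Icc 0 Real.pi)] f) :
    inner ℂ Ψs w = 0 := by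
  obtain ⟨u, hu, hb⟩ := h.exists_isSol_boundary_of_resCoef (mult_ne_zero t) hω2 hD hf r0 r1
  obtain ⟨y, hy⟩ := exists_L2_of_isSol hu
  obtain ⟨hyd, hye⟩ := op_of_isSol hu hb hy hw
  obtain ⟨-, hsd, hse⟩ := hΨs
  have hadj := LinearPMap.adjoint_isFormalAdjoint (h.dense_domain t) ⟨Ψs, hsd⟩ ⟨y, hyd⟩
  rw [hse, inner_smul_left] at hadj
  rw [← hye, inner_sub_right, inner_smul_right]
  have e : (starRingEnd ℂ) (star z) = z := star_star z
  rw [e] at hadj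
  exact sub_eq_zero.2 hadj.symm

/-- The inner product of the normalized eigenfunctions is controlled by the derivative of the
discriminant. -/
lemma norm_discrDeriv_le (R : ℝ) : ∃ C, 0 < C ∧ ∀ (t : ℝ) (z : ℂ), ‖z‖ ≤ R → mult t ^ 2 ≠ 1 →
    ∀ Ψ Ψs : L2 (Icc 0 Real.pi), IsEigenvector (op p q t) z Ψ → ‖Ψ‖ = 1 →
      IsEigenvector (op p q t).adjoint (star z) Ψs → ‖Ψs‖ = 1 →
      ‖discrDeriv p q z‖ ≤ C * ‖(inner ℂ Ψs Ψ : ℂ)‖ := by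
  obtain ⟨K, hK0, hK⟩ := h.exists_bound R
  obtain ⟨C₁, hC₁, hN⟩ := exists_integral_norm_le
  obtain ⟨C₂, hC₂, hM⟩ := exists_norm_L2_le
  refine ⟨C₂ * (4 * K ^ 2 * (2 * K + 1) * C₁), by positivity,
    fun t z hz hω2 Ψ Ψs hΨ hΨn hΨs hΨsn => ?_⟩
  have hD := h.discr_eq_of_isEigenvector hΨ
  obtain ⟨v, Y, hv, e0, e1, huniq, hY, hYu⟩ := h.exists_bloch_L2 hω2 hD
  obtain ⟨-, hd, he⟩ := hΨ
  have hgr := (op p q t).mem_graph ⟨Ψ, hd⟩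
  obtain ⟨κ₀, hκ₀⟩ := hYu Ψ _ hgr he
  obtain ⟨k0, k1⟩ := h.resCoef_mem_kernel (mult_ne_zero t) hD Ψs
  -- The residue of `Ψs` lies in the Bloch line, hence equals `κ Y`, and its norm is bounded
  -- uniformly for `‖z‖ ≤ R`.
  obtain ⟨κ, hκ⟩ := huniq !₂[resCoef₀ p q z (mult t) Ψs, resCoef₁ p q z (mult t) Ψs]
    (by simpa using k0) (by simpa using k1)
  have a0 : resCoef₀ p q z (mult t) Ψs = κ * v 0 := by
    simpa using congrArg (fun w : C2 => w 0) hκ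
  have a1 : resCoef₁ p q z (mult t) Ψs = κ * v 1 := by
    simpa using congrArg (fun w : C2 => w 1) hκ
  set F := discrDeriv p q z
  have hnorm : ‖κ • Y‖ ≤ C₂ * (4 * K ^ 2 * (2 * K + 1) * C₁) := by
    refine hM _ (resFun p q z (mult t) Ψs) _ (by positivity) ?_ fun x hx => ?_
    · filter_upwards [Lp.coeFn_smul κ Y, hY] with x h1 h2
      rw [h1, Pi.smul_apply, h2, resFun, a0, a1, smul_add, smul_smul, smul_smul]
    · refine norm_resFun_le (norm_mult t) hC₁.le (hK z hz) (intervalIntegrable_L2 Ψs) ?_ hx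
      simpa [hΨsn] using hN Ψs
  -- The residue map sends `Ψs` to `κ Y` and `κ Y` to `F κ Y`, so it annihilates `F Ψs - κ Y`, which
  -- therefore lies in the range of `L_t - z`.
  have hperp : inner ℂ Ψs (F • Ψs - κ • Y) = 0 := by
    have hV := (h.continuous_bloch z v).intervalIntegrable (μ := volume) 0 Real.pi
    obtain ⟨l0, l1⟩ := h.resCoef_add_smul (z := z) (ω := mult t) (intervalIntegrable_L2 Ψs) hV
      F (-κ)
    obtain ⟨b0, b1⟩ := h.resCoef_bloch e0 e1
    rw [a0, b0] at l0
    rw [a1, b1] at l1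
    refine h.inner_adjoint_eq_zero hω2 hD hΨs
      (((intervalIntegrable_L2 Ψs).smul F).add (hV.smul (-κ)))
      (l0.trans (by ring)) (l1.trans (by ring)) ?_
    filter_upwards [Lp.coeFn_sub (F • Ψs) (κ • Y), Lp.coeFn_smul F Ψs, Lp.coeFn_smul κ Y, hY]
      with x h1 h2 h3 h4
    rw [h1, Pi.sub_apply, h2, h3, Pi.smul_apply, Pi.smul_apply, h4, neg_smul, sub_eq_add_neg]
    rfl
  rw [inner_sub_right, inner_smul_right, inner_smul_right, inner_self_eq_norm_sq_to_K, hΨsn,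
    sub_eq_zero] at hperp
  have hF : F = κ * inner ℂ Ψs Y := by simpa using hperp
  have hκ₀' : ‖κ₀‖ * ‖Y‖ = 1 := by rw [← norm_smul, ← hκ₀, hΨn]
  have hα : ‖(inner ℂ Ψs Ψ : ℂ)‖ = ‖κ₀‖ * ‖(inner ℂ Ψs Y : ℂ)‖ := by
    rw [hκ₀, inner_smul_right, norm_mul]
  calc ‖F‖ = ‖κ‖ * ‖(inner ℂ Ψs Y : ℂ)‖ * (‖κ₀‖ * ‖Y‖) := by rw [hκ₀', mul_one, hF, norm_mul]
    _ = ‖κ • Y‖ * ‖(inner ℂ Ψs Ψ : ℂ)‖ := by rw [hα, norm_smul]; ring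
    _ ≤ _ := by gcongr

end BddPotential


/-! ### Integrability of the reciprocal inner product -/

/-- A gradient inequality: near any point, a non-constant analytic function has derivative at least
of the order of a power less than one of its increment. -/
lemma exists_le_norm_deriv {F : ℂ → ℂ} {z₀ : ℂ} (hF : AnalyticAt ℂ F z₀)
    (hc : ¬∀ᶠ z in 𝓝 z₀, F z = F z₀) :
    ∃ σ c : ℝ, 0 ≤ σ ∧ σ < 1 ∧ 0 < c ∧
      ∀ᶠ z in 𝓝 z₀, c * ‖F z - F z₀‖ ^ σ ≤ ‖deriv F z‖ := by
  have hG : AnalyticAt ℂ (fun z => F z - F z₀) z₀ := hF.sub analyticAt_const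
  obtain ⟨n, g, hg, hg0, hfac⟩ := hG.exists_eventuallyEq_pow_smul_nonzero_iff.2
    (by simpa only [sub_eq_zero] using hc)
  obtain ⟨k, rfl⟩ : ∃ k, n = k + 1 := by
    refine Nat.exists_eq_succ_of_ne_zero ?_
    rintro rfl
    have := hfac.self_of_nhds
    simp only [sub_self, pow_zero, one_smul] at this
    exact hg0 this.symm
  -- With `F - F z₀ = (z - z₀)^(k+1) g`, the derivative is `(z - z₀)^k H` and `H z₀ = (k + 1) g z₀ ≠
  -- 0`.
  set H : ℂ → ℂ := fun z => (k + 1) * g z + (z - z₀) * deriv g z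
  have hH : ContinuousAt H z₀ :=
    (continuousAt_const.mul hg.continuousAt).add
      ((continuousAt_id.sub continuousAt_const).mul hg.deriv.continuousAt)
  have hH0 : H z₀ ≠ 0 := by
    have : (k + 1 : ℂ) ≠ 0 := by exact_mod_cast k.succ_ne_zero
    simpa [H] using mul_ne_zero this hg0
  have hderiv : ∀ᶠ z in 𝓝 z₀, deriv F z = (z - z₀) ^ k * H z := by
    filter_upwards [hfac.eventually_nhds, hg.eventually_analyticAt] with z hz hgz
    have hpow : HasDerivAt (fun w : ℂ => (w - z₀) ^ (k + 1)) ((k + 1 : ℕ) * (z - z₀) ^ k) z := by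
      simpa using ((hasDerivAt_id z).sub_const z₀).fun_pow (k + 1)
    have h1 : HasDerivAt (fun w => F w - F z₀) ((z - z₀) ^ k * H z) z := by
      refine ((hpow.mul hgz.differentiableAt.hasDerivAt).congr_of_eventuallyEq
        (hz.mono fun w hw => ?_)).congr_deriv ?_
      · simpa using hw
      · simp only [H]; push_cast; ring
    simpa using (h1.add_const (F z₀)).deriv
  -- The exponent for which `‖F z - F z₀‖ ^ σ` has exactly the order `‖z - z₀‖ ^ k` of the
  -- derivative.
  set σ : ℝ := k / (k + 1)
  have hk : (0 : ℝ) < k + 1 := by positivity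
  have hσ0 : 0 ≤ σ := by positivity
  set M : ℝ := ‖g z₀‖ + 1
  have hM : 0 < M := by positivity
  set a : ℝ := ‖H z₀‖ / 2
  have ha : 0 < a := half_pos (norm_pos_iff.2 hH0)
  refine ⟨σ, a / M ^ σ, hσ0, (div_lt_one hk).2 (by linarith), by positivity, ?_⟩
  filter_upwards [hderiv, hfac, hg.continuousAt.norm.eventually_lt_const (lt_add_one _),
    hH.norm.eventually_const_lt (half_lt_self (norm_pos_iff.2 hH0))] with z h1 h2 h3 h4
  have hσk : ((k + 1 : ℕ) : ℝ) * σ = (k : ℕ) := by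
    push_cast
    exact mul_div_cancel₀ _ hk.ne'
  have h5 : ‖F z - F z₀‖ ^ σ = ‖z - z₀‖ ^ k * ‖g z‖ ^ σ := by
    rw [h2, norm_smul, norm_pow, Real.mul_rpow (by positivity) (norm_nonneg _),
      ← Real.rpow_natCast, ← Real.rpow_mul (norm_nonneg _), hσk, Real.rpow_natCast]
  rw [h5, h1, norm_mul, norm_pow]
  calc a / M ^ σ * (‖z - z₀‖ ^ k * ‖g z‖ ^ σ)
      = ‖z - z₀‖ ^ k * (a * (‖g z‖ ^ σ / M ^ σ)) := by ring
    _ ≤ ‖z - z₀‖ ^ k * (a * 1) := by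
        gcongr
        exact div_le_one_of_le₀ (Real.rpow_le_rpow (norm_nonneg _) h3.le hσ0) (by positivity)
    _ ≤ ‖z - z₀‖ ^ k * ‖H z‖ := by
        rw [mul_one]; gcongr

lemma exists_le_norm_mult_sub {t : ℝ} (hs : Real.sin (Real.pi * t) ≠ 0) : ∃ c : ℝ, 0 < c ∧
    ∀ᶠ s in 𝓝 t, c * |s - t| ≤ ‖mult s + (mult s)⁻¹ - (mult t + (mult t)⁻¹)‖ := by
  obtain ⟨C, hC, hb⟩ := (HasDerivAtFilter.isTheta_sub (hasDerivAt_cos_pi_mul t)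
    (mul_ne_zero (neg_ne_zero.2 hs) Real.pi_ne_zero)).isBigO_symm.exists_pos
  refine ⟨C⁻¹, inv_pos.2 hC, ?_⟩
  have hb' : ∀ᶠ s in 𝓝 t, ‖s - t‖ ≤ C * ‖Real.cos (Real.pi * s) - Real.cos (Real.pi * t)‖ := by
    simpa [prod_pure, Asymptotics.isBigOWith_iff] using hb
  filter_upwards [hb'] with s h1
  rw [mult_add_inv, mult_add_inv, ← Complex.ofReal_sub, Complex.norm_real, ← mul_sub, norm_mul,
    Real.norm_two]
  rw [inv_mul_le_iff₀ hC]
  rw [Real.norm_eq_abs] at h1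
  nlinarith [norm_nonneg (Real.cos (Real.pi * s) - Real.cos (Real.pi * t))]

lemma integrableOn_abs_sub_rpow {r : ℝ} (hr : -1 < r) (t ε : ℝ) (hε : 0 < ε) :
    IntegrableOn (fun s => |s - t| ^ r) (Ioo (t - ε) (t + ε)) := by
  have h1 : IntervalIntegrable (fun x : ℝ => |x| ^ r) volume 0 ε :=
    (intervalIntegral.intervalIntegrable_rpow' hr).congr fun x hx => by
      rw [uIoc_of_le hε.le] at hx
      simp only [abs_of_pos hx.1]
  have h2 : IntervalIntegrable (fun x : ℝ => |x| ^ r) volume (-ε) 0 := by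
    simpa [div_neg] using (h1.comp_mul_left (c := -1)).symm
  have h3 := (h2.trans h1).comp_sub_right t
  rw [show -ε + t = t - ε by ring, show ε + t = t + ε by ring] at h3
  exact (intervalIntegrable_iff_integrableOn_Ioo_of_le (by linarith)).1 h3

namespace BddPotential

variable {p q : ℝ → ℂ} {B : ℝ} (h : BddPotential p q B)
include h

/-- The reciprocal of the inner product of the normalized eigenfunctions is integrable near any
quasimomentum at which the multipliers are distinct. -/
theorem not_isESS {z₀ : ℂ} (hne : discr p q z₀ ≠ 2) (hne' : discr p q z₀ ≠ -2) :
    ¬IsESS p q z₀ := by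
  rintro ⟨t, -, δ, hδ, lam, Ψ, Ψs, hbr, rfl, htop⟩
  have hI : Ioo (t - δ) (t + δ) ∈ 𝓝 t := Ioo_mem_nhds (by linarith) (by linarith)
  have ht : t ∈ Ioo (t - δ) (t + δ) := mem_of_mem_nhds hI
  have hD : ∀ s ∈ Ioo (t - δ) (t + δ), discr p q (lam s) = mult s + (mult s)⁻¹ := fun s hs =>
    h.discr_eq_of_isEigenvector (hbr.eigen s hs)
  have hlam : ContinuousAt lam t := hbr.continuousOn.continuousAt hI
  rw [hD t ht] at hne hne'
  have hω := mult_sq_ne_one_of_add_inv hne hne'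
  -- The quasimomentum of the branch is arbitrary; `Δ ≠ ±2` at its value alone excludes the zeros of
  -- the sine.
  have hsin : Real.sin (Real.pi * t) ≠ 0 := by
    intro e
    have e1 := Real.sin_sq_add_cos_sq (Real.pi * t)
    rw [e] at e1
    rcases (sq_eq_sq_iff_eq_or_eq_neg (b := (1 : ℝ))).1
        (by linarith : Real.cos (Real.pi * t) ^ 2 = 1 ^ 2) with e2 | e2
    · exact hne (by rw [mult_add_inv, e2]; norm_num)
    · exact hne' (by rw [mult_add_inv, e2]; norm_num)
  obtain ⟨σ, c, hσ0, hσ1, hc, hloj⟩ := exists_le_norm_deriv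
    (h.analyticOnNhd_discr (lam t) trivial) (h.not_eventually_const hω (hD t ht))
  obtain ⟨c', hc', hcos⟩ := exists_le_norm_mult_sub hsin
  obtain ⟨C, hC, hα⟩ := h.norm_discrDeriv_le (‖lam t‖ + 1)
  rw [h.deriv_discr] at hloj
  set K : ℝ := C / (c * c' ^ σ)
  have hK : 0 < K := by positivity
  -- The point `s = t`, where the inner product may vanish, is a null set; elsewhere its positivity
  -- is part of the estimate.
  have key : ∀ᶠ s in 𝓝 t, s ≠ t → ‖(inner ℂ (Ψs s) (Ψ s) : ℂ)‖ₑ⁻¹ ≤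
      ENNReal.ofReal (K * |s - t| ^ (-σ)) := by
    filter_upwards [hlam.eventually hloj, hcos, hI,
      hlam.norm.eventually_lt_const (lt_add_one _),
      (mult_continuous.pow 2).continuousAt.eventually_ne hω] with s h1 h2 hs h3 h4 hst
    have h5 := hα s (lam s) h3.le h4 _ _ (hbr.eigen s hs) (hbr.norm_eigen s hs)
      (hbr.eigen_adjoint s hs) (hbr.norm_eigen_adjoint s hs)
    rw [hD s hs, hD t ht] at h1
    have hpos : 0 < |s - t| := abs_pos.2 (sub_ne_zero.2 hst)
    have h6 : c * (c' ^ σ * |s - t| ^ σ) ≤ C * ‖(inner ℂ (Ψs s) (Ψ s) : ℂ)‖ := by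
      rw [← Real.mul_rpow hc'.le hpos.le]
      refine le_trans ?_ (h1.trans h5)
      gcongr
    have h7 : 0 < ‖(inner ℂ (Ψs s) (Ψ s) : ℂ)‖ :=
      pos_of_mul_pos_right (lt_of_lt_of_le (by positivity) h6) hC.le
    rw [← ofReal_norm, ← ENNReal.ofReal_inv_of_pos h7]
    refine ENNReal.ofReal_le_ofReal ?_
    rw [Real.rpow_neg hpos.le, inv_le_iff_one_le_mul₀ h7]
    have : K * (|s - t| ^ σ)⁻¹ * ‖(inner ℂ (Ψs s) (Ψ s) : ℂ)‖ =
        (C * ‖(inner ℂ (Ψs s) (Ψ s) : ℂ)‖) / (c * (c' ^ σ * |s - t| ^ σ)) := by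
      simp only [K]; field_simp
    rw [this]
    exact (one_le_div (by positivity)).2 h6
  obtain ⟨ε, hε, hball⟩ := Metric.eventually_nhds_iff_ball.1 key
  rw [Real.ball_eq_Ioo] at hball
  have hint := (integrableOn_abs_sub_rpow (r := -σ) (by linarith) t ε hε).const_mul K
  refine (lt_of_le_of_lt ?_ hint.lintegral_lt_top).ne (htop ε hε)
  refine lintegral_mono_ae ?_
  filter_upwards [ae_restrict_mem measurableSet_Ioo,
    ae_restrict_of_ae (Measure.ae_ne volume t)] with s hs hst
  exact hball s hs hst

end BddPotential


/-! ### The spectrum of the operator on the line -/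

lemma IsPrimitive.fun_smul {u g : ℝ → C2} (hu : IsPrimitive univ u g) {X X' : ℝ → ℂ}
    (hX : ∀ x, HasDerivAt X (X' x) x) (hX' : Continuous X') :
    IsPrimitive univ (fun x => X x • u x) (fun x => X' x • u x + X x • g x) := by
  have hXc : Continuous X := continuous_iff_continuousAt.2 fun x => (hX x).continuousAt
  have hle : ∀ a b : ℝ, a ≤ b →
      IntervalIntegrable (fun x => X' x • u x + X x • g x) volume a b ∧
      X b • u b - X a • u a = ∫ x in a..b, (X' x • u x + X x • g x) := by
    intro a b hab
    have huc : ContinuousOn u (uIcc a b) := by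
      rw [uIcc_of_le hab]; exact hu.continuousOn (subset_univ _)
    have hI : IntervalIntegrable (fun x => X' x • u x + X x • g x) volume a b :=
      ((hX'.continuousOn.smul huc).intervalIntegrable).add
        ((hu a trivial b trivial).1.continuousOn_smul hXc.continuousOn)
    refine ⟨hI, ?_⟩
    have key : ∀ i : Fin 2, (X b • u b - X a • u a) i =
        (∫ x in a..b, (X' x • u x + X x • g x)) i := by
      intro i
      obtain ⟨hgi, hui⟩ := hu.coord (subset_univ (Icc a b)) hab i
      have h1 := (primitive_mul hab (hX'.intervalIntegrable a b) hgi
        (fun x _ => by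
          rw [intervalIntegral.integral_eq_sub_of_hasDerivAt (fun y _ => hX y)
            (hX'.intervalIntegrable a x)]
          ring) hui).2
      have h2 := (EuclideanSpace.proj (𝕜 := ℂ) i).intervalIntegral_comp_comm hI
      simpa using h1.trans h2
    exact C2.ext (key 0) (key 1)
  intro a _ b _
  rcases le_total a b with hab | hab
  · exact hle a b hab
  · obtain ⟨h1, h2⟩ := hle b a hab
    refine ⟨h1.symm, ?_⟩
    rw [intervalIntegral.integral_symm, ← h2, neg_sub]

/-- Only the commutator `X' J u` is new; the sign is that of `rotCLM = -J`. -/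
lemma diracExpr_fun_smul (p q : ℝ → ℂ) (X X' : ℝ → ℂ) (u g : ℝ → C2) (x : ℝ) :
    diracExpr p q (fun x => X x • u x) (fun x => X' x • u x + X x • g x) x =
      X x • diracExpr p q u g x - X' x • rotCLM (u x) := by
  apply C2.ext
  · simp only [diracExpr_apply_zero, PiLp.add_apply, PiLp.sub_apply, PiLp.smul_apply, smul_eq_mul,
      rotCLM_apply_zero]
    ring
  · simp only [diracExpr_apply_one, PiLp.add_apply, PiLp.sub_apply, PiLp.smul_apply, smul_eq_mul,
      rotCLM_apply_one]
    ring

/-- The support lies in `[0, 3]`, so rescaled cutoffs only meet the half-line `x ≥ 0`, on which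
Bloch solutions are bounded. -/
lemma exists_cutoff : ∃ (χ : ℝ → ℝ) (D : ℝ), ContDiff ℝ 1 χ ∧ (∀ x, |deriv χ x| ≤ D) ∧
    (∀ x ∉ Icc (0 : ℝ) 3, χ x = 0 ∧ deriv χ x = 0) ∧ ∀ x ∈ Icc (1 : ℝ) 2, χ x = 1 := by
  let f : ContDiffBump (3 / 2 : ℝ) := ⟨1 / 2, 3 / 2, by norm_num, by norm_num⟩
  have hf : ContDiff ℝ 1 f := f.contDiff
  obtain ⟨D, hD⟩ := (f.hasCompactSupport.deriv).exists_bound_of_continuous (hf.continuous_deriv le_rfl)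
  have hz : ∀ x ∉ Icc (0 : ℝ) 3, f x = 0 := by
    intro x hx
    refine f.zero_of_le_dist ?_
    rw [Real.dist_eq, le_abs]
    by_contra! hc
    refine hx ⟨?_, ?_⟩ <;> simp only [f] at hc <;> linarith [hc.1, hc.2]
  refine ⟨f, D, hf, hD, fun x hx => ⟨hz x hx, ?_⟩, fun x hx => ?_⟩
  · have : f =ᶠ[𝓝 x] fun _ => (0 : ℝ) := by
      filter_upwards [isClosed_Icc.isOpen_compl.mem_nhds hx] with y hy using hz y hy
    rw [this.deriv_eq, deriv_const]
  · refine f.one_of_mem_closedBall ?_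
    rw [Metric.mem_closedBall, Real.dist_eq, abs_le]
    constructor <;> simp only [f] <;> linarith [hx.1, hx.2]

lemma norm_sq_eq_integral {y : L2 univ} {v : ℝ → C2} (hy : y =ᵐ[volume.restrict univ] v) :
    ‖y‖ ^ 2 = ∫ x, ‖v x‖ ^ 2 := by
  have h1 : ((‖y‖ ^ 2 : ℝ) : ℂ) = ((∫ x, ‖v x‖ ^ 2 : ℝ) : ℂ) := by
    have h2 := L2.inner_def (𝕜 := ℂ) y y
    rw [inner_self_eq_norm_sq_to_K] at h2
    rw [← integral_complex_ofReal]
    push_cast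
    refine h2.trans ((integral_congr_ae ?_).trans setIntegral_univ)
    filter_upwards [hy] with x hx
    rw [hx, inner_self_eq_norm_sq_to_K]
    simp
  exact_mod_cast h1

section Floquet

variable {p q : ℝ → ℂ} (hp : Function.Periodic p Real.pi) (hq : Function.Periodic q Real.pi)
  {z : ℂ} {u : ℝ → C2}

include hp hq in
lemma IsSol.comp_add_period (hu : IsSol p q univ z 0 u) :
    IsSol p q univ z 0 (fun x => u (x + Real.pi)) := by
  obtain ⟨g, hg, hd⟩ := hu
  refine ⟨fun x => g (x + Real.pi), fun a _ b _ => ?_, ?_⟩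
  · obtain ⟨h1, h2⟩ := hg (a + Real.pi) trivial (b + Real.pi) trivial
    refine ⟨?_, ?_⟩
    · simpa using h1.comp_add_right Real.pi
    · rw [intervalIntegral.integral_comp_add_right (fun x => g x), ← h2]
  · rw [Measure.restrict_univ] at hd ⊢
    filter_upwards [(measurePreserving_add_right volume Real.pi).quasiMeasurePreserving.ae hd]
      with x hx
    simp only [Pi.zero_apply] at hx ⊢
    rw [← hx]
    simp only [diracExpr, hp x, hq x]

variable {B : ℝ} (h : BddPotential p q B) {ω : ℂ}

include hp hq h

/-- `u (x + π) - ω u x` solves the homogeneous system with initial value zero, so the growth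
estimate makes it vanish. -/
lemma BddPotential.apply_add_period (hu : IsSol p q univ z 0 u) (hb : u Real.pi = ω • u 0) {x : ℝ}
    (hx : 0 ≤ x) : u (x + Real.pi) = ω • u x := by
  have h1 := (hu.comp_add_period hp hq).add (hu.smul (-ω))
  rw [smul_zero, add_zero] at h1
  have h2 := h.norm_le_exp (le_refl ‖z‖) (h1.mono (subset_univ (Icc 0 x))) x ⟨hx, le_rfl⟩
  simp only [Pi.add_apply, Pi.neg_apply, Pi.smul_apply, zero_add, hb, neg_smul, add_neg_cancel, norm_zero,
    mul_zero, zero_mul, norm_le_zero_iff] at h2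
  exact add_neg_eq_zero.1 h2

lemma BddPotential.norm_apply_add_nat_mul (hω : ‖ω‖ = 1) (hu : IsSol p q univ z 0 u)
    (hb : u Real.pi = ω • u 0) {x : ℝ} (hx : 0 ≤ x) (n : ℕ) :
    ‖u (x + n * Real.pi)‖ = ‖u x‖ := by
  induction n with
  | zero => simp
  | succ n ih =>
    have := Real.pi_pos
    rw [← ih, show x + ((n + 1 : ℕ) : ℝ) * Real.pi = (x + n * Real.pi) + Real.pi by
      push_cast; ring, h.apply_add_period hp hq hu hb (by positivity), norm_smul, hω, one_mul]

lemma BddPotential.exists_bound_bloch (hω : ‖ω‖ = 1) (hu : IsSol p q univ z 0 u)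
    (hb : u Real.pi = ω • u 0) : ∃ C, ∀ x, 0 ≤ x → ‖u x‖ ≤ C := by
  obtain ⟨C, hC⟩ := isCompact_Icc.exists_bound_of_continuousOn
    (hu.continuousOn (subset_univ (Icc 0 Real.pi)))
  refine ⟨C, fun x hx => ?_⟩
  have hπ := Real.pi_pos
  set n := ⌊x / Real.pi⌋₊
  have h1 : n * Real.pi ≤ x := (le_div_iff₀ hπ).1 (Nat.floor_le (by positivity))
  have h2 : x < (n + 1) * Real.pi := (div_lt_iff₀ hπ).1 (Nat.lt_floor_add_one _)
  have h3 := h.norm_apply_add_nat_mul hp hq hω hu hb (x := x - n * Real.pi) (by linarith) n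
  rw [sub_add_cancel] at h3
  rw [h3]
  exact hC _ ⟨by linarith, by linarith⟩

lemma BddPotential.integral_norm_sq_bloch (hω : ‖ω‖ = 1) (huc : Continuous u)
    (hu : IsSol p q univ z 0 u) (hb : u Real.pi = ω • u 0) (n : ℕ) :
    ∫ x in (0 : ℝ)..n * Real.pi, ‖u x‖ ^ 2 = n * ∫ x in (0 : ℝ)..Real.pi, ‖u x‖ ^ 2 := by
  induction n with
  | zero => simp
  | succ n ih =>
    have hi : ∀ a b, IntervalIntegrable (fun x => ‖u x‖ ^ 2) volume a b := fun a b =>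
      (huc.norm.pow 2).intervalIntegrable a b
    rw [← intervalIntegral.integral_add_adjacent_intervals (hi 0 (n * Real.pi)) (hi _ _), ih]
    have h1 := intervalIntegral.integral_comp_add_right (a := 0) (b := Real.pi)
      (fun x => ‖u x‖ ^ 2) (n * Real.pi)
    rw [show ((n + 1 : ℕ) : ℝ) * Real.pi = Real.pi + n * Real.pi by push_cast; ring]
    rw [zero_add] at h1
    rw [← h1]
    have h2 : ∫ x in (0 : ℝ)..Real.pi, ‖u (x + n * Real.pi)‖ ^ 2 =
        ∫ x in (0 : ℝ)..Real.pi, ‖u x‖ ^ 2 := by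
      refine intervalIntegral.integral_congr fun x hx => ?_
      rw [uIcc_of_le Real.pi_pos.le] at hx
      simp only [h.norm_apply_add_nat_mul hp hq hω hu hb hx.1 n]
    rw [h2]
    push_cast
    ring

/-- A Bloch solution with a unimodular multiplier puts the spectral parameter into the spectrum of
the operator on the line. -/
theorem BddPotential.mem_spectrum_opLine (hω : ‖ω‖ = 1) (huc : Continuous u)
    (hu : IsSol p q univ z 0 u) (hb : u Real.pi = ω • u 0) (h0 : u 0 ≠ 0) :
    z ∈ spectrum (opLine p q) := by
  rintro ⟨R, -, hR⟩
  obtain ⟨C, hC⟩ := h.exists_bound_bloch hp hq hω hu hb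
  obtain ⟨χ, D, hχ, hD, hχ0, hχ1⟩ := exists_cutoff
  have hχ'c : Continuous (deriv χ) := hχ.continuous_deriv le_rfl
  have hπ := Real.pi_pos
  have hC0 : 0 ≤ C := (norm_nonneg _).trans (hC 0 le_rfl)
  have hD0 : 0 ≤ D := (abs_nonneg _).trans (hD 0)
  set κ := ∫ x in (0 : ℝ)..Real.pi, ‖u x‖ ^ 2
  have hκ : 0 < κ := integral_norm_sq_pos huc.continuousOn h0
  obtain ⟨g, hg, hd⟩ := hu
  set K : ℝ := (D * (‖rotCLM‖ * C)) ^ 2 * 3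
  -- If the resolvent `R` existed, the left side would stay bounded as `n` grows.
  have hest : ∀ n : ℕ, 1 ≤ n → n * κ ≤ ‖R‖ ^ 2 * K := by
    intro n hn
    have hn1 : (1 : ℝ) ≤ n := by exact_mod_cast hn
    set L : ℝ := n * Real.pi
    have hL1 : 1 ≤ L := by
      have := Real.pi_gt_three
      nlinarith
    have hL : 0 < L := by linarith
    set X : ℝ → ℂ := fun x => (χ (x / L) : ℂ)
    set X' : ℝ → ℂ := fun x => ((deriv χ (x / L) / L : ℝ) : ℂ)
    have hX : ∀ x, HasDerivAt X (X' x) x := by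
      intro x
      have h1 : HasDerivAt χ (deriv χ (x / L)) (x / L) :=
        ((hχ.differentiable one_ne_zero) _).hasDerivAt
      have h2 : HasDerivAt (fun x => x / L) (1 / L) x := (hasDerivAt_id x).div_const L
      have h3 := (h1.comp x h2).ofReal_comp
      exact h3.congr_deriv (by simp [X', div_eq_mul_inv])
    have hX'c : Continuous X' := by fun_prop
    have hXc : Continuous X := continuous_iff_continuousAt.2 fun x => (hX x).continuousAt
    have hoff : ∀ x ∉ Icc 0 (3 * L), X x = 0 ∧ X' x = 0 := by
      intro x hx
      have hx' : x / L ∉ Icc (0 : ℝ) 3 := by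
        rw [mem_Icc, le_div_iff₀ hL, zero_mul, div_le_iff₀ hL]; exact hx
      simp [X, X', hχ0 _ hx']
    set Y : ℝ → C2 := fun x => X x • u x
    -- `W` is `(L - z) Y`: since `u` solves the equation, only the derivative of the cutoff
    -- survives, of size `1 / L`.
    set W : ℝ → C2 := fun x => -(X' x • rotCLM (u x))
    have hYc : Continuous Y := by fun_prop
    have hWc : Continuous W := by fun_prop
    have hYs : HasCompactSupport Y :=
      HasCompactSupport.intro (K := Icc 0 (3 * L)) isCompact_Icc fun x hx => by
        simp [Y, (hoff x hx).1]
    have hW0 : ∀ x ∉ Icc 0 (3 * L), W x = 0 := fun x hx => by simp [W, (hoff x hx).2]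
    have hWs : HasCompactSupport W := HasCompactSupport.intro isCompact_Icc hW0
    have hYL : MemLp Y 2 (volume.restrict univ) := hYc.memLp_of_hasCompactSupport hYs
    have hWL : MemLp W 2 (volume.restrict univ) := hWc.memLp_of_hasCompactSupport hWs
    have hgr : (hYL.toLp Y, z • hYL.toLp Y + hWL.toLp W) ∈ (opLine p q).graph := by
      rw [opLine_graph]
      refine ⟨Y, _, hg.fun_smul hX hX'c, trivial, hYL.coeFn_toLp, ?_⟩
      have e1 := Lp.coeFn_add (z • hYL.toLp Y) (hWL.toLp W)
      have e2 := Lp.coeFn_smul z (hYL.toLp Y)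
      have e3 := hYL.coeFn_toLp
      have e4 := hWL.coeFn_toLp
      filter_upwards [hd, e1, e2, e3, e4] with x h1 h2 h3 h4 h5
      rw [h2, Pi.add_apply, h3, Pi.smul_apply, h4, h5, diracExpr_fun_smul, h1]
      simp only [Y, W, Pi.zero_apply, add_zero, sub_eq_add_neg, smul_comm z]
    obtain ⟨y, hy, hw⟩ := ((opLine p q).mem_graph_iff).1 hgr
    have hRy := hR y
    simp only at hy hw
    rw [hw, hy, add_sub_cancel_left] at hRy
    have hle : ‖hYL.toLp Y‖ ^ 2 ≤ ‖R‖ ^ 2 * ‖hWL.toLp W‖ ^ 2 := by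
      rw [← mul_pow, ← hRy]
      gcongr
      exact R.le_opNorm _
    rw [norm_sq_eq_integral hYL.coeFn_toLp, norm_sq_eq_integral hWL.coeFn_toLp] at hle
    -- The cutoff equals one on `[L, 2L]`, which consists of `n` periods of mass `κ` each.
    have hlow : n * κ ≤ ∫ x, ‖Y x‖ ^ 2 := by
      have hi : ∀ a b, IntervalIntegrable (fun x => ‖u x‖ ^ 2) volume a b := fun a b =>
        (huc.norm.pow 2).intervalIntegrable a b
      have h1 := h.integral_norm_sq_bloch hp hq hω huc ⟨g, hg, hd⟩ hb n
      have h2 := h.integral_norm_sq_bloch hp hq hω huc ⟨g, hg, hd⟩ hb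
        (2 * n)
      have h3 := intervalIntegral.integral_interval_sub_left (hi 0 (2 * L)) (hi 0 L)
      rw [show (((2 * n : ℕ) : ℝ)) * Real.pi = 2 * L by simp only [L]; push_cast; ring] at h2
      rw [h1, h2] at h3
      have h4 : n * κ = ∫ x in L..2 * L, ‖u x‖ ^ 2 := by
        rw [← h3]; push_cast; ring
      rw [h4, intervalIntegral.integral_of_le (by linarith)]
      have h5 : ∫ x in Ioc L (2 * L), ‖u x‖ ^ 2 = ∫ x in Ioc L (2 * L), ‖Y x‖ ^ 2 := by
        refine setIntegral_congr_fun measurableSet_Ioc fun x hx => ?_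
        have : χ (x / L) = 1 := hχ1 _ ⟨(one_le_div hL).2 hx.1.le, (div_le_iff₀ hL).2 hx.2⟩
        simp [Y, X, this]
      rw [h5]
      refine setIntegral_le_integral ?_ (Eventually.of_forall fun x => by positivity)
      rw [Measure.restrict_univ] at hYL
      exact (memLp_two_iff_integrable_sq_norm hYL.1).1 hYL
    -- The support has length `3L` and the square of the amplitude is of order `L⁻²`, so the
    -- integral is at most `K / L ≤ K`.
    have hup : ∫ x, ‖W x‖ ^ 2 ≤ K := by
      rw [← setIntegral_eq_integral_of_forall_compl_eq_zero (s := Icc 0 (3 * L))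
        fun x hx => by rw [hW0 x hx]; simp]
      have hb : ∀ x ∈ Icc 0 (3 * L), ‖W x‖ ^ 2 ≤ (D / L * (‖rotCLM‖ * C)) ^ 2 := by
        intro x hx
        gcongr
        simp only [W, norm_neg, norm_smul]
        gcongr
        · simp only [X', Complex.norm_real, norm_div, Real.norm_eq_abs, abs_of_pos hL]
          gcongr
          exact hD _
        · exact (rotCLM.le_opNorm _).trans (by gcongr; exact hC x hx.1)
      refine (setIntegral_mono_on ((hWc.norm.pow 2).integrableOn_Icc)
        (integrableOn_const measure_Icc_lt_top.ne) measurableSet_Icc hb).trans ?_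
      rw [setIntegral_const, Measure.real, Real.volume_Icc, sub_zero,
        ENNReal.toReal_ofReal (by positivity), smul_eq_mul]
      have e : 3 * L * (D / L * (‖rotCLM‖ * C)) ^ 2 = K / L := by
        simp only [K]; field_simp
      rw [e]
      exact div_le_self (by positivity) hL1
    exact hlow.trans (hle.trans (by gcongr))
  obtain ⟨n, hn⟩ := exists_nat_gt (‖R‖ ^ 2 * K / κ)
  have h1 := hest (n + 1) (by omega)
  rw [div_lt_iff₀ hκ] at hn
  push_cast at h1
  nlinarith

end Floquet

end Dirac

theorem theorem3 (p q : ℝ → ℂ)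
    (hp : Function.Periodic p Real.pi) (hq : Function.Periodic q Real.pi)
    (hpv : BoundedVariationOn p (Set.Icc 0 Real.pi))
    (hqv : BoundedVariationOn q (Set.Icc 0 Real.pi))
    (t₀ : ℝ) (ht₀ : t₀ ∈ Set.Ioc (-1 : ℝ) 1) (h0 : t₀ ≠ 0) (h1 : t₀ ≠ 1)
    (lam₀ : ℂ) (hlam₀ : Dirac.IsEigenvalue (Dirac.op p q t₀) lam₀)
    (hmult : 2 ≤ Dirac.algMultiplicity (Dirac.op p q t₀) lam₀) :
    Dirac.IsSpectralSingularity p q lam₀ ∧ ¬ Dirac.IsESS p q lam₀ := by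
  obtain ⟨B₁, hB₁⟩ := Dirac.exists_bound_of_boundedVariation hp hpv
  obtain ⟨B₂, hB₂⟩ := Dirac.exists_bound_of_boundedVariation hq hqv
  have h : Dirac.BddPotential p q (max B₁ B₂) :=
    ⟨Dirac.aestronglyMeasurable_of_boundedVariation hp hpv,
      Dirac.aestronglyMeasurable_of_boundedVariation hq hqv,
      fun x => (hB₁ x).trans (le_max_left _ _), fun x => (hB₂ x).trans (le_max_right _ _)⟩
  have ht : t₀ ∈ Ioo (-1 : ℝ) 1 := ⟨ht₀.1, lt_of_le_of_ne ht₀.2 h1⟩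
  -- A zero of the sine would make `t₀` an integer in `(-1, 1)`, that is, `0`.
  have hsin : Real.sin (Real.pi * t₀) ≠ 0 := by
    rw [Real.sin_ne_zero_iff]
    intro n hn
    have hn' : (n : ℝ) = t₀ := mul_right_cancel₀ Real.pi_ne_zero (by rw [hn, mul_comm])
    rw [← hn'] at ht h0
    obtain ⟨h2, h3⟩ := ht
    norm_cast at h2 h3
    have : n = 0 := by omega
    simp [this] at h0
  obtain ⟨y, hy⟩ := hlam₀
  have hD := h.discr_eq_of_isEigenvector hy
  have hω2 := Dirac.mult_sq_ne_one hsin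
  have hF : Dirac.discrDeriv p q lam₀ = 0 := by
    by_contra hF
    have := hmult.trans (h.algMultiplicity_le_one (fun _ => hω2) hF)
    norm_num at this
  refine ⟨⟨?_, fun ε hε => h.exists_contours ht hsin hD hF hε⟩, ?_⟩
  · obtain ⟨v, hv, e0, e1, -⟩ := h.exists_bloch (Dirac.mult_ne_zero t₀) hω2 hD
    obtain ⟨hs, hv0⟩ := h.bloch_spec (z := lam₀) v
    exact h.mem_spectrum_opLine hp hq (Dirac.norm_mult t₀) (h.continuous_bloch lam₀ v) hs
      (h.bloch_boundary e0 e1) (by simpa only [hv0] using hv)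
  · obtain ⟨h2, h3⟩ := Dirac.mult_add_inv_ne hsin
    exact h.not_isESS (by rwa [hD]) (by rwa [hD])
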